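/- Let $Y$ be a closed (compact, Hausdorff, without boundary) smooth manifold of dimension $2n+1$, $n\ge 0$. A contact form on $Y$ is a smooth one-form $\sigma$ with $\sigma\wedge(d\sigma)^n$ nowhere zero; $Y$ is then oriented by $\sigma\wedge(d\sigma)^n$. Its Reeb vector field is the vector field $\xi$ with $\sigma(\xi)=1$ and $\xi\lrcorner d\sigma=0$. Put $$\mathrm{vol}_\sigma=\frac{1}{2^n\,n!}\,\sigma\wedge(d\sigma)^n,\qquad \mathrm{Vol}_\sigma(Y)=\int_Y \mathrm{vol}_\sigma ,$$ so that in dimension five ($n=2$) $\mathrm{Vol}_\sigma(Y)=\frac18\int_Y\sigma\wedge d\sigma\wedge d\sigma$. 1. (Reeb dependence.) $\mathrm{Vol}_\sigma(Y)$ depends only on $\xi$: contact forms with the same Reeb vector field have the same contact volume. Hence there is a functional $\mathrm{Vol}$ with $\mathrm{Vol}(\xi)=\mathrm{Vol}_\sigma(Y)$ whenever $\xi$ is the Reeb vector field of the contact form $\sigma$. 2. (First variation.) Let $\sigma_t$, $t\in(-\epsilon,\epsilon)$, be a smooth family of contact forms with $\sigma_0=\sigma$ and Reeb vector fields $\xi_t$,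 and let $\xi'=\frac{d}{dt}\xi_t|_{t=0}$. Then $$\frac{d}{dt}\Big|_{t=0}\mathrm{Vol}(\xi_t)=d\mathrm{Vol}_\sigma[\xi']:=-(n+1)\int_Y\sigma(\xi')\,\mathrm{vol}_\sigma ;$$ for $n=2$ the constant is $-3$. 3. (Second variation.) Let $\sigma_t$ be a smooth family of contact forms with $\sigma_0=\sigma$, Reeb vector fields $\xi_t$ and $\xi''=\frac{d}{dt}\xi_t|_{t=0}$, and let $\xi'$ be a smooth vector field with $\mathcal L_{\xi'}\sigma=0$. Then $$\frac{d}{dt}\Big|_{t=0}d\mathrm{Vol}_{\sigma_t}[\xi']=(n+1)(n+2)\int_Y\sigma(\xi')\,\sigma(\xi'')\,\mathrm{vol}_\sigma ;$$ for $n=2$ the constant is $12$. Likewise, if $\sigma_{s,t}$ is a smooth two-parameter family of contact forms near $(s,t)=(0,0)$, with $\sigma_{0,0}=\sigma$ and Reeb vector fields $\xi_{s,t}$, such that $\partial_s\xi_{s,t}|_{s=0}=\xi'$ for all $t$ and $\partial_t\xi_{0,t}|_{t=0}=\xi''$, where $\xi'$ is smooth and $\mathcal L_{\xi'}\sigma=0$,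 then $$\partial_t|_{t=0}\,\partial_s|_{s=0}\mathrm{Vol}(\xi_{s,t})=(n+1)(n+2)\int_Y\sigma(\xi')\,\sigma(\xi'')\,\mathrm{vol}_\sigma .$$ 4. (Strict convexity.) If $\sigma$ is a contact form and $\xi'\neq 0$ is a smooth vector field with $\mathcal L_{\xi'}\sigma=0$, then $(n+1)(n+2)\int_Y\sigma(\xi')^2\,\mathrm{vol}_\sigma>0$. Moreover, let $\xi$ be the Reeb vector field of $\sigma$ and let $C$ be a convex set of vector fields such that $\xi\in C$ and every $\zeta\in C$ is the Reeb vector field of some contact form on $Y$ and satisfies $\mathcal L_\zeta\sigma=0$. Then $\mathrm{Vol}$ is strictly convex on $C$. -/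

import Mathlib

open scoped Manifold ContDiff Topology

noncomputable section

namespace ContactVolume

/-! ### Exterior algebra at a point -/

section Wedge

variable {V : Type*} [AddCommGroup V] [Module ℝ V] [TopologicalSpace V]

/-- The wedge product of alternating forms, with the convention that
`(α ∧ β) (v₁, …, v_{k+l})` is the sum over `(k, l)`-shuffles `π` of
`sign π * α (v_{π 1}, …, v_{π k}) * β (v_{π (k+1)}, …, v_{π (k+l)})`;
in particular `(α ∧ β) (u, v) = α u * β v - α v * β u` for one-forms. -/
def wedgeAlg {k l : ℕ} (α : V [⋀^Fin k]→L[ℝ] ℝ) (β : V [⋀^Fin l]→L[ℝ] ℝ) :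
    V [⋀^Fin (k + l)]→ₗ[ℝ] ℝ :=
  ((LinearMap.mul' ℝ ℝ).compAlternatingMap
    (α.toAlternatingMap.domCoprod β.toAlternatingMap)).domDomCongr finSumFinEquiv

theorem continuous_wedgeAlg {k l : ℕ} (α : V [⋀^Fin k]→L[ℝ] ℝ) (β : V [⋀^Fin l]→L[ℝ] ℝ) :
    Continuous (fun v => wedgeAlg α β v) := by
  simp only [wedgeAlg, AlternatingMap.domDomCongr_apply, LinearMap.compAlternatingMap_apply,
    AlternatingMap.domCoprod_apply, sum_apply, map_sum]
  refine continuous_finsetSum _ fun π _ => ?_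
  induction π using Quotient.inductionOn' with
  | _ π =>
    rw [AlternatingMap.domCoprod.summand_mk'']
    have hα : Continuous fun v : Fin (k + l) → V =>
        α (fun i => v (finSumFinEquiv (π (Sum.inl i)))) := α.cont.comp (by fun_prop)
    have hβ : Continuous fun v : Fin (k + l) → V =>
        β (fun i => v (finSumFinEquiv (π (Sum.inr i)))) := β.cont.comp (by fun_prop)
    rcases Int.units_eq_one_or (Equiv.Perm.sign π) with h | h
    · rw [h, one_smul]
      exact hα.mul hβ
    · rw [h, Units.neg_smul, one_smul]
      refine (hα.mul hβ).neg.congr fun v => ?_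
      exact (map_neg (LinearMap.mul' ℝ ℝ) (MultilinearMap.domDomCongr π
        (MultilinearMap.domCoprod (α.toAlternatingMap : MultilinearMap ℝ (fun _ => V) ℝ)
          (β.toAlternatingMap : MultilinearMap ℝ (fun _ => V) ℝ)) (v ∘ finSumFinEquiv))).symm

/-- The wedge product of two (continuous) alternating forms, see `wedgeAlg`. -/
def wedge {k l : ℕ} (α : V [⋀^Fin k]→L[ℝ] ℝ) (β : V [⋀^Fin l]→L[ℝ] ℝ) :
    V [⋀^Fin (k + l)]→L[ℝ] ℝ :=
  { wedgeAlg α β with cont := continuous_wedgeAlg α β }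

/-- `α ∧ β ∧ ⋯ ∧ β` (`n` factors `β`) for a one-form `α` and a two-form `β`. -/
def wedgePow (α : V [⋀^Fin 1]→L[ℝ] ℝ) (β : V [⋀^Fin 2]→L[ℝ] ℝ) :
    (n : ℕ) → V [⋀^Fin (2 * n + 1)]→L[ℝ] ℝ
  | 0 => α
  | n + 1 => show V [⋀^Fin (2 * n + 1 + 2)]→L[ℝ] ℝ from wedge (wedgePow α β n) β

end Wedge

/-! ### Differential forms on a manifold -/

section Forms

/-- Euclidean space of dimension `m`. -/
abbrev Euc (m : ℕ) : Type := EuclideanSpace ℝ (Fin m)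

/-- (Not necessarily smooth) differential `k`-forms on an `m`-dimensional manifold `Y`. -/
abbrev DForm (m : ℕ) (Y : Type*) [TopologicalSpace Y] [ChartedSpace (Euc m) Y] (k : ℕ) :
    Type _ :=
  (y : Y) → TangentSpace (𝓡 m) y [⋀^Fin k]→L[ℝ] ℝ

/-- (Not necessarily smooth) vector fields on an `m`-dimensional manifold `Y`. -/
abbrev VField (m : ℕ) (Y : Type*) [TopologicalSpace Y] [ChartedSpace (Euc m) Y] : Type _ :=
  (y : Y) → TangentSpace (𝓡 m) y

variable {m : ℕ} {Y : Type*} [TopologicalSpace Y] [ChartedSpace (Euc m) Y]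

/-- The coordinate expression of a form in the chart around `p`: its pullback
`((chartAt p)⁻¹)^* η`, a form on (the target of the chart in) Euclidean space. -/
def coordForm {k : ℕ} (p : Y) (η : DForm m Y k) : Euc m → Euc m [⋀^Fin k]→L[ℝ] ℝ := fun x =>
  (η ((chartAt (Euc m) p).symm x)).compContinuousLinearMap
    (mfderiv (𝓡 m) (𝓡 m) (chartAt (Euc m) p).symm x)

/-- The coordinate expression of a vector field in the chart around `p`. -/
def coordField (p : Y) (X : VField m Y) : Euc m → Euc m := fun x =>
  mfderiv (𝓡 m) (𝓡 m) (chartAt (Euc m) p) ((chartAt (Euc m) p).symm x)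
    (X ((chartAt (Euc m) p).symm x))

/-- Smoothness of a differential form. -/
def IsSmoothForm {k : ℕ} (η : DForm m Y k) : Prop :=
  ∀ p : Y, ContDiffOn ℝ ∞ (coordForm p η) (chartAt (Euc m) p).target

/-- Smoothness of a vector field. -/
def IsSmoothField [IsManifold (𝓡 m) ∞ Y] (X : VField m Y) : Prop :=
  ContMDiff (𝓡 m) (𝓡 m).tangent ∞ (fun y => (⟨y, X y⟩ : TangentBundle (𝓡 m) Y))

/-- A family of differential forms, with parameter in the open set `U`, that is jointly smooth
in the parameter and the point. -/
def IsSmoothFamily {P : Type*} [NormedAddCommGroup P] [NormedSpace ℝ P] {k : ℕ}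
    (U : Set P) (η : P → DForm m Y k) : Prop :=
  ∀ p : Y, ContDiffOn ℝ ∞ (fun q : P × Euc m => coordForm p (η q.1) q.2)
    (U ×ˢ (chartAt (Euc m) p).target)

/-- The exterior derivative of a form, computed at each point `y` in the chart around `y`. -/
def dForm {k : ℕ} (η : DForm m Y k) : DForm m Y (k + 1) := fun y =>
  (extDeriv (coordForm y η) (chartAt (Euc m) y y)).compContinuousLinearMap
    (mfderiv (𝓡 m) (𝓡 m) (chartAt (Euc m) y) y)

/-- The Lie derivative `L_X σ` of a one-form, computed at each point `y` in the chart around `y`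
by the coordinate formula `(L_X σ)(v) = (D σ [X])(v) + σ (D X [v])`, i.e.
`(L_X σ)_i = X^j ∂_j σ_i + σ_j ∂_i X^j`. -/
def lieDeriv (X : VField m Y) (σ : DForm m Y 1) (y : Y) (v : TangentSpace (𝓡 m) y) : ℝ :=
  let x : Euc m := chartAt (Euc m) y y
  let w : Euc m := mfderiv (𝓡 m) (𝓡 m) (chartAt (Euc m) y) y v
  (fderiv ℝ (coordForm y σ) x (coordField y X x)) (fun _ => w) +
    coordForm y σ x (fun _ => fderiv ℝ (coordField y X) x w)

/-- The vector field `X` preserves the one-form `σ`: `L_X σ = 0`. -/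
def Preserves (X : VField m Y) (σ : DForm m Y 1) : Prop :=
  ∀ (y : Y) (v : TangentSpace (𝓡 m) y), lieDeriv X σ y v = 0

/-- The function `σ(X)`, for a one-form `σ` and a vector field `X`. -/
def pair (σ : DForm m Y 1) (X : VField m Y) (y : Y) : ℝ := σ y (fun _ => X y)

/-- The component of a top-degree form in the chart around `p`:
`((chartAt p)⁻¹)^* η = topCoeff p η dx¹ ∧ ⋯ ∧ dxᵐ`. -/
def topCoeff (p : Y) (η : DForm m Y m) (x : Euc m) : ℝ :=
  coordForm p η x (fun i => EuclideanSpace.basisFun (Fin m) ℝ i)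

variable (m Y) in
/-- A smooth partition of unity subordinate to the cover of `Y` by chart domains. -/
def partUnity [IsManifold (𝓡 m) ∞ Y] [T2Space Y] [SigmaCompactSpace Y] :
    SmoothPartitionOfUnity Y (𝓡 m) Y :=
  (SmoothPartitionOfUnity.exists_isSubordinate_chartAt_source (𝓡 m) Y).choose

/-- The integral over the compact manifold `Y`, with the orientation for which the nowhere
vanishing top-degree form `ν` is positive, of the top-degree form `η`:
the sum over a partition of unity of the integrals computed in charts, a chart on which `ν` is
negative being counted with a minus sign. -/
def integral [IsManifold (𝓡 m) ∞ Y] [T2Space Y] [CompactSpace Y]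
    (ν η : DForm m Y m) : ℝ :=
  ∑ᶠ p : Y, ∫ x in (chartAt (Euc m) p).target,
    partUnity m Y p ((chartAt (Euc m) p).symm x) *
      (Real.sign (topCoeff p ν x) * topCoeff p η x)

end Forms

/-! ### Contact forms -/

section Contact

variable {n : ℕ} {Y : Type*} [TopologicalSpace Y] [ChartedSpace (Euc (2 * n + 1)) Y]

/-- `vol_σ = σ ∧ ω_T ^ n / n!` with `ω_T = dσ / 2`, i.e. `σ ∧ (dσ) ^ n / (2 ^ n * n!)`. -/
def volForm (σ : DForm (2 * n + 1) Y 1) : DForm (2 * n + 1) Y (2 * n + 1) := fun y =>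
  ((2 : ℝ) ^ n * (n.factorial : ℝ))⁻¹ • wedgePow (σ y) (dForm σ y) n

/-- `σ` is a contact form: smooth, with `σ ∧ (dσ) ^ n` nowhere zero. -/
def IsContact (σ : DForm (2 * n + 1) Y 1) : Prop :=
  IsSmoothForm σ ∧ ∀ y, wedgePow (σ y) (dForm σ y) n ≠ 0

/-- `ξ` is the Reeb vector field of `σ`: a smooth vector field with `σ(ξ) = 1` and
`dσ(ξ, ·) = 0`. -/
def IsReeb [IsManifold (𝓡 (2 * n + 1)) ∞ Y] (σ : DForm (2 * n + 1) Y 1) (ξ : VField (2 * n + 1) Y) : Prop :=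
  IsSmoothField ξ ∧ (∀ y, pair σ ξ y = 1) ∧
    ∀ (y : Y) (v : TangentSpace (𝓡 (2 * n + 1)) y), dForm σ y ![ξ y, v] = 0

variable [IsManifold (𝓡 (2 * n + 1)) ∞ Y] [T2Space Y] [CompactSpace Y]

/-- `∫_Y f vol_σ`, where `Y` is oriented by the contact form `σ`, i.e. by `vol_σ`. -/
def contactIntegral (σ : DForm (2 * n + 1) Y 1) (f : Y → ℝ) : ℝ :=
  integral (volForm σ) (fun y => f y • volForm σ y)

/-- The contact volume `∫_Y vol_σ`, where `Y` is oriented by the contact form `σ`. -/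
def contactVolume (σ : DForm (2 * n + 1) Y 1) : ℝ :=
  integral (volForm σ) (volForm σ)

end Contact

end ContactVolume

end

/-!
Write `ν` for a reference volume form `vol_σ` and `ratio ν η` for the function `η / ν`. All the
contact volumes and integrals in question are integrals of such functions against one fixed measure
`volMeasure` (the Riesz measure of `g ↦ ∫ g |ν|`), so that they can be differentiated under the
integral sign. What has to be understood is the derivative `variation ν σ α` of `vol` at `σ` in the
direction of a one-form `α`, that is, of
`α ∧ (dσ) ^ n + n σ ∧ dα ∧ (dσ) ^ (n - 1)` up to the factor `1 / (2 ^ n n!)`.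

The main tool is Stokes' theorem (`integral_stokesFun`) for the form `f σ ∧ α ∧ (dσ) ^ (n - 1)`,
where `df = -ι_X dσ`. With the pointwise identity
`σ(X) α ∧ (dσ) ^ n + n σ ∧ (α ∧ ι_X dσ) ∧ (dσ) ^ (n - 1) = α(X) σ ∧ (dσ) ^ n`, valid for top-degree
forms (`skewSumDeriv_contract`), it expresses `∫ f * variation` through integrals without
derivatives of `α`. If `ξ` is the Reeb field of `σ`, the same identity gives
`α ∧ (dσ) ^ n = α(ξ) σ ∧ (dσ) ^ n`. The consequences are as follows.

* Reeb dependence (`IsReeb.contactVolume_eq`). If `σ` and `τ` have the Reeb field `ξ`, then `τ - σ`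
  and `d (τ - σ)` vanish on `ξ`, so that the volume is constant along the segment from `σ` to `τ`:
  the forms on the segment need not be contact, but the integral of their signed volume is
  constant. The same holds after multiplication with a locally constant function, and this shows
  that `σ` and `τ` define the same orientation (`IsReeb.ratio_pos`).
* First variation (`hasDerivAt_contactVolume`). Take `f = 1`, `X = 0`, and use
  `α(ξ) = -σ(ξ')`, the derivative of `σ_t(ξ_t) = 1`.
* Second variation (`hasDerivAt_contactIntegral_pair`). If `L_X σ = 0`, then Cartan's formula says
  `d (σ(X)) = -ι_X dσ` (`Preserves.fderiv_pair`), and one takes `f = σ(X)`. The mixed derivative of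
  a two-parameter family is the second variation of its first variation.
* Positivity (`contactIntegral_pair_mul_self_pos`). A field `X` with `L_X σ = 0` is determined by
  the function `σ(X)`, since `(σ, dσ)` is nondegenerate.
* Strict convexity (`strictConvexOn_contactVolume`). For `ζ` in the convex set `C` the function
  `σ(ζ)` is positive: at its minimum `ζ` is a multiple of `ξ`, and if it were not a positive
  multiple, a convex combination of `ζ` and `ξ` would vanish there, although it is a Reeb field. Then `ζ` is
  the Reeb field of `σ / σ(ζ)`, whose volume form is `σ(ζ) ^ (-(n + 1)) vol_σ`. Hence
  `Vol(ζ) = ∫ σ(ζ) ^ (-(n + 1)) vol_σ`, and `x ↦ x ^ (-(n + 1))` is strictly convex.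

The forms are handled through their components: a top-degree form `α ∧ β ^ n` is a signed sum over
permutations, `skewSum`, and Stokes' theorem reduces to the vanishing of the integral of a partial
derivative of a function with compact support (`setIntegral_stokes`).
-/

noncomputable section

namespace ContactVolume

/-! ### Exterior algebra: components of `α ∧ β ^ n` -/

section SkewSum

variable {n : ℕ}

/-- The first entry `2 i + 1` of the `i`-th pair in `{1, …, 2 n}`. -/
def pairFst (i : Fin n) : Fin (2 * n + 1) := ⟨2 * i + 1, by omega⟩

/-- The second entry `2 i + 2` of the `i`-th pair in `{1, …, 2 n}`. -/
def pairSnd (i : Fin n) : Fin (2 * n + 1) := ⟨2 * i + 2, by omega⟩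

/-- The complete antisymmetrization of `a ⊗ b ⊗ ⋯ ⊗ b` (`n` factors `b`) over `2 n + 1` indices:
the component of `α ∧ β ^ n`, if `a` consists of the components of the one-form `α` and
`β i j = b i j - b j i`. -/
def skewSum (a : Fin (2 * n + 1) → ℝ) (b : Fin (2 * n + 1) → Fin (2 * n + 1) → ℝ) : ℝ :=
  ∑ π : Equiv.Perm (Fin (2 * n + 1)), ((Equiv.Perm.sign π : ℤ) : ℝ) *
    (a (π 0) * ∏ k : Fin n, b (π (pairFst k)) (π (pairSnd k)))

/-- The derivative of `skewSum a b` with respect to `b` in the direction `d`. -/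
def skewSumDeriv (a : Fin (2 * n + 1) → ℝ) (b d : Fin (2 * n + 1) → Fin (2 * n + 1) → ℝ) : ℝ :=
  ∑ k : Fin n, ∑ π : Equiv.Perm (Fin (2 * n + 1)), ((Equiv.Perm.sign π : ℤ) : ℝ) *
    (a (π 0) * (d (π (pairFst k)) (π (pairSnd k)) *
      ∏ j ∈ Finset.univ.erase k, b (π (pairFst j)) (π (pairSnd j))))

theorem sum_sign_mul_swap {m : ℕ} {i j : Fin m} (hij : i ≠ j) (F : Equiv.Perm (Fin m) → ℝ) :
    ∑ π, ((Equiv.Perm.sign π : ℤ) : ℝ) * F (π * Equiv.swap i j) =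
      -∑ π, ((Equiv.Perm.sign π : ℤ) : ℝ) * F π := by
  rw [← Equiv.sum_comp (Equiv.mulRight (Equiv.swap i j))
    (fun π => ((Equiv.Perm.sign π : ℤ) : ℝ) * F π), ← Finset.sum_neg_distrib]
  refine Finset.sum_congr rfl fun π _ => ?_
  simp [Equiv.Perm.sign_mul, Equiv.Perm.sign_swap hij]

theorem sum_sign_mul_eq_zero {m : ℕ} {i j : Fin m} (hij : i ≠ j) (F : Equiv.Perm (Fin m) → ℝ)
    (hF : ∀ π, F (π * Equiv.swap i j) = F π) :
    ∑ π, ((Equiv.Perm.sign π : ℤ) : ℝ) * F π = 0 := by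
  have h := sum_sign_mul_swap hij F
  simp only [hF] at h
  linarith

theorem pairFst_ne_pairSnd (i j : Fin n) : pairFst i ≠ pairSnd j := by
  simp only [pairFst, pairSnd, ne_eq, Fin.mk.injEq]; omega

theorem pairFst_ne_zero (i : Fin n) : pairFst i ≠ 0 := by
  simp [pairFst, Fin.ext_iff]

theorem pairSnd_ne_zero (i : Fin n) : pairSnd i ≠ 0 := by
  simp [pairSnd, Fin.ext_iff]

theorem pairFst_ne {i j : Fin n} (h : i ≠ j) : pairFst i ≠ pairFst j := by
  simp only [pairFst, ne_eq, Fin.mk.injEq]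
  intro h'; exact h (Fin.ext (by omega))

theorem pairSnd_ne {i j : Fin n} (h : i ≠ j) : pairSnd i ≠ pairSnd j := by
  simp only [pairSnd, ne_eq, Fin.mk.injEq]
  intro h'; exact h (Fin.ext (by omega))

theorem skewSumDeriv_transpose (a : Fin (2 * n + 1) → ℝ)
    (b d : Fin (2 * n + 1) → Fin (2 * n + 1) → ℝ) :
    skewSumDeriv a b (fun i j => d j i) = -skewSumDeriv a b d := by
  unfold skewSumDeriv
  rw [← Finset.sum_neg_distrib]
  refine Finset.sum_congr rfl fun k _ => ?_
  rw [← sum_sign_mul_swap (pairFst_ne_pairSnd k k)]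
  refine Finset.sum_congr rfl fun π _ => ?_
  simp only [Equiv.Perm.mul_apply, Equiv.swap_apply_left, Equiv.swap_apply_right]
  rw [Equiv.swap_apply_of_ne_of_ne (pairFst_ne_zero k).symm (pairSnd_ne_zero k).symm]
  congr 3
  refine Finset.prod_congr rfl fun j hj => ?_
  have hj : j ≠ k := Finset.ne_of_mem_erase hj
  rw [Equiv.swap_apply_of_ne_of_ne (pairFst_ne hj) (pairFst_ne_pairSnd j k),
    Equiv.swap_apply_of_ne_of_ne (pairFst_ne_pairSnd k j).symm (pairSnd_ne hj)]

theorem hasDerivAt_skewSum {a : ℝ → Fin (2 * n + 1) → ℝ}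
    {b : ℝ → Fin (2 * n + 1) → Fin (2 * n + 1) → ℝ} {a' : Fin (2 * n + 1) → ℝ}
    {b' : Fin (2 * n + 1) → Fin (2 * n + 1) → ℝ} {t : ℝ}
    (ha : ∀ i, HasDerivAt (fun s => a s i) (a' i) t)
    (hb : ∀ i j, HasDerivAt (fun s => b s i j) (b' i j) t) :
    HasDerivAt (fun s => skewSum (a s) (b s))
      (skewSum a' (b t) + skewSumDeriv (a t) (b t) b') t := by
  unfold skewSum skewSumDeriv
  rw [Finset.sum_comm, ← Finset.sum_add_distrib]
  refine HasDerivAt.fun_sum fun π _ => ?_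
  have h := ((ha (π 0)).mul (HasDerivAt.fun_finsetProd (u := Finset.univ)
    fun k (_ : k ∈ Finset.univ) => hb (π (pairFst k)) (π (pairSnd k)))).const_mul
      (((Equiv.Perm.sign π : ℤ) : ℝ))
  refine h.congr_deriv ?_
  simp only [smul_eq_mul, Finset.mul_sum, mul_add]
  congr 1
  refine Finset.sum_congr rfl fun k _ => ?_
  ring

end SkewSum

section Wedge

theorem update_pair_zero {V : Type*} (u u' w : V) : Function.update ![u, w] 0 u' = ![u', w] := by
  ext i; fin_cases i <;> rfl

theorem update_pair_one {V : Type*} (u w w' : V) : Function.update ![u, w] 1 w' = ![u, w'] := by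
  ext i; fin_cases i <;> rfl

variable {V : Type*} [AddCommGroup V] [Module ℝ V] [TopologicalSpace V]

/-- The wedge product as a sum over all permutations instead of shuffles: for antisymmetrizations of
multilinear maps `M` and `N`, it is the antisymmetrization of `M ⊗ N`. -/
theorem wedge_apply_of_alternatization {k l : ℕ} (α : V [⋀^Fin k]→L[ℝ] ℝ)
    (β : V [⋀^Fin l]→L[ℝ] ℝ) (M : MultilinearMap ℝ (fun _ : Fin k => V) ℝ)
    (N : MultilinearMap ℝ (fun _ : Fin l => V) ℝ)
    (hM : α.toAlternatingMap = MultilinearMap.alternatization M)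
    (hN : β.toAlternatingMap = MultilinearMap.alternatization N) (v : Fin (k + l) → V) :
    wedge α β v = ∑ π : Equiv.Perm (Fin (k + l)), ((Equiv.Perm.sign π : ℤ) : ℝ) *
      (M (fun i => v (π (Fin.castAdd l i))) * N (fun j => v (π (Fin.natAdd k j)))) := by
  change wedgeAlg α β v = _
  unfold wedgeAlg
  rw [hM, hN, ← MultilinearMap.domCoprod_alternization]
  simp only [AlternatingMap.domDomCongr_apply, LinearMap.compAlternatingMap_apply,
    MultilinearMap.alternatization_apply, map_sum]
  rw [← Equiv.sum_comp (Equiv.permCongr (finSumFinEquiv (m := k) (n := l)))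
    (fun π : Equiv.Perm (Fin (k + l)) => ((Equiv.Perm.sign π : ℤ) : ℝ) *
      (M (fun i => v (π (Fin.castAdd l i))) * N (fun j => v (π (Fin.natAdd k j)))))]
  refine Finset.sum_congr rfl fun π _ => ?_
  rw [Equiv.Perm.sign_permCongr]
  rw [Units.smul_def, map_zsmul, zsmul_eq_mul]
  congr 1
  simp [MultilinearMap.domCoprod_apply, Equiv.permCongr_apply]

/-- A bilinear map, as a multilinear map in two variables. -/
def bilinMulti (B : V →ₗ[ℝ] V →ₗ[ℝ] ℝ) : MultilinearMap ℝ (fun _ : Fin 2 => V) ℝ :=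
  MultilinearMap.mk' (fun v => B (v 0) (v 1))
    (fun v i x y => by fin_cases i <;> simp)
    (fun v i c x => by fin_cases i <;> simp)

/-- The components of `α ∧ β ^ n`. The bilinear map `B` with antisymmetrization `β` is arbitrary:
for `β = dσ` it can be the derivative of `σ`, or `β / 2`. -/
theorem wedgePow_apply (α : V [⋀^Fin 1]→L[ℝ] ℝ) (β : V [⋀^Fin 2]→L[ℝ] ℝ)
    (B : V →ₗ[ℝ] V →ₗ[ℝ] ℝ) (hB : ∀ u w, β ![u, w] = B u w - B w u) (n : ℕ)
    (v : Fin (2 * n + 1) → V) :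
    wedgePow α β n v = skewSum (fun i => α (fun _ => v i)) (fun i j => B (v i) (v j)) := by
  have hN : β.toAlternatingMap = MultilinearMap.alternatization (bilinMulti B) := by
    ext w
    have hw : w = ![w 0, w 1] := by ext i; fin_cases i <;> rfl
    have hp : (Finset.univ : Finset (Equiv.Perm (Fin 2))) = {1, Equiv.swap 0 1} := by decide
    rw [MultilinearMap.alternatization_apply, hp, Finset.sum_pair (by decide)]
    change β w = _
    rw [hw, hB]
    simp [bilinMulti, sub_eq_add_neg]
  suffices h : ∀ n, ∃ M : MultilinearMap ℝ (fun _ : Fin (2 * n + 1) => V) ℝ,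
      (wedgePow α β n).toAlternatingMap = MultilinearMap.alternatization M ∧
      ∀ v, M v = α (fun _ => v 0) * ∏ k : Fin n, B (v (pairFst k)) (v (pairSnd k)) by
    obtain ⟨M, h1, h2⟩ := h n
    change (wedgePow α β n).toAlternatingMap v = _
    rw [h1, MultilinearMap.alternatization_apply]
    refine Finset.sum_congr rfl fun π _ => ?_
    rw [Units.smul_def, zsmul_eq_mul, MultilinearMap.domDomCongr_apply, h2]
  intro n
  induction n with
  | zero =>
    refine ⟨α.toMultilinearMap, ?_, ?_⟩
    · ext w
      rw [MultilinearMap.alternatization_apply]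
      simp [wedgePow]
    · intro v
      simp only [Finset.univ_eq_empty, Finset.prod_empty, mul_one]
      change α v = _
      congr 1
      ext i
      exact congrArg v (Fin.ext (by omega))
  | succ n ih =>
    obtain ⟨M, h1, h2⟩ := ih
    have key : ∀ v : Fin (2 * n + 1 + 2) → V,
        ((LinearMap.mul' ℝ ℝ).compMultilinearMap (M.domCoprod (bilinMulti B))).domDomCongr
          finSumFinEquiv v = M (fun i => v (Fin.castAdd 2 i)) *
            bilinMulti B (fun j => v (Fin.natAdd (2 * n + 1) j)) := by
      intro v
      simp [MultilinearMap.domCoprod_apply]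
    refine ⟨(((LinearMap.mul' ℝ ℝ).compMultilinearMap
      (M.domCoprod (bilinMulti B))).domDomCongr finSumFinEquiv :
        MultilinearMap ℝ (fun _ : Fin (2 * n + 1 + 2) => V) ℝ), ?_, fun v => ?_⟩
    · ext w
      rw [MultilinearMap.alternatization_apply]
      change wedge (wedgePow α β n) β w = _
      rw [wedge_apply_of_alternatization _ _ _ _ h1 hN]
      refine Finset.sum_congr rfl fun π _ => ?_
      rw [Units.smul_def, zsmul_eq_mul]
      congr 1
    · refine (key v).trans ?_
      rw [h2, Fin.prod_univ_castSucc, mul_assoc]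
      rfl

/-- A two-form as a bilinear map. -/
def twoFormBilin (β : V [⋀^Fin 2]→L[ℝ] ℝ) : V →ₗ[ℝ] V →ₗ[ℝ] ℝ :=
  LinearMap.mk₂ ℝ (fun u w => β ![u, w])
    (fun u u' w => by
      have h := β.map_update_add ![0, w] 0 u u'
      rwa [update_pair_zero, update_pair_zero, update_pair_zero] at h)
    (fun c u w => by
      have h := β.map_update_smul ![0, w] 0 c u
      rwa [update_pair_zero, update_pair_zero] at h)
    (fun u w w' => by
      have h := β.map_update_add ![u, 0] 1 w w'
      rwa [update_pair_one, update_pair_one, update_pair_one] at h)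
    (fun c u w => by
      have h := β.map_update_smul ![u, 0] 1 c w
      rwa [update_pair_one, update_pair_one] at h)

theorem twoFormBilin_apply (β : V [⋀^Fin 2]→L[ℝ] ℝ) (u w : V) :
    twoFormBilin β u w = β ![u, w] := rfl

theorem twoForm_swap (β : V [⋀^Fin 2]→L[ℝ] ℝ) (u w : V) : β ![w, u] = -β ![u, w] := by
  have h := β.toAlternatingMap.map_swap ![u, w] (i := 0) (j := 1) (by decide)
  have h2 : ![u, w] ∘ Equiv.swap (0 : Fin 2) 1 = ![w, u] := by
    ext i; fin_cases i <;> simp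
  rw [h2] at h
  exact h

theorem twoForm_eq_half (β : V [⋀^Fin 2]→L[ℝ] ℝ) (u w : V) :
    β ![u, w] = ((1 / 2 : ℝ) • twoFormBilin β) u w - ((1 / 2 : ℝ) • twoFormBilin β) w u := by
  simp only [LinearMap.smul_apply, twoFormBilin_apply, smul_eq_mul, twoForm_swap β u w]
  ring

theorem wedgePow_comp {V' : Type*} [AddCommGroup V'] [Module ℝ V'] [TopologicalSpace V']
    (α : V [⋀^Fin 1]→L[ℝ] ℝ) (β : V [⋀^Fin 2]→L[ℝ] ℝ) (A : V' →L[ℝ] V) (n : ℕ) :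
    wedgePow (α.compContinuousLinearMap A) (β.compContinuousLinearMap A) n =
      (wedgePow α β n).compContinuousLinearMap A := by
  ext v
  have h := twoForm_eq_half β
  have h2 := wedgePow_apply (α.compContinuousLinearMap A) (β.compContinuousLinearMap A)
    (((1 / 2 : ℝ) • twoFormBilin β).compl₁₂ (A : V' →ₗ[ℝ] V) (A : V' →ₗ[ℝ] V))
    (fun u w => by
      have e : (A ∘ ![u, w]) = ![A u, A w] := by ext i; fin_cases i <;> rfl
      rw [ContinuousAlternatingMap.compContinuousLinearMap_apply, e, h]
      rfl) n v
  rw [h2]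
  refine (wedgePow_apply α β _ h n (A ∘ v)).symm

/-- A top-degree form transforms under a linear endomorphism by its determinant. -/
theorem topForm_comp {m : ℕ} (e : Module.Basis (Fin m) ℝ V) (η : V [⋀^Fin m]→L[ℝ] ℝ)
    (A : V →L[ℝ] V) :
    η (fun i => A (e i)) = LinearMap.det (A : V →ₗ[ℝ] V) * η e := by
  have h := congrArg (fun f => f (fun i => A (e i))) (η.toAlternatingMap.eq_smul_basis_det e)
  have h2 := e.det_comp (A : V →ₗ[ℝ] V) e
  rw [e.det_self, mul_one] at h2
  rw [← h2]
  change η _ = η e * _ at h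
  rw [h, mul_comm]
  rfl

/-- The change of `α ∧ β ^ n` under `id + X ⊗ c`, whose determinant is `1 + c X`. -/
theorem wedgePow_comp_id_add {n : ℕ} (e : Module.Basis (Fin (2 * n + 1)) ℝ V)
    [IsTopologicalAddGroup V] [ContinuousSMul ℝ V]
    (σ : V [⋀^Fin 1]→L[ℝ] ℝ) (β : V [⋀^Fin 2]→L[ℝ] ℝ) (X : V) (c : V →L[ℝ] ℝ) :
    wedgePow (σ.compContinuousLinearMap (ContinuousLinearMap.id ℝ V + c.smulRight X))
      (β.compContinuousLinearMap (ContinuousLinearMap.id ℝ V + c.smulRight X)) n e =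
      (1 + c X) * wedgePow σ β n e := by
  rw [wedgePow_comp, ContinuousAlternatingMap.compContinuousLinearMap_apply]
  refine (topForm_comp e _ _).trans ?_
  congr 1
  rw [← LinearMap.det_toMatrix e]
  have : LinearMap.toMatrix e e ((ContinuousLinearMap.id ℝ V + c.smulRight X : V →L[ℝ] V) :
      V →ₗ[ℝ] V) = 1 + Matrix.replicateCol Unit (e.repr X) *
        Matrix.replicateRow Unit (fun i => c (e i)) := by
    ext i j
    simp [LinearMap.toMatrix_apply, Matrix.mul_apply, Matrix.one_apply, Finsupp.single_apply,
      eq_comm, mul_comm]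
  rw [this, Matrix.det_one_add_mul_comm, Matrix.det_unique]
  conv_rhs => rw [← e.sum_repr X, map_sum]
  simp [Matrix.mul_apply, mul_comm]

theorem oneForm_const_add (σ : V [⋀^Fin 1]→L[ℝ] ℝ) (u w : V) :
    σ (fun _ => u + w) = σ (fun _ => u) + σ (fun _ => w) := by
  have h := σ.toMultilinearMap.map_update_add (fun _ => 0) 0 u w
  rwa [Function.update_eq_const_of_subsingleton, Function.update_eq_const_of_subsingleton,
    Function.update_eq_const_of_subsingleton] at h

theorem oneForm_const_smul (σ : V [⋀^Fin 1]→L[ℝ] ℝ) (r : ℝ) (u : V) :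
    σ (fun _ => r • u) = r * σ (fun _ => u) := by
  have h := σ.toMultilinearMap.map_update_smul (fun _ => 0) 0 r u
  rwa [Function.update_eq_const_of_subsingleton, Function.update_eq_const_of_subsingleton] at h

/-- An alternating map in one variable, as a linear functional. -/
def oneFormLin (σ : V [⋀^Fin 1]→L[ℝ] ℝ) : V →L[ℝ] ℝ where
  toFun u := σ (fun _ => u)
  map_add' := oneForm_const_add σ
  map_smul' := oneForm_const_smul σ
  cont := σ.cont.comp (by fun_prop)

/-- The identity `σ(X) α ∧ β ^ n + n σ ∧ (α ∧ ι_X β) ∧ β ^ (n - 1) = α(X) σ ∧ β ^ n` in dimension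
`2 n + 1`. It is the derivative at the identity of the transformation of `σ ∧ β ^ n` under
`id + s X ⊗ α`. -/
theorem skewSumDeriv_contract {n : ℕ} (e : Module.Basis (Fin (2 * n + 1)) ℝ V)
    [IsTopologicalAddGroup V] [ContinuousSMul ℝ V]
    (σ α : V [⋀^Fin 1]→L[ℝ] ℝ) (β : V [⋀^Fin 2]→L[ℝ] ℝ) (X : V)
    (B : V →ₗ[ℝ] V →ₗ[ℝ] ℝ) (hB : ∀ u w, β ![u, w] = B u w - B w u) :
    σ (fun _ => X) * skewSum (fun i => α (fun _ => e i)) (fun i j => B (e i) (e j)) +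
      skewSumDeriv (fun i => σ (fun _ => e i)) (fun i j => B (e i) (e j))
        (fun i j => α (fun _ => e i) * β ![X, e j]) =
      α (fun _ => X) * skewSum (fun i => σ (fun _ => e i)) (fun i j => B (e i) (e j)) := by
  set L := oneFormLin α with hL
  have hσA : ∀ (s : ℝ) (u : V), σ (fun _ => u + (s * L u) • X) =
      σ (fun _ => u) + s * (σ (fun _ => X) * L u) := fun s u => by
    rw [oneForm_const_add, oneForm_const_smul]; ring
  have key : ∀ s : ℝ, skewSum (fun i => σ (fun _ => e i) + s * (σ (fun _ => X) * L (e i)))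
      (fun i j => B (e i) (e j) + s * (L (e i) * β ![X, e j])) =
      (1 + s * L X) * skewSum (fun i => σ (fun _ => e i)) (fun i j => B (e i) (e j)) := by
    intro s
    have h1 := wedgePow_comp_id_add e σ β X (s • L)
    rw [wedgePow_apply σ β B hB n e, wedgePow_apply _ _
      (B + s • (LinearMap.mk₂ ℝ (fun u w => L u * twoFormBilin β X w)
        (fun u u' w => by simp [add_mul]) (fun c u w => by simp [mul_assoc])
        (fun u w w' => by simp [mul_add]) (fun c u w => by simp [mul_left_comm])))] at h1
    · simp only [smul_apply, smul_eq_mul] at h1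
      rw [← h1]
      congr 1
      ext i
      exact (hσA s (e i)).symm
    · intro u w
      have e1 : ((ContinuousLinearMap.id ℝ V + (s • L).smulRight X : V →L[ℝ] V) ∘ ![u, w]) =
          ![u + (s * L u) • X, w + (s * L w) • X] := by
        ext i; fin_cases i <;> simp [mul_smul]
      rw [ContinuousAlternatingMap.compContinuousLinearMap_apply, e1]
      have h3 : ∀ u w, β ![u, w] = twoFormBilin β u w := fun _ _ => rfl
      have h5 := twoForm_swap β X u
      have h6 := twoForm_swap β X X
      rw [h3, h3] at h5
      rw [h3] at h6
      have h4 := hB u w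
      rw [h3] at h4 ⊢
      simp only [map_add, map_smul, LinearMap.add_apply, LinearMap.smul_apply, smul_eq_mul,
        LinearMap.mk₂_apply]
      rw [h5, h4]
      linear_combination (s * L u * (s * L w) / 2) * h6
  have hd := hasDerivAt_skewSum (t := 0)
    (a := fun s i => σ (fun _ => e i) + s * (σ (fun _ => X) * L (e i)))
    (b := fun s i j => B (e i) (e j) + s * (L (e i) * β ![X, e j]))
    (a' := fun i => σ (fun _ => X) * L (e i)) (b' := fun i j => L (e i) * β ![X, e j])
    (fun i => (hasDerivAt_mul_const _).const_add _)
    (fun i j => (hasDerivAt_mul_const _).const_add _)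
  simp only [key] at hd
  have hd2 : HasDerivAt (fun s : ℝ => (1 + s * L X) *
      skewSum (fun i => σ (fun _ => e i)) (fun i j => B (e i) (e j)))
      (L X * skewSum (fun i => σ (fun _ => e i)) (fun i j => B (e i) (e j))) 0 :=
    ((hasDerivAt_mul_const (L X)).const_add 1).mul_const _
  have h := hd.unique hd2
  simp only [zero_mul, add_zero] at h
  have hs : skewSum (fun i => σ (fun _ => X) * L (e i)) (fun i j => B (e i) (e j)) =
      σ (fun _ => X) * skewSum (fun i => L (e i)) (fun i j => B (e i) (e j)) := by
    simp only [skewSum, Finset.mul_sum]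
    exact Finset.sum_congr rfl fun π _ => by ring
  rw [hs] at h
  exact h

/-- If `X` annihilates `β`, then `σ(X) α ∧ β ^ n = α(X) σ ∧ β ^ n` in dimension `2 n + 1`. -/
theorem wedgePow_of_contract_eq_zero {n : ℕ} (e : Module.Basis (Fin (2 * n + 1)) ℝ V)
    [IsTopologicalAddGroup V] [ContinuousSMul ℝ V]
    (σ α : V [⋀^Fin 1]→L[ℝ] ℝ) (β : V [⋀^Fin 2]→L[ℝ] ℝ) (X : V) (hX : ∀ w, β ![X, w] = 0) :
    σ (fun _ => X) * wedgePow α β n e = α (fun _ => X) * wedgePow σ β n e := by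
  have hB := twoForm_eq_half β
  have h := skewSumDeriv_contract e σ α β X _ hB
  rw [← wedgePow_apply σ β _ hB, ← wedgePow_apply α β _ hB] at h
  simpa [hX, skewSumDeriv] using h

end Wedge

/-! ### Forms and fields in charts -/

section Charts

variable {m : ℕ} {Y : Type*} [TopologicalSpace Y] [ChartedSpace (Euc m) Y]

/-- The transition map from the chart around `p` to the chart around `q`. -/
def trans (p q : Y) (x : Euc m) : Euc m := chartAt (Euc m) q ((chartAt (Euc m) p).symm x)

/-- The domain of the transition map `trans p q`. -/
def transDom (p q : Y) : Set (Euc m) :=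
  (chartAt (Euc m) p).target ∩ (chartAt (Euc m) p).symm ⁻¹' (chartAt (Euc m) q).source

theorem isOpen_transDom (p q : Y) : IsOpen (transDom (m := m) p q) :=
  (chartAt (Euc m) p).isOpen_inter_preimage_symm (chartAt (Euc m) q).open_source

theorem trans_mem_target {p q : Y} {x : Euc m} (hx : x ∈ transDom p q) :
    trans p q x ∈ (chartAt (Euc m) q).target :=
  (chartAt (Euc m) q).map_source hx.2

theorem symm_trans {p q : Y} {x : Euc m} (hx : x ∈ transDom p q) :
    (chartAt (Euc m) q).symm (trans p q x) = (chartAt (Euc m) p).symm x :=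
  (chartAt (Euc m) q).left_inv hx.2

theorem trans_mem_transDom {p q : Y} {x : Euc m} (hx : x ∈ transDom p q) :
    trans p q x ∈ transDom q p := by
  refine ⟨trans_mem_target hx, ?_⟩
  change (chartAt (Euc m) q).symm (trans p q x) ∈ (chartAt (Euc m) p).source
  rw [symm_trans hx]
  exact (chartAt (Euc m) p).map_target hx.1

theorem trans_trans {p q : Y} {x : Euc m} (hx : x ∈ transDom p q) :
    trans q p (trans p q x) = x := by
  change chartAt (Euc m) p ((chartAt (Euc m) q).symm (trans p q x)) = x
  rw [symm_trans hx, (chartAt (Euc m) p).right_inv hx.1]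

theorem trans_image (p q : Y) : trans p q '' transDom p q = transDom (m := m) q p := by
  refine Set.Subset.antisymm ?_ fun x hx => ?_
  · rintro _ ⟨x, hx, rfl⟩
    exact trans_mem_transDom hx
  · exact ⟨trans q p x, trans_mem_transDom hx, trans_trans hx⟩

theorem trans_injOn (p q : Y) : Set.InjOn (trans p q) (transDom (m := m) p q) := by
  intro x hx x' hx' h
  rw [← trans_trans hx, h, trans_trans hx']

/-- The derivative of the inverse of the chart around `p`, with the tangent spaces of `Y`
identified with the model space. -/
def dsymm (p : Y) (x : Euc m) : Euc m →L[ℝ] Euc m :=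
  mfderiv (𝓡 m) (𝓡 m) (chartAt (Euc m) p).symm x

/-- The derivative of the chart around `p`, with the tangent spaces of `Y` identified with the
model space. -/
def dchart (p : Y) (y : Y) : Euc m →L[ℝ] Euc m :=
  mfderiv (𝓡 m) (𝓡 m) (chartAt (Euc m) p) y

/-- A form, with the tangent spaces of `Y` identified with the model space. -/
def atPt {k : ℕ} (η : DForm m Y k) (y : Y) : Euc m [⋀^Fin k]→L[ℝ] ℝ := η y

theorem coordForm_eq {k : ℕ} (η : DForm m Y k) (p : Y) (x : Euc m) :
    coordForm p η x =
      (atPt η ((chartAt (Euc m) p).symm x)).compContinuousLinearMap (dsymm p x) := rfl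

theorem coordField_eq (X : VField m Y) (p : Y) (x : Euc m) :
    coordField p X x =
      dchart p ((chartAt (Euc m) p).symm x) (X ((chartAt (Euc m) p).symm x)) := rfl

theorem pair_eq_atPt (σ : DForm m Y 1) (X : VField m Y) (y : Y) :
    pair σ X y = atPt σ y (fun _ => (X y : Euc m)) := rfl

theorem mem_transDom_chart (p : Y) {x : Euc m} (hx : x ∈ (chartAt (Euc m) p).target) :
    x ∈ transDom p ((chartAt (Euc m) p).symm x) :=
  ⟨hx, mem_chart_source (Euc m) _⟩

theorem IsSmoothForm.contDiffAt {k : ℕ} {η : DForm m Y k} (h : IsSmoothForm η) {p : Y} {x : Euc m}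
    (hx : x ∈ (chartAt (Euc m) p).target) : ContDiffAt ℝ ∞ (coordForm p η) x :=
  (h p).contDiffAt ((chartAt (Euc m) p).open_target.mem_nhds hx)

variable [IsManifold (𝓡 m) ∞ Y]

theorem contDiffOn_trans (p q : Y) : ContDiffOn ℝ ∞ (trans p q) (transDom (m := m) p q) := by
  have h := contDiffOn_ext_coord_change (I := 𝓡 m) (n := ∞) q p
  refine (h.congr fun x _ => by simp [trans]).mono fun x hx => ?_
  simpa [transDom] using hx

theorem contDiffAt_trans {p q : Y} {x : Euc m} (hx : x ∈ transDom p q) :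
    ContDiffAt ℝ ∞ (trans p q) x :=
  (contDiffOn_trans p q).contDiffAt ((isOpen_transDom p q).mem_nhds hx)

theorem mdifferentiableAt_chart_symm {p : Y} {x : Euc m} (hx : x ∈ (chartAt (Euc m) p).target) :
    MDifferentiableAt (𝓡 m) (𝓡 m) (chartAt (Euc m) p).symm x :=
  mdifferentiableAt_atlas_symm (chart_mem_atlas _ p) hx

theorem mdifferentiableAt_chart {p y : Y} (hy : y ∈ (chartAt (Euc m) p).source) :
    MDifferentiableAt (𝓡 m) (𝓡 m) (chartAt (Euc m) p) y :=
  mdifferentiableAt_atlas (chart_mem_atlas _ p) hy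

theorem dsymm_eq {p q : Y} {x : Euc m} (hx : x ∈ transDom p q) :
    dsymm p x = dsymm q (trans p q x) ∘L fderiv ℝ (trans p q) x := by
  have h1 : (chartAt (Euc m) p).symm =ᶠ[𝓝 x] (chartAt (Euc m) q).symm ∘ trans p q := by
    filter_upwards [(isOpen_transDom p q).mem_nhds hx] with z hz
    exact (symm_trans hz).symm
  unfold dsymm
  rw [h1.mfderiv_eq, mfderiv_comp (I' := 𝓡 m) x
    (mdifferentiableAt_chart_symm (trans_mem_target hx))
    ((contDiffAt_trans hx).differentiableAt (by simp)).mdifferentiableAt, mfderiv_eq_fderiv]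
  rfl

theorem dchart_dsymm {p : Y} {x : Euc m} (hx : x ∈ (chartAt (Euc m) p).target) :
    dchart p ((chartAt (Euc m) p).symm x) ∘L dsymm p x = ContinuousLinearMap.id ℝ (Euc m) := by
  have h1 : (chartAt (Euc m) p) ∘ (chartAt (Euc m) p).symm =ᶠ[𝓝 x] id := by
    filter_upwards [(chartAt (Euc m) p).open_target.mem_nhds hx] with z hz
    exact (chartAt (Euc m) p).right_inv hz
  have h2 := h1.mfderiv_eq (I := 𝓡 m) (I' := 𝓡 m)
  rw [mfderiv_comp (I' := 𝓡 m) x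
    (mdifferentiableAt_chart ((chartAt (Euc m) p).map_target hx))
    (mdifferentiableAt_chart_symm hx), mfderiv_id] at h2
  exact h2

theorem dsymm_dchart {p : Y} {x : Euc m} (hx : x ∈ (chartAt (Euc m) p).target) :
    dsymm p x ∘L dchart p ((chartAt (Euc m) p).symm x) = ContinuousLinearMap.id ℝ (Euc m) := by
  rw [ContinuousLinearMap.ext_iff]
  have hi : Function.Injective (dsymm p x) :=
    Function.LeftInverse.injective (g := dchart p ((chartAt (Euc m) p).symm x))
      fun v => congrArg (fun L => L v) (dchart_dsymm hx)
  have hs := LinearMap.injective_iff_surjective.1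
    (show Function.Injective (dsymm p x : Euc m →ₗ[ℝ] Euc m) from hi)
  intro v
  obtain ⟨w, rfl⟩ := hs v
  exact congrArg (fun u => dsymm p x u) (congrArg (fun L => L w) (dchart_dsymm hx))

theorem dchart_dsymm_trans {p q : Y} {x : Euc m} (hx : x ∈ transDom p q) :
    dchart q ((chartAt (Euc m) p).symm x) ∘L dsymm p x = fderiv ℝ (trans p q) x := by
  rw [dsymm_eq hx, ← ContinuousLinearMap.comp_assoc, ← symm_trans hx,
    dchart_dsymm (trans_mem_target hx), ContinuousLinearMap.id_comp]

/-- The tangent space at `y` is identified with the model space by the chart around `y`. -/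
theorem dchart_self (y : Y) : dchart y y = ContinuousLinearMap.id ℝ (Euc m) := by
  ext1 v
  have h := mfderiv_chartAt_eq_tangentCoordChange (I := 𝓡 m) (mem_chart_source (Euc m) y)
  have h2 := tangentCoordChange_self (I := 𝓡 m) (x := y) (z := y) (v := v)
    (mem_extChartAt_source y)
  exact (congrArg (fun L => L v) h).trans h2

theorem dsymm_self (y : Y) : dsymm y (chartAt (Euc m) y y) = ContinuousLinearMap.id ℝ (Euc m) := by
  have h := dchart_dsymm (mem_chart_target (Euc m) y)
  rwa [(chartAt (Euc m) y).left_inv (mem_chart_source _ y), dchart_self,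
    ContinuousLinearMap.id_comp] at h

theorem coordForm_self {k : ℕ} (η : DForm m Y k) (y : Y) :
    coordForm y η (chartAt (Euc m) y y) = atPt η y := by
  rw [coordForm_eq, dsymm_self, (chartAt (Euc m) y).left_inv (mem_chart_source _ y)]
  rfl

theorem coordForm_trans {k : ℕ} (η : DForm m Y k) {p q : Y} {x : Euc m} (hx : x ∈ transDom p q) :
    coordForm p η x = (coordForm q η (trans p q x)).compContinuousLinearMap
      (fderiv ℝ (trans p q) x) := by
  rw [coordForm_eq, coordForm_eq, dsymm_eq hx, symm_trans hx]
  rfl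

theorem atPt_eq {k : ℕ} (η : DForm m Y k) {p : Y} {x : Euc m}
    (hx : x ∈ (chartAt (Euc m) p).target) :
    atPt η ((chartAt (Euc m) p).symm x) = (coordForm p η x).compContinuousLinearMap
      (dchart p ((chartAt (Euc m) p).symm x)) := by
  rw [coordForm_eq]
  have h := dsymm_dchart hx
  ext v
  change _ = atPt η _ (fun i => (dsymm p x ∘L dchart p ((chartAt (Euc m) p).symm x)) (v i))
  rw [h]
  rfl

theorem pair_symm (σ : DForm m Y 1) (X : VField m Y) {p : Y} {x : Euc m}
    (hx : x ∈ (chartAt (Euc m) p).target) :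
    pair σ X ((chartAt (Euc m) p).symm x) = coordForm p σ x (fun _ => coordField p X x) := by
  rw [pair_eq_atPt, atPt_eq σ hx]
  rfl

/-- The exterior derivative, defined at each point by the chart around this point, is given by the
same formula in every chart. -/
theorem coordForm_dForm {k : ℕ} {η : DForm m Y k} (h : IsSmoothForm η) {p : Y} {x : Euc m}
    (hx : x ∈ (chartAt (Euc m) p).target) :
    coordForm p (dForm η) x = extDeriv (coordForm p η) x := by
  have hd := mem_transDom_chart p hx
  set y := (chartAt (Euc m) p).symm x with hy
  have h1 : coordForm p η =ᶠ[𝓝 x] fun z =>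
      (coordForm y η (trans p y z)).compContinuousLinearMap (fderiv ℝ (trans p y) z) := by
    filter_upwards [(isOpen_transDom p y).mem_nhds hd] with z hz
    exact coordForm_trans η hz
  rw [h1.extDeriv_eq, extDeriv_pullback ((h.contDiffAt (trans_mem_target hd)).differentiableAt
    (by simp)) (contDiffAt_trans hd) (by simpa using
      (show (2 : WithTop ℕ∞) ≤ ∞ from WithTop.coe_le_coe.2 le_top))]
  rw [← dchart_dsymm_trans hd]
  rfl

theorem IsSmoothField.contDiffOn {X : VField m Y} (h : IsSmoothField X) (p : Y) :
    ContDiffOn ℝ ∞ (coordField p X) (chartAt (Euc m) p).target := by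
  have h1 := ((trivializationAt (Euc m) (TangentSpace (𝓡 m) : Y → Type _)
    p).contMDiffOn_section_baseSet_iff (IB := 𝓡 m) (n := ∞) (s := X)).1 h.contMDiffOn
  rw [TangentBundle.trivializationAt_baseSet] at h1
  have h2 := h1.comp (contMDiffOn_chart_symm (x := p))
    fun x hx => (chartAt (Euc m) p).map_target hx
  rw [contMDiffOn_iff_contDiffOn] at h2
  refine h2.congr fun x hx => ?_
  rw [coordField_eq]
  have h := mfderiv_chartAt_eq_tangentCoordChange (I := 𝓡 m) ((chartAt (Euc m) p).map_target hx)
  exact congrArg (fun L => L (X ((chartAt (Euc m) p).symm x))) h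

end Charts

/-! ### The divergence theorem in Euclidean space -/

section EuclideanStokes

open MeasureTheory

/-- The integral of a directional derivative of a compactly supported function vanishes. The
function is only assumed to be differentiable on an open set `U` containing the compact set `K`
outside which it vanishes. -/
theorem setIntegral_fderiv_eq_zero {m : ℕ} {U K : Set (Euc m)} (hU : IsOpen U) (hK : IsCompact K)
    (hKU : K ⊆ U) {H : Euc m → ℝ} (hH : ContDiffOn ℝ 1 H U) (h0 : ∀ x ∈ U, x ∉ K → H x = 0)
    (v : Euc m) :
    IntegrableOn (fun x => fderiv ℝ H x v) U ∧ ∫ x in U, fderiv ℝ H x v = 0 := by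
  set G : Euc m → ℝ := U.indicator H with hG
  have hGU : ∀ x ∈ U, G =ᶠ[𝓝 x] H := fun x hx => by
    filter_upwards [hU.mem_nhds hx] with z hz
    simp [hG, hz]
  have hG0 : ∀ x, x ∉ K → G x = 0 := fun x hx => by
    by_cases hxU : x ∈ U
    · simp [hG, hxU, h0 x hxU hx]
    · simp [hG, hxU]
  have hGc : ContDiff ℝ 1 G := by
    rw [contDiff_iff_contDiffAt]
    intro x
    by_cases hx : x ∈ K
    · exact (hH.contDiffAt (hU.mem_nhds (hKU hx))).congr_of_eventuallyEq (hGU x (hKU hx))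
    · refine (contDiffAt_const (c := (0 : ℝ))).congr_of_eventuallyEq ?_
      filter_upwards [hK.isClosed.isOpen_compl.mem_nhds hx] with z hz
      exact hG0 z hz
  have hGs : HasCompactSupport G := HasCompactSupport.intro hK fun x hx => hG0 x hx
  have hd : Continuous fun x => fderiv ℝ G x v := (hGc.continuous_fderiv (by simp)).clm_apply
    continuous_const
  have hds : HasCompactSupport fun x => fderiv ℝ G x v := hGs.fderiv_apply ℝ v
  have hi : Integrable fun x => fderiv ℝ G x v := hd.integrable_of_hasCompactSupport hds
  have heq : Set.EqOn (fun x => fderiv ℝ G x v) (fun x => fderiv ℝ H x v) U := fun x hx => by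
    simp only [(hGU x hx).fderiv_eq]
  refine ⟨hi.integrableOn.congr_fun heq hU.measurableSet, ?_⟩
  rw [← setIntegral_congr_fun hU.measurableSet heq, setIntegral_eq_integral_of_forall_compl_eq_zero]
  · have h := integral_bilinear_fderiv_right_eq_neg_left_of_integrable (μ := volume)
      (f := fun _ : Euc m => (1 : ℝ)) (g := G) (v := v) (B := ContinuousLinearMap.mul ℝ ℝ)
      (by simp) (by simpa using hi)
      (by simpa using hGc.continuous.integrable_of_hasCompactSupport hGs)
      (fun x _ => differentiableAt_const _) (fun x _ => hGc.differentiable (by simp) x)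
    simpa using h
  · intro x hx
    have : G =ᶠ[𝓝 x] fun _ => 0 := by
      filter_upwards [hK.isClosed.isOpen_compl.mem_nhds (fun h => hx (hKU h))] with z hz
      exact hG0 z hz
    simp [this.fderiv_eq]

variable {n : ℕ}

/-- The partial derivative of `f` in the `i`-th coordinate direction. -/
def pd {m : ℕ} (i : Fin m) (f : Euc m → ℝ) (x : Euc m) : ℝ :=
  fderiv ℝ f x (EuclideanSpace.basisFun (Fin m) ℝ i)

theorem hasDerivAt_line {m : ℕ} {f : Euc m → ℝ} {x : Euc m} (hf : DifferentiableAt ℝ f x)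
    (i : Fin m) :
    HasDerivAt (fun t : ℝ => f (x + t • EuclideanSpace.basisFun (Fin m) ℝ i)) (pd i f x) 0 :=
  hf.hasFDerivAt.hasLineDerivAt _

theorem contDiffOn_pd {m : ℕ} {f : Euc m → ℝ} {U : Set (Euc m)} (hU : IsOpen U)
    (hf : ContDiffOn ℝ ∞ f U) (i : Fin m) : ContDiffOn ℝ ∞ (pd i f) U :=
  (hf.fderiv_of_isOpen hU (by simp)).clm_apply contDiffOn_const

theorem pd_comm {m : ℕ} {f : Euc m → ℝ} {U : Set (Euc m)} (hU : IsOpen U)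
    (hf : ContDiffOn ℝ ∞ f U) (i j : Fin m) {x : Euc m} (hx : x ∈ U) :
    pd i (pd j f) x = pd j (pd i f) x := by
  have hx' := hU.mem_nhds hx
  have h1 : DifferentiableAt ℝ (fderiv ℝ f) x :=
    (((hf.fderiv_of_isOpen hU (m := ∞) (by simp)).contDiffAt hx').differentiableAt (by simp))
  have h2 := (hf.contDiffAt hx').isSymmSndFDerivAt
    (by simpa using (show (2 : WithTop ℕ∞) ≤ ∞ from WithTop.coe_le_coe.2 le_top))
  have h3 : ∀ i j, pd i (pd j f) x = fderiv ℝ (fderiv ℝ f) x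
      (EuclideanSpace.basisFun (Fin m) ℝ i) (EuclideanSpace.basisFun (Fin m) ℝ j) := by
    intro i j
    unfold pd
    rw [fderiv_clm_apply h1 (differentiableAt_const _)]
    simp
  rw [h3, h3, h2.eq]

/-- The summand attached to the permutation `π` of the `2 n`-form whose differential is
`± f σ ∧ dα ∧ (dσ) ^ (n - 1) + ⋯`, in coordinates. -/
def stokesTerm (f : Euc (2 * n + 1) → ℝ) (A C : Fin (2 * n + 1) → Euc (2 * n + 1) → ℝ) (k : Fin n)
    (π : Equiv.Perm (Fin (2 * n + 1))) (x : Euc (2 * n + 1)) : ℝ :=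
  f x * (A (π 0) x * (C (π (pairSnd k)) x *
    ∏ j ∈ Finset.univ.erase k, pd (π (pairFst j)) (A (π (pairSnd j))) x))

theorem contDiffOn_stokesTerm {U : Set (Euc (2 * n + 1))} (hU : IsOpen U)
    {f : Euc (2 * n + 1) → ℝ} {A C : Fin (2 * n + 1) → Euc (2 * n + 1) → ℝ}
    (hf : ContDiffOn ℝ ∞ f U) (hA : ∀ i, ContDiffOn ℝ ∞ (A i) U)
    (hC : ∀ i, ContDiffOn ℝ ∞ (C i) U) (k : Fin n) (π : Equiv.Perm (Fin (2 * n + 1))) :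
    ContDiffOn ℝ ∞ (stokesTerm f A C k π) U :=
  hf.mul ((hA _).mul ((hC _).mul (contDiffOn_prod fun _ _ => contDiffOn_pd hU (hA _) _)))

/-- The differential of `f σ ∧ α ∧ (dσ) ^ (n - 1)` in coordinates, by the product rule. -/
theorem sum_pd_stokesTerm {U : Set (Euc (2 * n + 1))} (hU : IsOpen U)
    {f : Euc (2 * n + 1) → ℝ} {A C : Fin (2 * n + 1) → Euc (2 * n + 1) → ℝ}
    (hf : ContDiffOn ℝ ∞ f U) (hA : ∀ i, ContDiffOn ℝ ∞ (A i) U)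
    (hC : ∀ i, ContDiffOn ℝ ∞ (C i) U) {x : Euc (2 * n + 1)} (hx : x ∈ U) :
    ∑ k : Fin n, ∑ π : Equiv.Perm (Fin (2 * n + 1)), ((Equiv.Perm.sign π : ℤ) : ℝ) *
        pd (π (pairFst k)) (stokesTerm f A C k π) x =
      f x * skewSumDeriv (fun i => A i x) (fun i j => pd i (A j) x) (fun i j => pd i (C j) x) +
      skewSumDeriv (fun i => A i x) (fun i j => pd i (A j) x) (fun i j => pd i f x * C j x) -
      n * (f x * skewSum (fun i => C i x) (fun i j => pd i (A j) x)) := by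
  have hx' := hU.mem_nhds hx
  have hd : ∀ {g : Euc (2 * n + 1) → ℝ}, ContDiffOn ℝ ∞ g U → DifferentiableAt ℝ g x :=
    fun h => (h.contDiffAt hx').differentiableAt (by simp)
  have key : ∀ (k : Fin n) (π : Equiv.Perm (Fin (2 * n + 1))),
      pd (π (pairFst k)) (stokesTerm f A C k π) x =
        pd (π (pairFst k)) f x * (A (π 0) x * (C (π (pairSnd k)) x *
          ∏ j ∈ Finset.univ.erase k, pd (π (pairFst j)) (A (π (pairSnd j))) x)) +
        f x * (pd (π (pairFst k)) (A (π 0)) x * (C (π (pairSnd k)) x *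
          ∏ j ∈ Finset.univ.erase k, pd (π (pairFst j)) (A (π (pairSnd j))) x)) +
        f x * (A (π 0) x * (pd (π (pairFst k)) (C (π (pairSnd k))) x *
          ∏ j ∈ Finset.univ.erase k, pd (π (pairFst j)) (A (π (pairSnd j))) x)) +
        ∑ j ∈ Finset.univ.erase k, f x * (A (π 0) x * (C (π (pairSnd k)) x *
          (pd (π (pairFst k)) (pd (π (pairFst j)) (A (π (pairSnd j)))) x *
          ∏ l ∈ (Finset.univ.erase k).erase j, pd (π (pairFst l)) (A (π (pairSnd l))) x))) := by
    intro k π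
    have h1 := hasDerivAt_line (hd (contDiffOn_stokesTerm hU hf hA hC k π)) (π (pairFst k))
    have h2 := (hasDerivAt_line (hd hf) (π (pairFst k))).mul
      ((hasDerivAt_line (hd (hA (π 0))) (π (pairFst k))).mul
      ((hasDerivAt_line (hd (hC (π (pairSnd k)))) (π (pairFst k))).mul
      (HasDerivAt.fun_finsetProd (u := Finset.univ.erase k) fun j _ =>
        hasDerivAt_line (hd (contDiffOn_pd hU (hA (π (pairSnd j))) (π (pairFst j))))
          (π (pairFst k)))))
    refine (h1.unique h2).trans ?_
    simp only [Pi.mul_apply, zero_smul, add_zero, smul_eq_mul]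
    simp only [mul_add, Finset.mul_sum]
    have : ∀ (p q r : ℝ) (s : Fin n → ℝ) (s' : Fin n → ℝ), s = s' →
        p + (q + (r + ∑ j ∈ Finset.univ.erase k, s j)) =
        p + q + r + ∑ j ∈ Finset.univ.erase k, s' j := by
      rintro p q r s s' rfl; ring
    refine this _ _ _ _ _ ?_
    ext j
    ring
  -- The derivative of the factor `A (π 0)` yields `d σ` in place of `σ ∧ d α`: exchange `π 0`
  -- and `π (pairSnd k)`.
  have hA0 : ∀ k : Fin n, ∑ π : Equiv.Perm (Fin (2 * n + 1)), ((Equiv.Perm.sign π : ℤ) : ℝ) *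
      (f x * (pd (π (pairFst k)) (A (π 0)) x * (C (π (pairSnd k)) x *
        ∏ j ∈ Finset.univ.erase k, pd (π (pairFst j)) (A (π (pairSnd j))) x))) =
      -(f x * skewSum (fun i => C i x) (fun i j => pd i (A j) x)) := by
    intro k
    rw [skewSum, Finset.mul_sum]
    simp only [mul_left_comm (f x)]
    rw [← sum_sign_mul_swap (pairSnd_ne_zero k).symm]
    refine Finset.sum_congr rfl fun π _ => ?_
    simp only [Equiv.Perm.mul_apply, Equiv.swap_apply_left]
    rw [← Finset.mul_prod_erase _ _ (Finset.mem_univ k), Equiv.swap_apply_right,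
      Equiv.swap_apply_of_ne_of_ne (pairFst_ne_zero k) (pairFst_ne_pairSnd k k)]
    have : ∏ j ∈ Finset.univ.erase k, pd (π (Equiv.swap 0 (pairSnd k) (pairFst j)))
        (A (π (Equiv.swap 0 (pairSnd k) (pairSnd j)))) x =
        ∏ j ∈ Finset.univ.erase k, pd (π (pairFst j)) (A (π (pairSnd j))) x :=
      Finset.prod_congr rfl fun j hj => by
        rw [Equiv.swap_apply_of_ne_of_ne (pairFst_ne_zero j) (pairFst_ne_pairSnd j k),
          Equiv.swap_apply_of_ne_of_ne (pairSnd_ne_zero j)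
            (pairSnd_ne (Finset.ne_of_mem_erase hj))]
    rw [this]
    ring
  -- The second derivatives of `A` cancel by symmetry: exchange the two indices of differentiation.
  have hAA : ∀ k : Fin n, ∑ π : Equiv.Perm (Fin (2 * n + 1)), ((Equiv.Perm.sign π : ℤ) : ℝ) *
      (∑ j ∈ Finset.univ.erase k, f x * (A (π 0) x * (C (π (pairSnd k)) x *
          (pd (π (pairFst k)) (pd (π (pairFst j)) (A (π (pairSnd j)))) x *
          ∏ l ∈ (Finset.univ.erase k).erase j,
            pd (π (pairFst l)) (A (π (pairSnd l))) x)))) = 0 := by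
    intro k
    simp only [Finset.mul_sum]
    rw [Finset.sum_comm]
    refine Finset.sum_eq_zero fun j hj => ?_
    have hjk := Finset.ne_of_mem_erase hj
    refine sum_sign_mul_eq_zero (pairFst_ne hjk) (fun π => f x * (A (π 0) x *
      (C (π (pairSnd k)) x * (pd (π (pairFst k)) (pd (π (pairFst j)) (A (π (pairSnd j)))) x *
        ∏ l ∈ (Finset.univ.erase k).erase j,
            pd (π (pairFst l)) (A (π (pairSnd l))) x)))) fun π => ?_
    simp only [Equiv.Perm.mul_apply, Equiv.swap_apply_left, Equiv.swap_apply_right]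
    rw [Equiv.swap_apply_of_ne_of_ne (pairFst_ne_zero j).symm (pairFst_ne_zero k).symm,
      Equiv.swap_apply_of_ne_of_ne (pairFst_ne_pairSnd j k).symm (pairFst_ne_pairSnd k k).symm,
      Equiv.swap_apply_of_ne_of_ne (pairFst_ne_pairSnd j j).symm (pairFst_ne_pairSnd k j).symm,
      pd_comm hU (hA _) _ _ hx]
    congr 4
    refine Finset.prod_congr rfl fun l hl => ?_
    rw [Equiv.swap_apply_of_ne_of_ne (pairFst_ne (Finset.ne_of_mem_erase hl))
        (pairFst_ne (Finset.ne_of_mem_erase (Finset.mem_of_mem_erase hl))),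
      Equiv.swap_apply_of_ne_of_ne (pairFst_ne_pairSnd j l).symm (pairFst_ne_pairSnd k l).symm]
  simp only [key, mul_add (Int.cast _), Finset.sum_add_distrib, hA0, hAA]
  have e1 : f x * skewSumDeriv (fun i => A i x) (fun i j => pd i (A j) x)
      (fun i j => pd i (C j) x) = ∑ k : Fin n, ∑ π : Equiv.Perm (Fin (2 * n + 1)),
      ((Equiv.Perm.sign π : ℤ) : ℝ) * (f x * (A (π 0) x *
        (pd (π (pairFst k)) (C (π (pairSnd k))) x *
          ∏ j ∈ Finset.univ.erase k, pd (π (pairFst j)) (A (π (pairSnd j))) x))) := by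
    simp only [skewSumDeriv, Finset.mul_sum, mul_left_comm (f x)]
  have e2 : skewSumDeriv (fun i => A i x) (fun i j => pd i (A j) x)
      (fun i j => pd i f x * C j x) = ∑ k : Fin n, ∑ π : Equiv.Perm (Fin (2 * n + 1)),
      ((Equiv.Perm.sign π : ℤ) : ℝ) * (pd (π (pairFst k)) f x * (A (π 0) x *
        (C (π (pairSnd k)) x *
          ∏ j ∈ Finset.univ.erase k, pd (π (pairFst j)) (A (π (pairSnd j))) x))) :=
    Finset.sum_congr rfl fun k _ => Finset.sum_congr rfl fun π _ => by ring
  rw [e1, e2]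
  simp only [Finset.sum_const, Finset.card_univ, Fintype.card_fin, nsmul_eq_mul]
  ring

/-- Stokes' theorem for `f σ ∧ α ∧ (dσ) ^ (n - 1)` in coordinates, for `α` of compact support. -/
theorem setIntegral_stokes {U K : Set (Euc (2 * n + 1))} (hU : IsOpen U) (hK : IsCompact K)
    (hKU : K ⊆ U) {f : Euc (2 * n + 1) → ℝ} {A C : Fin (2 * n + 1) → Euc (2 * n + 1) → ℝ}
    (hf : ContDiffOn ℝ ∞ f U) (hA : ∀ i, ContDiffOn ℝ ∞ (A i) U)
    (hC : ∀ i, ContDiffOn ℝ ∞ (C i) U) (h0 : ∀ i, ∀ x ∈ U, x ∉ K → C i x = 0) :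
    ∫ x in U, (f x * skewSumDeriv (fun i => A i x) (fun i j => pd i (A j) x)
        (fun i j => pd i (C j) x) +
      skewSumDeriv (fun i => A i x) (fun i j => pd i (A j) x) (fun i j => pd i f x * C j x) -
      n * (f x * skewSum (fun i => C i x) (fun i j => pd i (A j) x))) = 0 := by
  have h1 : ∀ (k : Fin n) (π : Equiv.Perm (Fin (2 * n + 1))),
      IntegrableOn (fun x => pd (π (pairFst k)) (stokesTerm f A C k π) x) U ∧
      ∫ x in U, pd (π (pairFst k)) (stokesTerm f A C k π) x = 0 := fun k π =>
    setIntegral_fderiv_eq_zero hU hK hKU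
      ((contDiffOn_stokesTerm hU hf hA hC k π).of_le (by simp)) (fun x hx hxK => by
        simp [stokesTerm, h0 _ x hx hxK]) _
  rw [← setIntegral_congr_fun hU.measurableSet fun x hx => sum_pd_stokesTerm hU hf hA hC hx]
  rw [integral_finsetSum _ fun k _ => integrable_finsetSum _ fun π _ => (h1 k π).1.const_mul _]
  refine Finset.sum_eq_zero fun k _ => ?_
  rw [integral_finsetSum _ fun π _ => (h1 k π).1.const_mul _]
  refine Finset.sum_eq_zero fun π _ => ?_
  rw [integral_const_mul, (h1 k π).2, mul_zero]

end EuclideanStokes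

/-! ### Integration of top-degree forms -/

section VolumeMeasure

open MeasureTheory

variable {m : ℕ} {Y : Type*} [TopologicalSpace Y] [ChartedSpace (Euc m) Y]

/-- The component of a top-degree form at `y`, in the basis of the tangent space that comes from its
identification with the model space. -/
def topVal (η : DForm m Y m) (y : Y) : ℝ := atPt η y (fun i => EuclideanSpace.basisFun (Fin m) ℝ i)

theorem abs_eq_sign_mul (r : ℝ) : |r| = Real.sign r * r := by
  rcases lt_trichotomy r 0 with h | rfl | h
  · rw [abs_of_neg h, Real.sign_of_neg h]; ring
  · simp
  · rw [abs_of_pos h, Real.sign_of_pos h]; ring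

/-- The function `η / ν`, for top-degree forms `η` and `ν`. -/
def ratio (ν η : DForm m Y m) (y : Y) : ℝ := topVal η y / topVal ν y

/-- A nowhere vanishing top-degree form with smooth components. -/
def IsVolumeForm (ν : DForm m Y m) : Prop :=
  (∀ p : Y, ContDiffOn ℝ ∞ (topCoeff p ν) (chartAt (Euc m) p).target) ∧ ∀ y, ν y ≠ 0

/-- The components of a top-degree form in two frames differ by a determinant that does not depend
on the form, so that quotients of components do not depend on the frame. -/
theorem topCoeff_eq (η : DForm m Y m) (p : Y) (x : Euc m) :
    topCoeff p η x = LinearMap.det (dsymm p x : Euc m →ₗ[ℝ] Euc m) *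
      topVal η ((chartAt (Euc m) p).symm x) := by
  have h := topForm_comp (EuclideanSpace.basisFun (Fin m) ℝ).toBasis
    (atPt η ((chartAt (Euc m) p).symm x)) (dsymm p x)
  simp only [OrthonormalBasis.coe_toBasis] at h
  exact h

theorem topVal_ne_zero {ν : DForm m Y m} {y : Y} (h : ν y ≠ 0) : topVal ν y ≠ 0 := by
  intro h0
  refine h ?_
  have h1 := ((atPt ν y).toAlternatingMap.map_basis_eq_zero_iff
    (EuclideanSpace.basisFun (Fin m) ℝ).toBasis).1
    (by simp only [OrthonormalBasis.coe_toBasis]; exact h0)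
  ext v
  exact congrArg (fun F => F v) h1

theorem topCoeff_eq_ratio {ν : DForm m Y m} (hν : ∀ y, ν y ≠ 0) (η : DForm m Y m) (p : Y)
    (x : Euc m) :
    topCoeff p η x = ratio ν η ((chartAt (Euc m) p).symm x) * topCoeff p ν x := by
  rw [topCoeff_eq, topCoeff_eq, ratio]
  have := topVal_ne_zero (hν ((chartAt (Euc m) p).symm x))
  field_simp

/-- Integrability of a function on an open set, outside a compact subset of which it vanishes. -/
theorem integrableOn_of_continuousOn_of_compact {U K : Set (Euc m)} (hU : IsOpen U)
    (hK : IsCompact K) (hKU : K ⊆ U) {h : Euc m → ℝ} (hc : ContinuousOn h U)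
    (h0 : ∀ x ∈ U, x ∉ K → h x = 0) : IntegrableOn h U :=
  ((hc.mono hKU).integrableOn_compact hK).of_forall_sdiff_eq_zero hU.measurableSet
    fun x hx => h0 x hx.1 hx.2

/-- The image of a compact set in a chart. -/
theorem isCompact_chart_image {p : Y} {S : Set Y} (hS : IsCompact S)
    (hp : S ⊆ (chartAt (Euc m) p).source) :
    IsCompact (chartAt (Euc m) p '' S) ∧ chartAt (Euc m) p '' S ⊆ (chartAt (Euc m) p).target := by
  refine ⟨hS.image_of_continuousOn ((chartAt (Euc m) p).continuousOn.mono hp), ?_⟩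
  rintro _ ⟨y, hy, rfl⟩
  exact (chartAt (Euc m) p).map_source (hp hy)

theorem symm_notMem_of_notMem_image {p : Y} {S : Set Y} {x : Euc m}
    (hx : x ∈ (chartAt (Euc m) p).target) (hxS : x ∉ chartAt (Euc m) p '' S) :
    (chartAt (Euc m) p).symm x ∉ S :=
  fun h => hxS ⟨_, h, (chartAt (Euc m) p).right_inv hx⟩

theorem continuousOn_comp_chart_symm {g : Y → ℝ} (hg : Continuous g) (p : Y) :
    ContinuousOn (fun x => g ((chartAt (Euc m) p).symm x)) (chartAt (Euc m) p).target :=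
  hg.comp_continuousOn (chartAt (Euc m) p).continuousOn_symm

theorem continuousOn_volIntegrand {ν : DForm m Y m} (hν : IsVolumeForm ν) {g : Y → ℝ}
    (hg : Continuous g) (p : Y) :
    ContinuousOn (fun x => g ((chartAt (Euc m) p).symm x) * |topCoeff p ν x|)
      (chartAt (Euc m) p).target :=
  (continuousOn_comp_chart_symm hg p).mul (hν.1 p).continuousOn.abs

theorem integrableOn_volIntegrand {ν : DForm m Y m} (hν : IsVolumeForm ν) {g : Y → ℝ}
    (hg : Continuous g) [CompactSpace Y] {p : Y}
    (hp : tsupport g ⊆ (chartAt (Euc m) p).source) :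
    IntegrableOn (fun x => g ((chartAt (Euc m) p).symm x) * |topCoeff p ν x|)
      (chartAt (Euc m) p).target := by
  obtain ⟨h1, h2⟩ := isCompact_chart_image (isClosed_tsupport g).isCompact hp
  refine integrableOn_of_continuousOn_of_compact (chartAt (Euc m) p).open_target h1 h2
    (continuousOn_volIntegrand hν hg p) fun x hx hx' => ?_
  rw [image_eq_zero_of_notMem_tsupport (symm_notMem_of_notMem_image hx hx'), zero_mul]

variable [IsManifold (𝓡 m) ∞ Y]

theorem topCoeff_ne_zero {ν : DForm m Y m} (hν : ∀ y, ν y ≠ 0) {p : Y} {x : Euc m}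
    (hx : x ∈ (chartAt (Euc m) p).target) : topCoeff p ν x ≠ 0 := by
  rw [topCoeff_eq]
  refine mul_ne_zero ?_ (topVal_ne_zero (hν _))
  intro h0
  have h := congrArg (fun L : Euc m →L[ℝ] Euc m => LinearMap.det (L : Euc m →ₗ[ℝ] Euc m))
    (dchart_dsymm hx)
  simp only [ContinuousLinearMap.toLinearMap_comp, LinearMap.det_comp, h0, mul_zero] at h
  exact zero_ne_one (h.trans LinearMap.det_id)

theorem topCoeff_trans (η : DForm m Y m) {p q : Y} {x : Euc m} (hx : x ∈ transDom p q) :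
    topCoeff p η x = (fderiv ℝ (trans p q) x).det * topCoeff q η (trans p q x) := by
  rw [topCoeff_eq, topCoeff_eq, dsymm_eq hx, symm_trans hx, ContinuousLinearMap.toLinearMap_comp,
    LinearMap.det_comp]
  change _ = LinearMap.det _ * _
  ring

theorem ratio_eq_topCoeff {ν : DForm m Y m} (hν : ∀ y, ν y ≠ 0) (η : DForm m Y m) {p : Y}
    {x : Euc m} (hx : x ∈ (chartAt (Euc m) p).target) :
    ratio ν η ((chartAt (Euc m) p).symm x) = topCoeff p η x / topCoeff p ν x := by
  rw [topCoeff_eq_ratio hν η, mul_div_cancel_right₀ _ (topCoeff_ne_zero hν hx)]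

variable [T2Space Y] [CompactSpace Y]

theorem tsupport_partUnity (p : Y) :
    tsupport (partUnity m Y p) ⊆ (chartAt (Euc m) p).source :=
  (SmoothPartitionOfUnity.exists_isSubordinate_chartAt_source (𝓡 m) Y).choose_spec p

variable (m Y) in
/-- The finitely many points whose chart carries a nonzero function of the partition of unity. -/
def coverFinset : Finset Y :=
  ((partUnity m Y).locallyFinite.finite_nonempty_of_compact).toFinset

theorem partUnity_eq_zero {p : Y} (hp : p ∉ coverFinset m Y) (y : Y) : partUnity m Y p y = 0 := by
  by_contra h
  exact hp ((Set.Finite.mem_toFinset _).2 ⟨y, h⟩)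

theorem sum_partUnity (y : Y) : ∑ p ∈ coverFinset m Y, partUnity m Y p y = 1 := by
  rw [← (partUnity m Y).sum_eq_one (Set.mem_univ y)]
  refine (finsum_eq_sum_of_support_subset _ fun p hp => ?_).symm
  by_contra h
  exact hp (partUnity_eq_zero h y)

/-- The integral of `g |ν|` over `Y`, for a top-degree form `ν`. -/
def volIntegral (ν : DForm m Y m) (g : Y → ℝ) : ℝ :=
  ∑ p ∈ coverFinset m Y, ∫ x in (chartAt (Euc m) p).target,
    partUnity m Y p ((chartAt (Euc m) p).symm x) *
      (g ((chartAt (Euc m) p).symm x) * |topCoeff p ν x|)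

theorem integral_eq_volIntegral {ν : DForm m Y m} (hν : ∀ y, ν y ≠ 0) (η : DForm m Y m) :
    integral ν η = volIntegral ν (ratio ν η) := by
  unfold integral volIntegral
  rw [finsum_eq_sum_of_support_subset (s := coverFinset m Y)]
  · refine Finset.sum_congr rfl fun p _ => ?_
    refine setIntegral_congr_fun (chartAt (Euc m) p).open_target.measurableSet fun x _ => ?_
    rw [topCoeff_eq_ratio hν η, abs_eq_sign_mul]
    ring
  · intro p hp
    by_contra h
    exact hp (by simp [partUnity_eq_zero h])

theorem integrableOn_partUnity_mul {ν : DForm m Y m} (hν : IsVolumeForm ν) {g : Y → ℝ}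
    (hg : Continuous g) (p : Y) :
    IntegrableOn (fun x => partUnity m Y p ((chartAt (Euc m) p).symm x) *
      (g ((chartAt (Euc m) p).symm x) * |topCoeff p ν x|)) (chartAt (Euc m) p).target := by
  have := integrableOn_volIntegrand hν (g := fun y => partUnity m Y p y * g y) (p := p)
    ((partUnity m Y p).contMDiff.continuous.mul hg)
    ((tsupport_mul_subset_left).trans (tsupport_partUnity p))
  simpa only [mul_assoc] using this

theorem volIntegral_add {ν : DForm m Y m} (hν : IsVolumeForm ν) {g h : Y → ℝ}
    (hg : Continuous g) (hh : Continuous h) :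
    volIntegral ν (fun y => g y + h y) = volIntegral ν g + volIntegral ν h := by
  unfold volIntegral
  rw [← Finset.sum_add_distrib]
  refine Finset.sum_congr rfl fun p _ => ?_
  rw [← integral_add (integrableOn_partUnity_mul hν hg p) (integrableOn_partUnity_mul hν hh p)]
  simp only [add_mul, mul_add]

theorem volIntegral_const_mul (ν : DForm m Y m) (c : ℝ) (g : Y → ℝ) :
    volIntegral ν (fun y => c * g y) = c * volIntegral ν g := by
  unfold volIntegral
  rw [Finset.mul_sum]
  refine Finset.sum_congr rfl fun p _ => ?_
  rw [← integral_const_mul]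
  congr 1
  ext x
  ring

theorem volIntegrand_nonneg (ν : DForm m Y m) {g : Y → ℝ} (hg : ∀ y, 0 ≤ g y) (p : Y) (x : Euc m) :
    0 ≤ partUnity m Y p ((chartAt (Euc m) p).symm x) *
      (g ((chartAt (Euc m) p).symm x) * |topCoeff p ν x|) :=
  mul_nonneg ((partUnity m Y).nonneg _ _) (mul_nonneg (hg _) (abs_nonneg _))

theorem volIntegral_nonneg (ν : DForm m Y m) {g : Y → ℝ} (hg : ∀ y, 0 ≤ g y) :
    0 ≤ volIntegral ν g :=
  Finset.sum_nonneg fun p _ => integral_nonneg fun x => volIntegrand_nonneg ν hg p x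

theorem volIntegral_pos {ν : DForm m Y m} (hν : IsVolumeForm ν) {g : Y → ℝ}
    (hg : Continuous g) (h0 : ∀ y, 0 ≤ g y) {y : Y} (hy : g y ≠ 0) : 0 < volIntegral ν g := by
  obtain ⟨p, hp, hpy⟩ : ∃ p ∈ coverFinset m Y, partUnity m Y p y ≠ 0 := by
    by_contra! h
    have := sum_partUnity (m := m) y
    rw [Finset.sum_eq_zero h] at this
    exact zero_ne_one this
  refine Finset.sum_pos' (fun p _ => integral_nonneg fun x => volIntegrand_nonneg ν h0 p x)
    ⟨p, hp, ?_⟩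
  have hys : y ∈ (chartAt (Euc m) p).source := tsupport_partUnity p (subset_tsupport _ hpy)
  have hyt := (chartAt (Euc m) p).map_source hys
  rw [setIntegral_pos_iff_support_of_nonneg_ae
    (Filter.Eventually.of_forall fun x => volIntegrand_nonneg ν h0 p x)
    (integrableOn_partUnity_mul hν hg p), Set.inter_comm]
  have ho := ((continuousOn_comp_chart_symm (partUnity m Y p).contMDiff.continuous p).mul
    (continuousOn_volIntegrand hν hg p)).isOpen_inter_preimage (chartAt (Euc m) p).open_target
    isOpen_compl_singleton (t := {0}ᶜ)
  refine ho.measure_pos _ ⟨chartAt (Euc m) p y, hyt, ?_⟩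
  simp only [Set.mem_preimage, Set.mem_compl_iff, Set.mem_singleton_iff, Pi.mul_apply,
    (chartAt (Euc m) p).left_inv hys]
  exact mul_ne_zero hpy (mul_ne_zero hy (abs_ne_zero.2 (topCoeff_ne_zero hν.2 hyt)))

/-- The integral over `Y` of a function supported in the domain of a chart may be computed in that
chart. -/
theorem volIntegral_eq_chart {ν : DForm m Y m} (hν : IsVolumeForm ν) {g : Y → ℝ}
    (hg : Continuous g) {q : Y} (hq : tsupport g ⊆ (chartAt (Euc m) q).source) :
    volIntegral ν g = ∫ x in (chartAt (Euc m) q).target,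
      g ((chartAt (Euc m) q).symm x) * |topCoeff q ν x| := by
  have hq0 : ∀ y, y ∉ (chartAt (Euc m) q).source → g y = 0 := fun y hy =>
    image_eq_zero_of_notMem_tsupport fun h => hy (hq h)
  have hp0 : ∀ p y, y ∉ (chartAt (Euc m) p).source → partUnity m Y p y = 0 := fun p y hy =>
    image_eq_zero_of_notMem_tsupport fun h => hy (tsupport_partUnity p h)
  have key : ∀ p, ∫ x in (chartAt (Euc m) p).target,
      partUnity m Y p ((chartAt (Euc m) p).symm x) *
      (g ((chartAt (Euc m) p).symm x) * |topCoeff p ν x|) =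
      ∫ x in (chartAt (Euc m) q).target, partUnity m Y p ((chartAt (Euc m) q).symm x) *
      (g ((chartAt (Euc m) q).symm x) * |topCoeff q ν x|) := by
    intro p
    refine (setIntegral_eq_of_subset_of_forall_sdiff_eq_zero (s := transDom p q)
      (chartAt (Euc m) p).open_target.measurableSet Set.inter_subset_left ?_).trans
      (Eq.trans ?_ (setIntegral_eq_of_subset_of_forall_sdiff_eq_zero (s := transDom q p)
      (chartAt (Euc m) q).open_target.measurableSet Set.inter_subset_left ?_).symm)
    rotate_left
    · rw [← trans_image p q, integral_image_eq_integral_abs_det_fderiv_smul volume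
        (isOpen_transDom p q).measurableSet (fun x hx =>
          ((contDiffAt_trans hx).differentiableAt (by simp)).hasFDerivAt.hasFDerivWithinAt)
        (trans_injOn p q)]
      refine setIntegral_congr_fun (isOpen_transDom p q).measurableSet fun x hx => ?_
      rw [symm_trans hx, topCoeff_trans ν hx, abs_mul, smul_eq_mul]
      ring
    · intro x hx
      rw [hp0 p _ fun h => hx.2 ⟨hx.1, h⟩, zero_mul]
    · intro x hx
      rw [hq0 _ fun h => hx.2 ⟨hx.1, h⟩, zero_mul, mul_zero]
  unfold volIntegral
  rw [Finset.sum_congr rfl fun p _ => key p, ← integral_finsetSum]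
  · simp only [← Finset.sum_mul, sum_partUnity, one_mul]
  · intro p _
    have := integrableOn_volIntegrand hν (g := fun y => partUnity m Y p y * g y) (p := q)
      ((partUnity m Y p).contMDiff.continuous.mul hg) ((tsupport_mul_subset_right).trans hq)
    simpa only [mul_assoc, IntegrableOn] using this

variable [MeasurableSpace Y] [BorelSpace Y]

/-- The positive linear functional `g ↦ ∫ g |ν|` on continuous functions. -/
def volFunctional {ν : DForm m Y m} (hν : IsVolumeForm ν) :
    CompactlySupportedContinuousMap Y ℝ →ₚ[ℝ] ℝ :=
  PositiveLinearMap.mk₀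
    { toFun := fun g => volIntegral ν g
      map_add' := fun g h => volIntegral_add hν g.continuous h.continuous
      map_smul' := fun c g => volIntegral_const_mul ν c g }
    (fun _ hg => volIntegral_nonneg ν fun y => hg y)

/-- The measure `|ν|` on `Y` attached to a nowhere vanishing top-degree form `ν`. -/
def volMeasure {ν : DForm m Y m} (hν : IsVolumeForm ν) : Measure Y :=
  RealRMK.rieszMeasure (volFunctional hν)

theorem integral_volMeasure {ν : DForm m Y m} (hν : IsVolumeForm ν) {g : Y → ℝ}
    (hg : Continuous g) : ∫ y, g y ∂(volMeasure hν) = volIntegral ν g :=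
  RealRMK.integral_rieszMeasure (volFunctional hν)
    ⟨⟨g, hg⟩, HasCompactSupport.of_compactSpace g⟩

instance {ν : DForm m Y m} (hν : IsVolumeForm ν) : IsFiniteMeasure (volMeasure hν) := by
  unfold volMeasure
  infer_instance

end VolumeMeasure

/-! ### Components of one-forms and Cartan's formula -/

section Components

variable {m : ℕ} {Y : Type*} [TopologicalSpace Y] [ChartedSpace (Euc m) Y]

/-- The `i`-th component of a one-form in the chart around `p`. -/
def coordComp (p : Y) (σ : DForm m Y 1) (i : Fin m) (x : Euc m) : ℝ :=
  coordForm p σ x (fun _ => EuclideanSpace.basisFun (Fin m) ℝ i)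

theorem oneForm_eq_sum (σ : Euc m [⋀^Fin 1]→L[ℝ] ℝ) (v : Euc m) :
    σ (fun _ => v) = ∑ i, v i * σ (fun _ => EuclideanSpace.basisFun (Fin m) ℝ i) := by
  have h : oneFormLin σ v = ∑ i, v i * oneFormLin σ (EuclideanSpace.basisFun (Fin m) ℝ i) := by
    conv_lhs => rw [← (EuclideanSpace.basisFun (Fin m) ℝ).sum_repr v, map_sum]
    exact Finset.sum_congr rfl fun i _ => map_smul _ _ _
  exact h

theorem contDiffOn_apply_const {P : Type*} [NormedAddCommGroup P] [NormedSpace ℝ P] {k : ℕ}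
    {c : P → Euc m [⋀^Fin k]→L[ℝ] ℝ} {U : Set P} (hc : ContDiffOn ℝ ∞ c U) (v : Fin k → Euc m) :
    ContDiffOn ℝ ∞ (fun q => c q v) U :=
  (ContinuousAlternatingMap.apply ℝ (Euc m) ℝ v).contDiff.comp_contDiffOn hc

theorem IsSmoothForm.contDiffOn_coordComp {σ : DForm m Y 1} (h : IsSmoothForm σ) (p : Y)
    (i : Fin m) : ContDiffOn ℝ ∞ (coordComp p σ i) (chartAt (Euc m) p).target :=
  contDiffOn_apply_const (h p) _

theorem IsSmoothForm.add {k : ℕ} {σ τ : DForm m Y k} (hσ : IsSmoothForm σ) (hτ : IsSmoothForm τ) :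
    IsSmoothForm (fun y => σ y + τ y) := fun p => (hσ p).add (hτ p)

theorem IsSmoothForm.const_smul {k : ℕ} {σ : DForm m Y k} (hσ : IsSmoothForm σ) (c : ℝ) :
    IsSmoothForm (fun y => c • σ y) := fun p =>
  (contDiffOn_const (c := c)).smul (hσ p)

/-- Smoothness of a function on `Y`, expressed in the charts. -/
def IsSmoothFun (f : Y → ℝ) : Prop :=
  ∀ p : Y, ContDiffOn ℝ ∞ (fun x => f ((chartAt (Euc m) p).symm x)) (chartAt (Euc m) p).target

theorem IsSmoothForm.smul {k : ℕ} {σ : DForm m Y k} (hσ : IsSmoothForm σ) {f : Y → ℝ}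
    (hf : IsSmoothFun (m := m) f) : IsSmoothForm (fun y => f y • σ y) := fun p => (hf p).smul (hσ p)

theorem continuous_of_chart {f : Y → ℝ} (h : ∀ p : Y,
    ContinuousOn (fun x => f ((chartAt (Euc m) p).symm x)) (chartAt (Euc m) p).target) :
    Continuous f := by
  rw [continuous_iff_continuousAt]
  intro y
  have h1 := ((h y).comp (chartAt (Euc m) y).continuousOn
    (fun z hz => (chartAt (Euc m) y).map_source hz)).continuousAt
    ((chartAt (Euc m) y).open_source.mem_nhds (mem_chart_source _ y))
  refine h1.congr ?_
  filter_upwards [(chartAt (Euc m) y).open_source.mem_nhds (mem_chart_source _ y)] with z hz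
  simp [(chartAt (Euc m) y).left_inv hz]

theorem IsSmoothFun.continuous {f : Y → ℝ} (h : IsSmoothFun (m := m) f) : Continuous f :=
  continuous_of_chart fun p => (h p).continuousOn

/-- The derivative of a one-form in a chart, as a bilinear map: `(u, w) ↦ (∂_u σ) (w)`. -/
def derivBilin (s : Euc m → Euc m [⋀^Fin 1]→L[ℝ] ℝ) (x : Euc m) : Euc m →ₗ[ℝ] Euc m →ₗ[ℝ] ℝ :=
  LinearMap.mk₂ ℝ (fun u w => fderiv ℝ s x u (fun _ => w)) (fun u u' w => by simp)
    (fun c u w => by simp) (fun u w w' => oneForm_const_add _ _ _)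
    (fun c u w => oneForm_const_smul _ _ _)

theorem extDeriv_eq_derivBilin {s : Euc m → Euc m [⋀^Fin 1]→L[ℝ] ℝ} {x : Euc m}
    (hs : DifferentiableAt ℝ s x) (u w : Euc m) :
    extDeriv s x ![u, w] = derivBilin s x u w - derivBilin s x w u := by
  rw [extDeriv_apply hs, Fin.sum_univ_two]
  simp only [Fin.isValue, Fin.val_zero, pow_zero, one_smul, Fin.val_one, pow_one, neg_smul]
  rw [fderiv_continuousAlternatingMap_apply_const_apply hs,
    fderiv_continuousAlternatingMap_apply_const_apply hs, ← sub_eq_add_neg]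
  congr 1 <;> refine congrArg _ ?_ <;> ext i : 1 <;> rw [Subsingleton.elim i 0] <;> rfl

theorem derivBilin_basis {s : Euc m → Euc m [⋀^Fin 1]→L[ℝ] ℝ} {x : Euc m}
    (hs : DifferentiableAt ℝ s x) (i j : Fin m) :
    derivBilin s x (EuclideanSpace.basisFun (Fin m) ℝ i) (EuclideanSpace.basisFun (Fin m) ℝ j) =
      pd i (fun z => s z (fun _ => EuclideanSpace.basisFun (Fin m) ℝ j)) x := by
  unfold pd
  rw [fderiv_continuousAlternatingMap_apply_const_apply hs]
  rfl

theorem contDiffOn_apply_field {P : Type*} [NormedAddCommGroup P] [NormedSpace ℝ P]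
    {c : P → Euc m [⋀^Fin 1]→L[ℝ] ℝ} {V : P → Euc m} {U : Set P} (hc : ContDiffOn ℝ ∞ c U)
    (hV : ContDiffOn ℝ ∞ V U) : ContDiffOn ℝ ∞ (fun q => c q (fun _ => V q)) U := by
  have : (fun q => c q (fun _ => V q)) = fun q => ∑ i, V q i *
      c q (fun _ => EuclideanSpace.basisFun (Fin m) ℝ i) := by
    ext q; exact oneForm_eq_sum _ _
  rw [this]
  refine ContDiffOn.sum fun i _ => ContDiffOn.mul ?_ (contDiffOn_apply_const hc _)
  exact (EuclideanSpace.proj (𝕜 := ℝ) i).contDiff.comp_contDiffOn hV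

variable [IsManifold (𝓡 m) ∞ Y]

theorem IsSmoothForm.pair {σ : DForm m Y 1} (hσ : IsSmoothForm σ) {X : VField m Y}
    (hX : IsSmoothField X) : IsSmoothFun (m := m) (pair σ X) := fun p =>
  (contDiffOn_apply_field (hσ p) (hX.contDiffOn p)).congr fun _ hx => pair_symm σ X hx

theorem coordField_trans (X : VField m Y) {p q : Y} {x : Euc m} (hx : x ∈ transDom p q) :
    coordField q X (trans p q x) = fderiv ℝ (trans p q) x (coordField p X x) := by
  rw [coordField_eq, coordField_eq, symm_trans hx, ← dchart_dsymm_trans hx]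
  have h := congrArg (fun L => L (X ((chartAt (Euc m) p).symm x) : Euc m)) (dsymm_dchart hx.1)
  exact congrArg (dchart q ((chartAt (Euc m) p).symm x)) h.symm

theorem coordForm_two_apply (η : DForm m Y 2) (X : VField m Y) {p : Y} {x : Euc m}
    (hx : x ∈ (chartAt (Euc m) p).target) (v : Euc m) :
    coordForm p η x ![coordField p X x, v] =
      atPt η ((chartAt (Euc m) p).symm x) ![X ((chartAt (Euc m) p).symm x), dsymm p x v] := by
  have h := congrArg (fun L => L (X ((chartAt (Euc m) p).symm x) : Euc m)) (dsymm_dchart hx)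
  rw [coordForm_eq, ContinuousAlternatingMap.compContinuousLinearMap_apply]
  congr 1
  ext i : 1
  fin_cases i
  · exact h
  · rfl

/-- Cartan's formula `L_X σ = d (σ (X)) + ι_X dσ`: for a field preserving `σ`, the function `σ(X)`
is a Hamiltonian. -/
theorem Preserves.fderiv_pair {σ : DForm m Y 1} {X : VField m Y} (h : Preserves X σ)
    (hσ : IsSmoothForm σ) (hX : IsSmoothField X) {p : Y} {x : Euc m}
    (hx : x ∈ (chartAt (Euc m) p).target) (v : Euc m) :
    fderiv ℝ (fun z => pair σ X ((chartAt (Euc m) p).symm z)) x v =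
      -coordForm p (dForm σ) x ![coordField p X x, v] := by
  -- the formula at the centre of a chart, where `lieDeriv` is defined
  have key : ∀ (y : Y) (w : Euc m),
      fderiv ℝ (fun z => pair σ X ((chartAt (Euc m) y).symm z)) (chartAt (Euc m) y y) w =
        -extDeriv (coordForm y σ) (chartAt (Euc m) y y)
          ![coordField y X (chartAt (Euc m) y y), w] := by
    intro y w
    set x0 : Euc m := chartAt (Euc m) y y with hx0
    have ht : x0 ∈ (chartAt (Euc m) y).target := mem_chart_target (Euc m) y
    have ho := (chartAt (Euc m) y).open_target.mem_nhds ht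
    have hd1 : DifferentiableAt ℝ (coordForm y σ) x0 :=
      (hσ.contDiffAt ht).differentiableAt (by simp)
    have hd2 : DifferentiableAt ℝ (coordField y X) x0 :=
      ((hX.contDiffOn y).contDiffAt ho).differentiableAt (by simp)
    have hl : (fderiv ℝ (coordForm y σ) x0 (coordField y X x0)) (fun _ => w) +
        coordForm y σ x0 (fun _ => fderiv ℝ (coordField y X) x0 w) = 0 := by
      have h1 := h y w
      have h2 : (mfderiv (𝓡 m) (𝓡 m) (chartAt (Euc m) y) y w : Euc m) = w :=
        congrArg (fun L => L w) (dchart_self y)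
      unfold lieDeriv at h1
      simp only at h1
      rw [h2] at h1
      exact h1
    have he : (fun z => pair σ X ((chartAt (Euc m) y).symm z)) =ᶠ[𝓝 x0]
        fun z => coordForm y σ z (fun _ => coordField y X z) := by
      filter_upwards [ho] with z hz
      exact pair_symm σ X hz
    rw [he.fderiv_eq, extDeriv_eq_derivBilin hd1]
    have hf := hd1.hasFDerivAt.continuousAlternatingMap_apply
      (fun _ : Fin 1 => hd2.hasFDerivAt)
    rw [hf.fderiv]
    have e2 : (coordForm y σ x0).toContinuousLinearMap (fun _ => coordField y X x0) 0
        (fderiv ℝ (coordField y X) x0 w) =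
        coordForm y σ x0 (fun _ => fderiv ℝ (coordField y X) x0 w) :=
      congrArg (coordForm y σ x0) (Function.update_eq_const_of_subsingleton _ _ _)
    rw [Fin.sum_univ_one]
    refine (congrArg₂ (· + ·) rfl e2).trans ?_
    change (fderiv ℝ (coordForm y σ) x0 w) (fun _ => coordField y X x0) + _ =
      -((fderiv ℝ (coordForm y σ) x0 (coordField y X x0)) (fun _ => w) -
        (fderiv ℝ (coordForm y σ) x0 w) (fun _ => coordField y X x0))
    linarith
  have hd := mem_transDom_chart p hx
  set y := (chartAt (Euc m) p).symm x with hy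
  have hsm := hσ.pair hX
  have he : (fun z => pair σ X ((chartAt (Euc m) p).symm z)) =ᶠ[𝓝 x]
      (fun z => pair σ X ((chartAt (Euc m) y).symm z)) ∘ trans p y := by
    filter_upwards [(isOpen_transDom p y).mem_nhds hd] with z hz
    simp only [Function.comp_apply, symm_trans hz]
  have hT : trans p y x = chartAt (Euc m) y y := rfl
  rw [he.fderiv_eq, fderiv_comp x (((hsm y).contDiffAt ((chartAt (Euc m) y).open_target.mem_nhds
    (trans_mem_target hd))).differentiableAt (by simp))
    ((contDiffAt_trans hd).differentiableAt (by simp)), ContinuousLinearMap.comp_apply, hT, key,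
    coordForm_trans _ hd, coordForm_dForm hσ (trans_mem_target hd), ← hT, coordField_trans X hd,
    ContinuousAlternatingMap.compContinuousLinearMap_apply]
  congr 2
  ext i : 1
  fin_cases i <;> rfl

end Components

/-! ### The first variation of the volume form and Stokes' theorem -/

section SmoothFun

variable {m : ℕ} {Y : Type*} [TopologicalSpace Y] [ChartedSpace (Euc m) Y]

theorem IsSmoothFun.add {f g : Y → ℝ} (hf : IsSmoothFun (m := m) f) (hg : IsSmoothFun (m := m) g) :
    IsSmoothFun (m := m) (fun y => f y + g y) := fun p => (hf p).add (hg p)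

theorem IsSmoothFun.sub {f g : Y → ℝ} (hf : IsSmoothFun (m := m) f) (hg : IsSmoothFun (m := m) g) :
    IsSmoothFun (m := m) (fun y => f y - g y) := fun p => (hf p).sub (hg p)

theorem IsSmoothFun.mul {f g : Y → ℝ} (hf : IsSmoothFun (m := m) f) (hg : IsSmoothFun (m := m) g) :
    IsSmoothFun (m := m) (fun y => f y * g y) := fun p => (hf p).mul (hg p)

theorem isSmoothFun_const (c : ℝ) : IsSmoothFun (m := m) (fun _ : Y => c) :=
  fun _ => contDiffOn_const

theorem isSmoothFun_of_contMDiff [IsManifold (𝓡 m) ∞ Y] {f : Y → ℝ}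
    (hf : ContMDiff (𝓡 m) 𝓘(ℝ) ∞ f) : IsSmoothFun (m := m) f := fun p => by
  rw [← contMDiffOn_iff_contDiffOn]
  exact hf.comp_contMDiffOn (contMDiffOn_chart_symm (x := p))

theorem contDiffOn_skewSum {n : ℕ} {P : Type*} [NormedAddCommGroup P] [NormedSpace ℝ P]
    {U : Set P} {a : P → Fin (2 * n + 1) → ℝ} {b : P → Fin (2 * n + 1) → Fin (2 * n + 1) → ℝ}
    (ha : ∀ i, ContDiffOn ℝ ∞ (fun q => a q i) U)
    (hb : ∀ i j, ContDiffOn ℝ ∞ (fun q => b q i j) U) :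
    ContDiffOn ℝ ∞ (fun q => skewSum (a q) (b q)) U := by
  unfold skewSum
  exact ContDiffOn.sum fun π _ => contDiffOn_const.mul ((ha _).mul
    (contDiffOn_prod fun k _ => hb _ _))

theorem contDiffOn_skewSumDeriv {n : ℕ} {P : Type*} [NormedAddCommGroup P] [NormedSpace ℝ P]
    {U : Set P} {a : P → Fin (2 * n + 1) → ℝ} {b d : P → Fin (2 * n + 1) → Fin (2 * n + 1) → ℝ}
    (ha : ∀ i, ContDiffOn ℝ ∞ (fun q => a q i) U)
    (hb : ∀ i j, ContDiffOn ℝ ∞ (fun q => b q i j) U)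
    (hd : ∀ i j, ContDiffOn ℝ ∞ (fun q => d q i j) U) :
    ContDiffOn ℝ ∞ (fun q => skewSumDeriv (a q) (b q) (d q)) U := by
  unfold skewSumDeriv
  exact ContDiffOn.sum fun k _ => ContDiffOn.sum fun π _ => contDiffOn_const.mul
    ((ha _).mul ((hd _ _).mul (contDiffOn_prod fun k _ => hb _ _)))

theorem isSmoothFun_ratio [IsManifold (𝓡 m) ∞ Y] {ν : DForm m Y m} (hν : IsVolumeForm ν)
    {η : DForm m Y m}
    (hη : ∀ p : Y, ContDiffOn ℝ ∞ (topCoeff p η) (chartAt (Euc m) p).target) :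
    IsSmoothFun (m := m) (ratio ν η) := fun p =>
  ((hη p).div (hν.1 p) fun _ hx => topCoeff_ne_zero hν.2 hx).congr fun _ hx =>
    ratio_eq_topCoeff hν.2 η hx

end SmoothFun

section Variation

open MeasureTheory

variable {n : ℕ} {Y : Type*} [TopologicalSpace Y] [ChartedSpace (Euc (2 * n + 1)) Y]

/-- The top-degree form `α ∧ (dσ) ^ n / (2 ^ n n!)`. -/
def contactTop (α σ : DForm (2 * n + 1) Y 1) : DForm (2 * n + 1) Y (2 * n + 1) := fun y =>
  ((2 : ℝ) ^ n * (n.factorial : ℝ))⁻¹ • wedgePow (α y) (dForm σ y) n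

theorem volForm_eq (σ : DForm (2 * n + 1) Y 1) : volForm σ = contactTop σ σ := rfl

variable [IsManifold (𝓡 (2 * n + 1)) ∞ Y]

theorem topCoeff_contactTop (α : DForm (2 * n + 1) Y 1) {σ : DForm (2 * n + 1) Y 1}
    (hσ : IsSmoothForm σ) {p : Y} {x : Euc (2 * n + 1)}
    (hx : x ∈ (chartAt (Euc (2 * n + 1)) p).target) :
    topCoeff p (contactTop α σ) x = ((2 : ℝ) ^ n * (n.factorial : ℝ))⁻¹ *
      skewSum (fun i => coordComp p α i x) (fun i j => pd i (coordComp p σ j) x) := by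
  have hd : DifferentiableAt ℝ (coordForm p σ) x := (hσ.contDiffAt hx).differentiableAt (by simp)
  have h1 : coordForm p (contactTop α σ) x = ((2 : ℝ) ^ n * (n.factorial : ℝ))⁻¹ •
      wedgePow (coordForm p α x) (coordForm p (dForm σ) x) n := by
    rw [coordForm_eq α, coordForm_eq (dForm σ), wedgePow_comp]
    rfl
  unfold topCoeff
  rw [h1, ContinuousAlternatingMap.smul_apply, smul_eq_mul, coordForm_dForm hσ hx,
    wedgePow_apply _ _ _ (extDeriv_eq_derivBilin hd)]
  simp only [derivBilin_basis hd]
  rfl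

theorem contDiffOn_topCoeff_contactTop {α σ : DForm (2 * n + 1) Y 1} (hα : IsSmoothForm α)
    (hσ : IsSmoothForm σ) (p : Y) : ContDiffOn ℝ ∞ (topCoeff p (contactTop α σ))
      (chartAt (Euc (2 * n + 1)) p).target :=
  (contDiffOn_const.mul (contDiffOn_skewSum (fun i => hα.contDiffOn_coordComp p i)
    fun i j => contDiffOn_pd (chartAt (Euc (2 * n + 1)) p).open_target
      (hσ.contDiffOn_coordComp p j) i)).congr fun _ hx => topCoeff_contactTop α hσ hx

theorem IsContact.isVolumeForm {σ : DForm (2 * n + 1) Y 1} (hσ : IsContact σ) :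
    IsVolumeForm (volForm σ) :=
  ⟨fun p => contDiffOn_topCoeff_contactTop hσ.1 hσ.1 p, fun y =>
    smul_ne_zero (by positivity) (hσ.2 y)⟩

/-- The derivative at `s = 0` of the volume form of `σ + s α`, divided by the volume form `ν`. -/
def variation (ν : DForm (2 * n + 1) Y (2 * n + 1)) (σ α : DForm (2 * n + 1) Y 1) (y : Y) : ℝ :=
  deriv (fun s : ℝ => ratio ν (volForm (fun y => σ y + s • α y)) y) 0

theorem hasDerivAt_ratio_add_smul {ν : DForm (2 * n + 1) Y (2 * n + 1)} (hν : ∀ y, ν y ≠ 0)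
    {σ α : DForm (2 * n + 1) Y 1} (hσ : IsSmoothForm σ) (hα : IsSmoothForm α) {p : Y}
    {x : Euc (2 * n + 1)} (hx : x ∈ (chartAt (Euc (2 * n + 1)) p).target) :
    HasDerivAt (fun s : ℝ => ratio ν (volForm (fun y => σ y + s • α y))
        ((chartAt (Euc (2 * n + 1)) p).symm x))
      (((2 : ℝ) ^ n * (n.factorial : ℝ))⁻¹ *
        (skewSum (fun i => coordComp p α i x) (fun i j => pd i (coordComp p σ j) x) +
          skewSumDeriv (fun i => coordComp p σ i x) (fun i j => pd i (coordComp p σ j) x)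
            (fun i j => pd i (coordComp p α j) x)) / topCoeff p ν x) 0 := by
  have hx' := (chartAt (Euc (2 * n + 1)) p).open_target.mem_nhds hx
  have hd : ∀ {τ : DForm (2 * n + 1) Y 1}, IsSmoothForm τ → ∀ i,
      DifferentiableAt ℝ (coordComp p τ i) x := fun h i =>
    ((h.contDiffOn_coordComp p i).contDiffAt hx').differentiableAt (by simp)
  have h1 : ∀ s : ℝ, ratio ν (volForm (fun y => σ y + s • α y))
      ((chartAt (Euc (2 * n + 1)) p).symm x) = ((2 : ℝ) ^ n * (n.factorial : ℝ))⁻¹ *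
      skewSum (fun i => coordComp p σ i x + s * coordComp p α i x)
        (fun i j => pd i (coordComp p σ j) x + s * pd i (coordComp p α j) x) /
        topCoeff p ν x := by
    intro s
    rw [ratio_eq_topCoeff hν _ hx, volForm_eq, topCoeff_contactTop _ (hσ.add (hα.const_smul s)) hx]
    congr 3
    ext i j
    have : coordComp p (fun y => σ y + s • α y) j =
        fun z => coordComp p σ j z + s * coordComp p α j z := rfl
    unfold pd
    rw [this, fderiv_fun_add (hd hσ j) ((hd hα j).const_mul s), fderiv_const_mul (hd hα j)]
    rfl
  simp only [h1]
  refine HasDerivAt.div_const (HasDerivAt.const_mul _ ?_) _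
  have h2 := hasDerivAt_skewSum (t := 0)
    (a := fun s i => coordComp p σ i x + s * coordComp p α i x)
    (b := fun s i j => pd i (coordComp p σ j) x + s * pd i (coordComp p α j) x)
    (fun i => (hasDerivAt_mul_const _).const_add _)
    (fun i j => (hasDerivAt_mul_const _).const_add _)
  simpa using h2

theorem variation_eq {ν : DForm (2 * n + 1) Y (2 * n + 1)} (hν : ∀ y, ν y ≠ 0)
    {σ α : DForm (2 * n + 1) Y 1} (hσ : IsSmoothForm σ) (hα : IsSmoothForm α) {p : Y}
    {x : Euc (2 * n + 1)} (hx : x ∈ (chartAt (Euc (2 * n + 1)) p).target) :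
    variation ν σ α ((chartAt (Euc (2 * n + 1)) p).symm x) =
      ((2 : ℝ) ^ n * (n.factorial : ℝ))⁻¹ *
        (skewSum (fun i => coordComp p α i x) (fun i j => pd i (coordComp p σ j) x) +
          skewSumDeriv (fun i => coordComp p σ i x) (fun i j => pd i (coordComp p σ j) x)
            (fun i j => pd i (coordComp p α j) x)) / topCoeff p ν x :=
  (hasDerivAt_ratio_add_smul hν hσ hα hx).deriv

theorem isSmoothFun_variation {ν : DForm (2 * n + 1) Y (2 * n + 1)} (hν : IsVolumeForm ν)
    {σ α : DForm (2 * n + 1) Y 1} (hσ : IsSmoothForm σ) (hα : IsSmoothForm α) :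
    IsSmoothFun (m := 2 * n + 1) (variation ν σ α) := fun p => by
  have ho := (chartAt (Euc (2 * n + 1)) p).open_target
  refine ((contDiffOn_const.mul ((contDiffOn_skewSum (fun i => hα.contDiffOn_coordComp p i)
    fun i j => contDiffOn_pd ho (hσ.contDiffOn_coordComp p j) i).add
    (contDiffOn_skewSumDeriv (fun i => hσ.contDiffOn_coordComp p i)
    (fun i j => contDiffOn_pd ho (hσ.contDiffOn_coordComp p j) i)
    fun i j => contDiffOn_pd ho (hα.contDiffOn_coordComp p j) i))).div (hν.1 p)
    fun x hx => topCoeff_ne_zero hν.2 hx).congr fun x hx => variation_eq hν.2 hσ hα hx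

/-- The function whose integral vanishes by Stokes' theorem: up to the volume form `ν`, it is the
differential of a multiple of `f σ ∧ α ∧ (dσ) ^ (n - 1)`, once `df = -ι_X dσ`. -/
def stokesFun (ν : DForm (2 * n + 1) Y (2 * n + 1)) (σ : DForm (2 * n + 1) Y 1)
    (f : Y → ℝ) (X : VField (2 * n + 1) Y) (α : DForm (2 * n + 1) Y 1) (y : Y) : ℝ :=
  f y * variation ν σ α y - (n + 1) * (f y * ratio ν (contactTop α σ) y) +
    (pair α X y * ratio ν (volForm σ) y - pair σ X y * ratio ν (contactTop α σ) y)

theorem isSmoothFun_stokesFun {ν : DForm (2 * n + 1) Y (2 * n + 1)} (hν : IsVolumeForm ν)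
    {σ α : DForm (2 * n + 1) Y 1} (hσ : IsSmoothForm σ) (hα : IsSmoothForm α)
    {f : Y → ℝ} (hf : IsSmoothFun (m := 2 * n + 1) f) {X : VField (2 * n + 1) Y}
    (hX : IsSmoothField X) : IsSmoothFun (m := 2 * n + 1) (stokesFun ν σ f X α) := by
  have h1 := isSmoothFun_ratio hν fun p => contDiffOn_topCoeff_contactTop hα hσ p
  have h2 := isSmoothFun_ratio hν fun p => contDiffOn_topCoeff_contactTop hσ hσ p
  exact ((hf.mul (isSmoothFun_variation hν hσ hα)).sub ((isSmoothFun_const _).mul (hf.mul h1))).add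
    (((hα.pair hX).mul h2).sub ((hσ.pair hX).mul h1))

/-- The expression of `stokesFun` in a chart, as the total divergence of
`setIntegral_stokes`. -/
theorem stokesFun_eq {ν : DForm (2 * n + 1) Y (2 * n + 1)} (hν : IsVolumeForm ν)
    {σ α : DForm (2 * n + 1) Y 1} (hσ : IsSmoothForm σ) (hα : IsSmoothForm α)
    {f : Y → ℝ} {X : VField (2 * n + 1) Y} {p : Y} {x : Euc (2 * n + 1)}
    (hx : x ∈ (chartAt (Euc (2 * n + 1)) p).target)
    (hfX : ∀ v, fderiv ℝ (fun z => f ((chartAt (Euc (2 * n + 1)) p).symm z)) x v =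
      -coordForm p (dForm σ) x ![coordField p X x, v]) :
    stokesFun ν σ f X α ((chartAt (Euc (2 * n + 1)) p).symm x) * topCoeff p ν x =
      ((2 : ℝ) ^ n * (n.factorial : ℝ))⁻¹ *
      (f ((chartAt (Euc (2 * n + 1)) p).symm x) *
        skewSumDeriv (fun i => coordComp p σ i x) (fun i j => pd i (coordComp p σ j) x)
          (fun i j => pd i (coordComp p α j) x) +
      skewSumDeriv (fun i => coordComp p σ i x) (fun i j => pd i (coordComp p σ j) x)
        (fun i j => pd i (fun z => f ((chartAt (Euc (2 * n + 1)) p).symm z)) x *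
          coordComp p α j x) -
      n * (f ((chartAt (Euc (2 * n + 1)) p).symm x) *
        skewSum (fun i => coordComp p α i x) (fun i j => pd i (coordComp p σ j) x))) := by
  have hd : DifferentiableAt ℝ (coordForm p σ) x := (hσ.contDiffAt hx).differentiableAt (by simp)
  have h0 := topCoeff_ne_zero hν.2 hx
  have hc := skewSumDeriv_contract (EuclideanSpace.basisFun (Fin (2 * n + 1)) ℝ).toBasis
    (coordForm p σ x) (coordForm p α x) (coordForm p (dForm σ) x) (coordField p X x)
    (derivBilin (coordForm p σ) x)
    (fun u w => by rw [coordForm_dForm hσ hx]; exact extDeriv_eq_derivBilin hd u w)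
  simp only [OrthonormalBasis.coe_toBasis, derivBilin_basis hd] at hc
  change coordForm p σ x (fun _ => coordField p X x) *
      skewSum (fun i => coordComp p α i x) (fun i j => pd i (coordComp p σ j) x) +
    skewSumDeriv (fun i => coordComp p σ i x) (fun i j => pd i (coordComp p σ j) x)
      (fun i j => coordComp p α i x * coordForm p (dForm σ) x ![coordField p X x,
        EuclideanSpace.basisFun (Fin (2 * n + 1)) ℝ j]) =
    coordForm p α x (fun _ => coordField p X x) *
      skewSum (fun i => coordComp p σ i x) (fun i j => pd i (coordComp p σ j) x) at hc
  have ht := skewSumDeriv_transpose (fun i => coordComp p σ i x)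
    (fun i j => pd i (coordComp p σ j) x) (fun i j => coordComp p α i x *
      pd j (fun z => f ((chartAt (Euc (2 * n + 1)) p).symm z)) x)
  have hp : ∀ j, pd j (fun z => f ((chartAt (Euc (2 * n + 1)) p).symm z)) x =
      -coordForm p (dForm σ) x ![coordField p X x,
        EuclideanSpace.basisFun (Fin (2 * n + 1)) ℝ j] := fun j => hfX _
  have hneg : skewSumDeriv (fun i => coordComp p σ i x) (fun i j => pd i (coordComp p σ j) x)
      (fun i j => coordComp p α i x *
        pd j (fun z => f ((chartAt (Euc (2 * n + 1)) p).symm z)) x) =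
      -skewSumDeriv (fun i => coordComp p σ i x) (fun i j => pd i (coordComp p σ j) x)
      (fun i j => coordComp p α i x * coordForm p (dForm σ) x ![coordField p X x,
        EuclideanSpace.basisFun (Fin (2 * n + 1)) ℝ j]) := by
    simp only [hp, skewSumDeriv, ← Finset.sum_neg_distrib]
    refine Finset.sum_congr rfl fun k _ => Finset.sum_congr rfl fun π _ => by ring
  rw [hneg, neg_neg] at ht
  simp only [mul_comm (coordComp p α _ x) (pd _ _ x)] at ht
  unfold stokesFun
  rw [variation_eq hν.2 hσ hα hx, volForm_eq, ratio_eq_topCoeff hν.2 _ hx,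
    ratio_eq_topCoeff hν.2 _ hx, topCoeff_contactTop _ hσ hx, topCoeff_contactTop _ hσ hx,
    pair_symm α X hx, pair_symm σ X hx]
  field_simp
  linear_combination -hc - ht

theorem eventually_sign_eq {m : ℕ} {U : Set (Euc m)} (hU : IsOpen U) {g : Euc m → ℝ}
    (hg : ContinuousOn g U) (h0 : ∀ x ∈ U, g x ≠ 0) {x : Euc m} (hx : x ∈ U) :
    ∀ᶠ z in 𝓝 x, Real.sign (g z) = Real.sign (g x) := by
  have hc := hg.continuousAt (hU.mem_nhds hx)
  rcases lt_or_gt_of_ne (h0 x hx) with h | h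
  · filter_upwards [hc.eventually (gt_mem_nhds h)] with z hz
    rw [Real.sign_of_neg h, Real.sign_of_neg hz]
  · filter_upwards [hc.eventually (lt_mem_nhds h)] with z hz
    rw [Real.sign_of_pos h, Real.sign_of_pos hz]

theorem skewSum_add_left (a a' : Fin (2 * n + 1) → ℝ)
    (b : Fin (2 * n + 1) → Fin (2 * n + 1) → ℝ) :
    skewSum (fun i => a i + a' i) b = skewSum a b + skewSum a' b := by
  simp only [skewSum, ← Finset.sum_add_distrib]
  exact Finset.sum_congr rfl fun π _ => by ring

theorem skewSumDeriv_add (a : Fin (2 * n + 1) → ℝ)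
    (b d d' : Fin (2 * n + 1) → Fin (2 * n + 1) → ℝ) :
    skewSumDeriv a b (fun i j => d i j + d' i j) = skewSumDeriv a b d + skewSumDeriv a b d' := by
  simp only [skewSumDeriv, ← Finset.sum_add_distrib]
  exact Finset.sum_congr rfl fun k _ => Finset.sum_congr rfl fun π _ => by ring

/-- Additivity in `α`, which allows to localize `α` by a partition of unity. -/
theorem stokesFun_add {ν : DForm (2 * n + 1) Y (2 * n + 1)} (hν : IsVolumeForm ν)
    {σ α α' : DForm (2 * n + 1) Y 1} (hσ : IsSmoothForm σ) (hα : IsSmoothForm α)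
    (hα' : IsSmoothForm α') {f : Y → ℝ} {X : VField (2 * n + 1) Y}
    (hfX : ∀ (p : Y), ∀ x ∈ (chartAt (Euc (2 * n + 1)) p).target, ∀ v,
      fderiv ℝ (fun z => f ((chartAt (Euc (2 * n + 1)) p).symm z)) x v =
        -coordForm p (dForm σ) x ![coordField p X x, v]) (y : Y) :
    stokesFun ν σ f X (fun y => α y + α' y) y =
      stokesFun ν σ f X α y + stokesFun ν σ f X α' y := by
  set ψ := chartAt (Euc (2 * n + 1)) y with hψ
  have hyt : ψ y ∈ ψ.target := mem_chart_target _ y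
  have hd : ∀ {τ : DForm (2 * n + 1) Y 1}, IsSmoothForm τ → ∀ i,
      DifferentiableAt ℝ (coordComp y τ i) (ψ y) := fun h i =>
    ((h.contDiffOn_coordComp y i).contDiffAt (ψ.open_target.mem_nhds hyt)).differentiableAt
      (by simp)
  have h0 := topCoeff_ne_zero hν.2 hyt
  have e1 : ∀ j z, coordComp y (fun y => α y + α' y) j z = coordComp y α j z + coordComp y α' j z :=
    fun _ _ => rfl
  have e2 : ∀ i j, pd i (coordComp y (fun y => α y + α' y) j) (ψ y) =
      pd i (coordComp y α j) (ψ y) + pd i (coordComp y α' j) (ψ y) := fun i j => by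
    have : coordComp y (fun y => α y + α' y) j = fun z => coordComp y α j z + coordComp y α' j z :=
      rfl
    unfold pd
    rw [this, fderiv_fun_add (hd hα j) (hd hα' j)]
    rfl
  have h1 := stokesFun_eq hν hσ hα (f := f) (X := X) hyt (hfX y _ hyt)
  have h2 := stokesFun_eq hν hσ hα' (f := f) (X := X) hyt (hfX y _ hyt)
  have h3 := stokesFun_eq hν hσ (hα.add hα') (f := f) (X := X) hyt (hfX y _ hyt)
  simp only [e1, e2, mul_add, skewSum_add_left, skewSumDeriv_add] at h3
  rw [ψ.left_inv (mem_chart_source _ y)] at h1 h2 h3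
  refine mul_right_cancel₀ h0 ?_
  rw [add_mul, h1, h2, h3]
  ring

variable [T2Space Y] [CompactSpace Y] [MeasurableSpace Y] [BorelSpace Y]

/-- **Stokes' theorem** for a form `α` supported in the domain of a chart. -/
theorem integral_stokesFun_of_support {ν : DForm (2 * n + 1) Y (2 * n + 1)} (hν : IsVolumeForm ν)
    {σ α : DForm (2 * n + 1) Y 1} (hσ : IsSmoothForm σ) (hα : IsSmoothForm α)
    {f : Y → ℝ} (hf : IsSmoothFun (m := 2 * n + 1) f) {X : VField (2 * n + 1) Y}
    (hX : IsSmoothField X)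
    (hfX : ∀ (p : Y), ∀ x ∈ (chartAt (Euc (2 * n + 1)) p).target, ∀ v,
      fderiv ℝ (fun z => f ((chartAt (Euc (2 * n + 1)) p).symm z)) x v =
        -coordForm p (dForm σ) x ![coordField p X x, v])
    {S : Set Y} (hS : IsClosed S) {q : Y} (hq : S ⊆ (chartAt (Euc (2 * n + 1)) q).source)
    (hαS : ∀ y, y ∉ S → α y = 0) :
    ∫ y, stokesFun ν σ f X α y ∂(volMeasure hν) = 0 := by
  set φ := chartAt (Euc (2 * n + 1)) q with hφ
  have hg := (isSmoothFun_stokesFun hν hσ hα hf hX).continuous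
  have hα0 : ∀ (p : Y) (i : Fin (2 * n + 1)), ∀ x ∈ (chartAt (Euc (2 * n + 1)) p).target,
      (chartAt (Euc (2 * n + 1)) p).symm x ∉ S → coordComp p α i x = 0 := by
    intro p i x _ hxS
    unfold coordComp coordForm
    rw [hαS _ hxS]
    rfl
  have hsupp : ∀ y, y ∉ S → stokesFun ν σ f X α y = 0 := by
    intro y hy
    set ψ := chartAt (Euc (2 * n + 1)) y with hψ
    have hyt : ψ y ∈ ψ.target := mem_chart_target _ y
    have hev : ∀ i, coordComp y α i =ᶠ[𝓝 (ψ y)] fun _ => 0 := fun i => by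
      have hc : ContinuousAt ψ.symm (ψ y) := ψ.continuousAt_symm hyt
      have hy' : ψ.symm (ψ y) ∈ Sᶜ := by rwa [ψ.left_inv (mem_chart_source _ y)]
      filter_upwards [hc.eventually (hS.isOpen_compl.mem_nhds hy'),
        ψ.open_target.mem_nhds hyt] with z hz hzt
      exact hα0 y i z hzt hz
    have h1 := stokesFun_eq hν hσ hα (f := f) (X := X) hyt (hfX y _ hyt)
    have h2 : ∀ i j, pd i (coordComp y α j) (ψ y) = 0 := fun i j => by
      unfold pd
      rw [(hev j).fderiv_eq]
      simp
    simp only [h2, (hev _).eq_of_nhds] at h1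
    rw [ψ.left_inv (mem_chart_source _ y)] at h1
    have h3 := topCoeff_ne_zero hν.2 hyt
    have h4 : stokesFun ν σ f X α y * topCoeff y ν (ψ y) = 0 := by
      rw [h1]
      simp [skewSum, skewSumDeriv]
    exact (mul_eq_zero.1 h4).resolve_right h3
  have hts : tsupport (stokesFun ν σ f X α) ⊆ S := closure_minimal (fun y hy => by
    by_contra h
    exact hy (hsupp y h)) hS
  obtain ⟨hK, hKt⟩ := isCompact_chart_image hS.isCompact hq
  rw [integral_volMeasure hν hg, volIntegral_eq_chart hν hg (hts.trans hq)]
  -- The sign of `ν` in the chart is a locally constant factor, absorbed into `f`.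
  set s : Euc (2 * n + 1) → ℝ := fun x => Real.sign (topCoeff q ν x) with hs
  have hsev : ∀ x ∈ φ.target, s =ᶠ[𝓝 x] fun _ => s x := fun x hx =>
    eventually_sign_eq φ.open_target (hν.1 q).continuousOn
      (fun z hz => topCoeff_ne_zero hν.2 hz) hx
  have hss : ContDiffOn ℝ ∞ s φ.target := fun x hx =>
    (contDiffAt_const.congr_of_eventuallyEq (hsev x hx)).contDiffWithinAt
  have hpd : ∀ x ∈ φ.target, ∀ i, pd i (fun z => s z * f (φ.symm z)) x =
      s x * pd i (fun z => f (φ.symm z)) x := fun x hx i => by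
    have : (fun z => s z * f (φ.symm z)) =ᶠ[𝓝 x] fun z => s x * f (φ.symm z) := by
      filter_upwards [hsev x hx] with z hz
      rw [hz]
    unfold pd
    rw [this.fderiv_eq, fderiv_const_mul (((hf q).contDiffAt
      (φ.open_target.mem_nhds hx)).differentiableAt (by simp))]
    rfl
  have hst := setIntegral_stokes φ.open_target hK hKt
    (f := fun z => s z * f (φ.symm z)) (A := coordComp q σ) (C := coordComp q α)
    (hss.mul (hf q)) (hσ.contDiffOn_coordComp q) (hα.contDiffOn_coordComp q)
    (fun i x hx hxK => hα0 q i x hx (symm_notMem_of_notMem_image hx hxK))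
  rw [← mul_zero ((2 : ℝ) ^ n * (n.factorial : ℝ))⁻¹, ← hst, ← integral_const_mul]
  refine setIntegral_congr_fun φ.open_target.measurableSet fun x hx => ?_
  have h1 := stokesFun_eq hν hσ hα (f := f) (X := X) hx (hfX q x hx)
  have h2 : skewSumDeriv (fun i => coordComp q σ i x) (fun i j => pd i (coordComp q σ j) x)
      (fun i j => pd i (fun z => s z * f (φ.symm z)) x * coordComp q α j x) =
      s x * skewSumDeriv (fun i => coordComp q σ i x) (fun i j => pd i (coordComp q σ j) x)
      (fun i j => pd i (fun z => f (φ.symm z)) x * coordComp q α j x) := by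
    simp only [hpd x hx, skewSumDeriv, Finset.mul_sum]
    refine Finset.sum_congr rfl fun k _ => Finset.sum_congr rfl fun π _ => by ring
  rw [h2, abs_eq_sign_mul]
  linear_combination s x * h1

/-- **Stokes' theorem** for `f σ ∧ α ∧ (dσ) ^ (n - 1)`, if `df = -ι_X dσ`. -/
theorem integral_stokesFun {ν : DForm (2 * n + 1) Y (2 * n + 1)} (hν : IsVolumeForm ν)
    {σ α : DForm (2 * n + 1) Y 1} (hσ : IsSmoothForm σ) (hα : IsSmoothForm α)
    {f : Y → ℝ} (hf : IsSmoothFun (m := 2 * n + 1) f) {X : VField (2 * n + 1) Y}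
    (hX : IsSmoothField X)
    (hfX : ∀ (p : Y), ∀ x ∈ (chartAt (Euc (2 * n + 1)) p).target, ∀ v,
      fderiv ℝ (fun z => f ((chartAt (Euc (2 * n + 1)) p).symm z)) x v =
        -coordForm p (dForm σ) x ![coordField p X x, v]) :
    ∫ y, stokesFun ν σ f X α y ∂(volMeasure hν) = 0 := by
  rcases isEmpty_or_nonempty Y with hY | ⟨⟨y₀⟩⟩
  · exact integral_of_isEmpty
  -- Sum the statements for the products of `α` with the functions of a partition of unity.
  have key : ∀ T : Finset Y,
      IsSmoothForm (fun y => (∑ q ∈ T, partUnity (2 * n + 1) Y q y) • α y) ∧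
      ∫ y, stokesFun ν σ f X (fun y => (∑ q ∈ T, partUnity (2 * n + 1) Y q y) • α y) y
        ∂(volMeasure hν) = 0 := by
    classical
    intro T
    induction T using Finset.induction_on with
    | empty =>
      have h0 : IsSmoothForm (fun y : Y => (∑ q ∈ (∅ : Finset Y),
          partUnity (2 * n + 1) Y q y) • α y) :=
        hα.smul (by simpa using isSmoothFun_const (m := 2 * n + 1) (Y := Y) 0)
      exact ⟨h0, integral_stokesFun_of_support hν hσ h0 hf hX hfX isClosed_empty
        (Set.empty_subset (chartAt (Euc (2 * n + 1)) y₀).source) fun y _ => by simp⟩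
    | insert q T hqT ih =>
      have h1 : IsSmoothForm (fun y : Y => partUnity (2 * n + 1) Y q y • α y) :=
        hα.smul (isSmoothFun_of_contMDiff (partUnity (2 * n + 1) Y q).contMDiff)
      have h2 := integral_stokesFun_of_support hν hσ h1 hf hX hfX
        (isClosed_tsupport (partUnity (2 * n + 1) Y q)) (tsupport_partUnity q)
        fun y hy => by rw [image_eq_zero_of_notMem_tsupport hy, zero_smul]
      have he : (fun y : Y => (∑ q ∈ insert q T, partUnity (2 * n + 1) Y q y) • α y) =
          fun y => partUnity (2 * n + 1) Y q y • α y +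
            (∑ q ∈ T, partUnity (2 * n + 1) Y q y) • α y := by
        ext y : 1
        rw [Finset.sum_insert hqT, add_smul]
      rw [he]
      refine ⟨h1.add ih.1, ?_⟩
      simp only [stokesFun_add hν hσ h1 ih.1 hfX]
      rw [integral_add, h2, ih.2, add_zero]
      · exact (isSmoothFun_stokesFun hν hσ h1 hf hX).continuous.integrable_of_hasCompactSupport
          (HasCompactSupport.of_compactSpace _)
      · exact (isSmoothFun_stokesFun hν hσ ih.1 hf hX).continuous.integrable_of_hasCompactSupport
          (HasCompactSupport.of_compactSpace _)
  have h := (key (coverFinset (2 * n + 1) Y)).2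
  simpa only [sum_partUnity, one_smul] using h

end Variation

/-! ### Smooth families -/

section Families

open MeasureTheory

/-- Differentiation under the integral sign over a compact space. -/
theorem hasDerivAt_integral_of_continuousOn {Y : Type*} [TopologicalSpace Y] [CompactSpace Y]
    [MeasurableSpace Y] [BorelSpace Y] {μ : Measure Y} [IsFiniteMeasure μ]
    {U : Set ℝ} (hU : IsOpen U) {F F' : ℝ → Y → ℝ}
    (hF : ∀ t ∈ U, ∀ y, HasDerivAt (fun t => F t y) (F' t y) t) (hFc : ∀ t ∈ U, Continuous (F t))
    (hF' : ContinuousOn (fun q : ℝ × Y => F' q.1 q.2) (U ×ˢ Set.univ)) {t₀ : ℝ} (ht₀ : t₀ ∈ U) :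
    HasDerivAt (fun t => ∫ y, F t y ∂μ) (∫ y, F' t₀ y ∂μ) t₀ := by
  obtain ⟨δ, hδ, hδU⟩ := Metric.nhds_basis_closedBall.mem_iff.1 (hU.mem_nhds ht₀)
  have hK : IsCompact (Metric.closedBall t₀ δ ×ˢ (Set.univ : Set Y)) :=
    (isCompact_closedBall t₀ δ).prod isCompact_univ
  obtain ⟨C, hC⟩ := hK.exists_bound_of_continuousOn
    (hF'.mono (Set.prod_mono hδU subset_rfl))
  have hc' : Continuous (F' t₀) := by
    have := hF'.comp (f := fun y : Y => (t₀, y)) (s := Set.univ) (by fun_prop)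
      fun y _ => ⟨ht₀, Set.mem_univ y⟩
    exact continuousOn_univ.1 this
  refine (hasDerivAt_integral_of_dominated_loc_of_deriv_le (bound := fun _ => C)
    (F' := F') (Metric.closedBall_mem_nhds t₀ hδ) ?_ ?_ ?_ ?_ (integrable_const C) ?_).2
  · filter_upwards [hU.mem_nhds ht₀] with t ht
    exact ((hFc t ht).integrable_of_hasCompactSupport
      (HasCompactSupport.of_compactSpace _)).aestronglyMeasurable
  · exact (hFc t₀ ht₀).integrable_of_hasCompactSupport (HasCompactSupport.of_compactSpace _)
  · exact (hc'.integrable_of_hasCompactSupport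
      (HasCompactSupport.of_compactSpace _)).aestronglyMeasurable
  · exact Filter.Eventually.of_forall fun y t ht => hC (t, y) ⟨ht, Set.mem_univ y⟩
  · exact Filter.Eventually.of_forall fun y t ht => hF t (hδU ht) y

section Slices

variable {E G : Type*} [NormedAddCommGroup E] [NormedSpace ℝ E] [NormedAddCommGroup G]
  [NormedSpace ℝ G] {O : Set (ℝ × E)} {f : ℝ × E → G}

theorem hasDerivAt_slice (hO : IsOpen O) (hf : ContDiffOn ℝ ∞ f O) {t : ℝ} {x : E}
    (h : (t, x) ∈ O) : HasDerivAt (fun s => f (s, x)) (fderiv ℝ f (t, x) (1, 0)) t := by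
  have h1 := ((hf.contDiffAt (hO.mem_nhds h)).differentiableAt (by simp)).hasFDerivAt
  have h2 := h1.comp_hasDerivAt t ((hasDerivAt_id t).prodMk (hasDerivAt_const t x))
  exact h2

theorem hasFDerivAt_slice (hO : IsOpen O) (hf : ContDiffOn ℝ ∞ f O) {t : ℝ} {x : E}
    (h : (t, x) ∈ O) :
    HasFDerivAt (fun z => f (t, z)) ((fderiv ℝ f (t, x)).comp (ContinuousLinearMap.inr ℝ ℝ E)) x :=
  ((hf.contDiffAt (hO.mem_nhds h)).differentiableAt (by simp)).hasFDerivAt.comp x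
    (hasFDerivAt_prodMk_right t x)

theorem contDiffOn_fderiv_apply (hO : IsOpen O) (hf : ContDiffOn ℝ ∞ f O) (v : ℝ × E) :
    ContDiffOn ℝ ∞ (fun q => fderiv ℝ f q v) O :=
  (hf.fderiv_of_isOpen hO (by simp)).clm_apply contDiffOn_const

theorem fderiv_fderiv_comm (hO : IsOpen O) (hf : ContDiffOn ℝ ∞ f O) {q : ℝ × E} (h : q ∈ O)
    (u v : ℝ × E) :
    fderiv ℝ (fun q => fderiv ℝ f q u) q v = fderiv ℝ (fun q => fderiv ℝ f q v) q u := by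
  have hx' := hO.mem_nhds h
  have h1 : DifferentiableAt ℝ (fderiv ℝ f) q :=
    (((hf.fderiv_of_isOpen hO (m := ∞) (by simp)).contDiffAt hx').differentiableAt (by simp))
  have h2 := (hf.contDiffAt hx').isSymmSndFDerivAt
    (by simpa using (show (2 : WithTop ℕ∞) ≤ ∞ from WithTop.coe_le_coe.2 le_top))
  have h3 : ∀ u v, fderiv ℝ (fun q => fderiv ℝ f q u) q v = fderiv ℝ (fderiv ℝ f) q v u := by
    intro u v
    rw [fderiv_clm_apply h1 (differentiableAt_const _)]
    simp
  rw [h3, h3, h2.eq]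

end Slices

variable {m : ℕ} {Y : Type*} [TopologicalSpace Y] [ChartedSpace (Euc m) Y]

/-- A family of functions on `Y` that is jointly smooth in the parameter and the point. -/
def IsSmoothFunFamily (U : Set ℝ) (F : ℝ → Y → ℝ) : Prop :=
  ∀ p : Y, ContDiffOn ℝ ∞ (fun q : ℝ × Euc m => F q.1 ((chartAt (Euc m) p).symm q.2))
    (U ×ˢ (chartAt (Euc m) p).target)

theorem contDiffOn_slice {P : Type*} [NormedAddCommGroup P] [NormedSpace ℝ P]
    {G : Type*} [NormedAddCommGroup G] [NormedSpace ℝ G] {U : Set P} {T : Set (Euc m)}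
    {f : P × Euc m → G} (hf : ContDiffOn ℝ ∞ f (U ×ˢ T)) {t : P} (ht : t ∈ U) :
    ContDiffOn ℝ ∞ (fun x => f (t, x)) T :=
  hf.comp (contDiffOn_const.prodMk contDiffOn_id) fun _ hx => ⟨ht, hx⟩

theorem IsSmoothFunFamily.isSmoothFun {U : Set ℝ} {F : ℝ → Y → ℝ}
    (hF : IsSmoothFunFamily (m := m) U F) {t : ℝ} (ht : t ∈ U) : IsSmoothFun (m := m) (F t) :=
  fun p => contDiffOn_slice (hF p) ht

theorem IsSmoothFunFamily.mul {U : Set ℝ} {F G : ℝ → Y → ℝ} (hF : IsSmoothFunFamily (m := m) U F)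
    (hG : IsSmoothFunFamily (m := m) U G) :
    IsSmoothFunFamily (m := m) U (fun t y => F t y * G t y) := fun p => (hF p).mul (hG p)

theorem IsSmoothFun.family {f : Y → ℝ} (hf : IsSmoothFun (m := m) f) (U : Set ℝ) :
    IsSmoothFunFamily (m := m) U (fun _ => f) := fun p =>
  (hf p).comp contDiffOn_snd fun _ hq => hq.2

theorem IsSmoothFunFamily.hasDerivAt_integral [CompactSpace Y] [MeasurableSpace Y] [BorelSpace Y]
    {μ : Measure Y} [IsFiniteMeasure μ] {U : Set ℝ} (hU : IsOpen U) {F : ℝ → Y → ℝ}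
    (hF : IsSmoothFunFamily (m := m) U F) {t₀ : ℝ} (ht₀ : t₀ ∈ U) {F' : Y → ℝ}
    (hF' : ∀ y, HasDerivAt (fun t => F t y) (F' y) t₀) :
    HasDerivAt (fun t => ∫ y, F t y ∂μ) (∫ y, F' y ∂μ) t₀ := by
  have hO : ∀ p : Y, IsOpen (U ×ˢ (chartAt (Euc m) p).target) := fun p =>
    hU.prod (chartAt (Euc m) p).open_target
  have hd : ∀ p : Y, ∀ t ∈ U, ∀ x ∈ (chartAt (Euc m) p).target,
      HasDerivAt (fun t => F t ((chartAt (Euc m) p).symm x))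
      (fderiv ℝ (fun q : ℝ × Euc m => F q.1 ((chartAt (Euc m) p).symm q.2)) (t, x) (1, 0)) t :=
    fun p t ht x hx => hasDerivAt_slice (hO p) (hF p) ⟨ht, hx⟩
  have hfun : F' = fun y => deriv (fun t => F t y) t₀ := funext fun y => (hF' y).deriv.symm
  rw [hfun]
  refine hasDerivAt_integral_of_continuousOn hU (F' := fun t y => deriv (fun t => F t y) t)
    (fun t ht y => ?_) (fun t ht => (hF.isSmoothFun ht).continuous) ?_ ht₀
  · have h := hd y t ht _ (mem_chart_target _ y)
    rw [(chartAt (Euc m) y).left_inv (mem_chart_source _ y)] at h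
    exact h.differentiableAt.hasDerivAt
  · rintro ⟨t, y⟩ ⟨ht, -⟩
    have h1 := (contDiffOn_fderiv_apply (hO y) (hF y) (1, 0)).continuousOn
    have h2 : ContinuousOn (fun q : ℝ × Y => deriv (fun t => F t q.2) q.1)
        (U ×ˢ (chartAt (Euc m) y).source) := by
      refine (h1.comp (f := fun q : ℝ × Y => (q.1, chartAt (Euc m) y q.2))
        (continuousOn_fst.prodMk ((chartAt (Euc m) y).continuousOn.comp continuousOn_snd
          fun q hq => hq.2)) fun q hq => ⟨hq.1, (chartAt (Euc m) y).map_source hq.2⟩).congr ?_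
      rintro ⟨s, z⟩ ⟨hs, hz⟩
      have h := (hd y s hs _ ((chartAt (Euc m) y).map_source hz)).deriv
      rw [(chartAt (Euc m) y).left_inv hz] at h
      exact h
    exact (h2.continuousAt ((hU.prod (chartAt (Euc m) y).open_source).mem_nhds
      ⟨ht, mem_chart_source _ y⟩)).continuousWithinAt

theorem IsSmoothFamily.isSmoothForm {P : Type*} [NormedAddCommGroup P] [NormedSpace ℝ P] {k : ℕ}
    {U : Set P} {σ : P → DForm m Y k} (hσ : IsSmoothFamily U σ) {t : P} (ht : t ∈ U) :
    IsSmoothForm (σ t) := fun p => contDiffOn_slice (hσ p) ht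

/-- The derivative with respect to the parameter of a one-parameter family of forms. -/
def velocity {k : ℕ} (σ : ℝ → DForm m Y k) (t₀ : ℝ) : DForm m Y k := fun y =>
  (deriv (fun t => atPt (σ t) y) t₀ : Euc m [⋀^Fin k]→L[ℝ] ℝ)

theorem IsSmoothFamily.contDiffOn_coordComp {U : Set ℝ} {σ : ℝ → DForm m Y 1}
    (hσ : IsSmoothFamily U σ) (p : Y) (i : Fin m) :
    ContDiffOn ℝ ∞ (fun q : ℝ × Euc m => coordComp p (σ q.1) i q.2)
      (U ×ˢ (chartAt (Euc m) p).target) :=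
  contDiffOn_apply_const (hσ p) _

theorem IsSmoothFamily.pd_coordComp {U : Set ℝ} {σ : ℝ → DForm m Y 1} (hU : IsOpen U)
    (hσ : IsSmoothFamily U σ) (p : Y) (i j : Fin m) {t : ℝ} (ht : t ∈ U) {x : Euc m}
    (hx : x ∈ (chartAt (Euc m) p).target) :
    pd i (coordComp p (σ t) j) x = fderiv ℝ (fun q : ℝ × Euc m => coordComp p (σ q.1) j q.2) (t, x)
      (0, EuclideanSpace.basisFun (Fin m) ℝ i) := by
  have h := hasFDerivAt_slice (hU.prod (chartAt (Euc m) p).open_target)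
    (hσ.contDiffOn_coordComp p j) (t := t) (x := x) ⟨ht, hx⟩
  exact congrArg (fun L => L (EuclideanSpace.basisFun (Fin m) ℝ i)) h.fderiv

variable [IsManifold (𝓡 m) ∞ Y] {k : ℕ} {U : Set ℝ} {σ : ℝ → DForm m Y k}

theorem IsSmoothFamily.hasDerivAt_atPt (hU : IsOpen U) (hσ : IsSmoothFamily U σ) {t₀ : ℝ}
    (ht₀ : t₀ ∈ U) (y : Y) :
    HasDerivAt (fun t => atPt (σ t) y) (atPt (velocity σ t₀) y) t₀ := by
  have h := hasDerivAt_slice (hU.prod (chartAt (Euc m) y).open_target) (hσ y)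
    (t := t₀) (x := chartAt (Euc m) y y) ⟨ht₀, mem_chart_target _ y⟩
  simp only [coordForm_self] at h
  exact h.differentiableAt.hasDerivAt

theorem IsSmoothFamily.hasDerivAt_coordForm (hU : IsOpen U) (hσ : IsSmoothFamily U σ) {t₀ : ℝ}
    (ht₀ : t₀ ∈ U) (p : Y) (x : Euc m) :
    HasDerivAt (fun t => coordForm p (σ t) x) (coordForm p (velocity σ t₀) x) t₀ := by
  let L : (Euc m [⋀^Fin k]→L[ℝ] ℝ) →L[ℝ] (Euc m [⋀^Fin k]→L[ℝ] ℝ) :=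
    ContinuousAlternatingMap.compContinuousLinearMapCLM (dsymm p x)
  exact L.hasFDerivAt.comp_hasDerivAt t₀ (hσ.hasDerivAt_atPt hU ht₀ ((chartAt (Euc m) p).symm x))

theorem IsSmoothFamily.coordForm_velocity (hU : IsOpen U) (hσ : IsSmoothFamily U σ) {t₀ : ℝ}
    (ht₀ : t₀ ∈ U) {p : Y} {x : Euc m} (hx : x ∈ (chartAt (Euc m) p).target) :
    coordForm p (velocity σ t₀) x =
      fderiv ℝ (fun q : ℝ × Euc m => coordForm p (σ q.1) q.2) (t₀, x) (1, 0) :=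
  (hσ.hasDerivAt_coordForm hU ht₀ p x).unique
    (hasDerivAt_slice (hU.prod (chartAt (Euc m) p).open_target) (hσ p) ⟨ht₀, hx⟩)

theorem IsSmoothFamily.isSmoothForm_velocity (hU : IsOpen U) (hσ : IsSmoothFamily U σ) {t₀ : ℝ}
    (ht₀ : t₀ ∈ U) : IsSmoothForm (velocity σ t₀) := fun p =>
  (contDiffOn_slice (contDiffOn_fderiv_apply (hU.prod (chartAt (Euc m) p).open_target) (hσ p)
    (1, 0)) ht₀).congr fun _ hx => hσ.coordForm_velocity hU ht₀ hx

theorem IsSmoothFamily.pair {σ : ℝ → DForm m Y 1} (hσ : IsSmoothFamily U σ)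
    {X : VField m Y} (hX : IsSmoothField X) :
    IsSmoothFunFamily (m := m) U (fun t => pair (σ t) X) := fun p =>
  (contDiffOn_apply_field (hσ p) ((hX.contDiffOn p).comp contDiffOn_snd fun _ hq => hq.2)).congr
    fun q hq => pair_symm (σ q.1) X hq.2

theorem IsSmoothFamily.coordComp_velocity {σ : ℝ → DForm m Y 1} (hU : IsOpen U)
    (hσ : IsSmoothFamily U σ) (p : Y) (j : Fin m) {t : ℝ} (ht : t ∈ U) {x : Euc m}
    (hx : x ∈ (chartAt (Euc m) p).target) :
    HasDerivAt (fun t => coordComp p (σ t) j x) (coordComp p (velocity σ t) j x) t ∧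
    coordComp p (velocity σ t) j x =
      fderiv ℝ (fun q : ℝ × Euc m => coordComp p (σ q.1) j q.2) (t, x) (1, 0) := by
  let L : (Euc m [⋀^Fin 1]→L[ℝ] ℝ) →L[ℝ] ℝ := ContinuousAlternatingMap.apply ℝ (Euc m) ℝ
    (fun _ => EuclideanSpace.basisFun (Fin m) ℝ j)
  have h1 : HasDerivAt (fun t => coordComp p (σ t) j x) (coordComp p (velocity σ t) j x) t :=
    L.hasFDerivAt.comp_hasDerivAt t (hσ.hasDerivAt_coordForm hU ht p x)
  exact ⟨h1, h1.unique (hasDerivAt_slice (hU.prod (chartAt (Euc m) p).open_target)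
    (hσ.contDiffOn_coordComp p j) ⟨ht, hx⟩)⟩

theorem IsSmoothFamily.hasDerivAt_pd {σ : ℝ → DForm m Y 1} (hU : IsOpen U)
    (hσ : IsSmoothFamily U σ) (p : Y) (i j : Fin m) {t : ℝ} (ht : t ∈ U) {x : Euc m}
    (hx : x ∈ (chartAt (Euc m) p).target) :
    HasDerivAt (fun t => pd i (coordComp p (σ t) j) x) (pd i (coordComp p (velocity σ t) j) x)
      t := by
  have hO := hU.prod (chartAt (Euc m) p).open_target
  have hA := hσ.contDiffOn_coordComp p j
  have h1 := hasDerivAt_slice hO (contDiffOn_fderiv_apply hO hA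
    (0, EuclideanSpace.basisFun (Fin m) ℝ i)) (t := t) (x := x) ⟨ht, hx⟩
  have h2 : pd i (coordComp p (velocity σ t) j) x = _ :=
    congrArg (fun L => L (EuclideanSpace.basisFun (Fin m) ℝ i))
      ((hasFDerivAt_slice hO (contDiffOn_fderiv_apply hO hA (1, 0)) (t := t) (x := x)
        ⟨ht, hx⟩).congr_of_eventuallyEq (f₁ := coordComp p (velocity σ t) j) (by
          filter_upwards [(chartAt (Euc m) p).open_target.mem_nhds hx] with z hz
          exact (hσ.coordComp_velocity hU p j ht hz).2)).fderiv
  rw [h2]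
  refine (h1.congr_of_eventuallyEq ?_).congr_deriv (fderiv_fderiv_comm hO hA ⟨ht, hx⟩ _ _)
  filter_upwards [hU.mem_nhds ht] with s hs
  exact hσ.pd_coordComp hU p i j hs hx

end Families

section ContactFamilies

variable {n : ℕ} {Y : Type*} [TopologicalSpace Y] [ChartedSpace (Euc (2 * n + 1)) Y]
  [IsManifold (𝓡 (2 * n + 1)) ∞ Y] {U : Set ℝ} {σ : ℝ → DForm (2 * n + 1) Y 1}

theorem IsSmoothFamily.ratio_volForm {ν : DForm (2 * n + 1) Y (2 * n + 1)} (hν : IsVolumeForm ν)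
    (hU : IsOpen U) (hσ : IsSmoothFamily U σ) :
    IsSmoothFunFamily (m := 2 * n + 1) U (fun t => ratio ν (volForm (σ t))) := fun p => by
  have hO := hU.prod (chartAt (Euc (2 * n + 1)) p).open_target
  have h1 := contDiffOn_skewSum (fun i => hσ.contDiffOn_coordComp p i) fun i j =>
    (contDiffOn_fderiv_apply hO (hσ.contDiffOn_coordComp p j)
      (0, EuclideanSpace.basisFun (Fin (2 * n + 1)) ℝ i))
  refine (((contDiffOn_const (c := ((2 : ℝ) ^ n * (n.factorial : ℝ))⁻¹)).mul h1).div
    ((hν.1 p).comp contDiffOn_snd fun q hq => hq.2)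
    fun q hq => topCoeff_ne_zero hν.2 hq.2).congr fun q hq => ?_
  change ratio ν (volForm (σ q.1)) ((chartAt (Euc (2 * n + 1)) p).symm q.2) = _
  rw [ratio_eq_topCoeff hν.2 _ hq.2, volForm_eq, topCoeff_contactTop _ (hσ.isSmoothForm hq.1) hq.2]
  simp only [hσ.pd_coordComp hU p _ _ hq.1 hq.2]
  rfl

theorem IsSmoothFamily.hasDerivAt_ratio_volForm {ν : DForm (2 * n + 1) Y (2 * n + 1)}
    (hν : ∀ y, ν y ≠ 0) (hU : IsOpen U) (hσ : IsSmoothFamily U σ) {t : ℝ} (ht : t ∈ U) (y : Y) :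
    HasDerivAt (fun t => ratio ν (volForm (σ t)) y) (variation ν (σ t) (velocity σ t) y) t := by
  obtain ⟨p, x, hx, rfl⟩ : ∃ p : Y, ∃ x ∈ (chartAt (Euc (2 * n + 1)) p).target,
      (chartAt (Euc (2 * n + 1)) p).symm x = y :=
    ⟨y, _, mem_chart_target _ y, (chartAt (Euc (2 * n + 1)) y).left_inv (mem_chart_source _ y)⟩
  rw [variation_eq hν (hσ.isSmoothForm ht) (hσ.isSmoothForm_velocity hU ht) hx]
  have h := hasDerivAt_skewSum (t := t) (fun i => (hσ.coordComp_velocity hU p i ht hx).1)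
    fun i j => hσ.hasDerivAt_pd hU p i j ht hx
  refine ((h.const_mul ((2 : ℝ) ^ n * (n.factorial : ℝ))⁻¹).div_const
    (topCoeff p ν x)).congr_of_eventuallyEq ?_
  filter_upwards [hU.mem_nhds ht] with s hs
  rw [ratio_eq_topCoeff hν _ hx, volForm_eq, topCoeff_contactTop _ (hσ.isSmoothForm hs) hx]

end ContactFamilies

/-! ### Contact forms and their Reeb fields -/

section Pointwise

variable {n : ℕ} {Y : Type*} [TopologicalSpace Y] [ChartedSpace (Euc (2 * n + 1)) Y]

theorem topVal_contactTop (α σ : DForm (2 * n + 1) Y 1) (y : Y) :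
    topVal (contactTop α σ) y = ((2 : ℝ) ^ n * (n.factorial : ℝ))⁻¹ *
      wedgePow (atPt α y) (atPt (dForm σ) y) n
        (fun i => EuclideanSpace.basisFun (Fin (2 * n + 1)) ℝ i) := rfl

/-- If `ι_X dσ = 0` at `y`, then `σ(X) α ∧ (dσ) ^ n = α(X) σ ∧ (dσ) ^ n` at `y`. -/
theorem topVal_of_contract {α σ : DForm (2 * n + 1) Y 1} {y : Y} (X : Euc (2 * n + 1))
    (hX : ∀ w, atPt (dForm σ) y ![X, w] = 0) :
    atPt σ y (fun _ => X) * topVal (contactTop α σ) y =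
      atPt α y (fun _ => X) * topVal (volForm σ) y := by
  have h := wedgePow_of_contract_eq_zero (EuclideanSpace.basisFun (Fin (2 * n + 1)) ℝ).toBasis
    (atPt σ y) (atPt α y) (atPt (dForm σ) y) X hX
  simp only [OrthonormalBasis.coe_toBasis] at h
  rw [volForm_eq, topVal_contactTop, topVal_contactTop]
  linear_combination ((2 : ℝ) ^ n * (n.factorial : ℝ))⁻¹ * h

theorem IsContact.volForm_ne_zero {σ : DForm (2 * n + 1) Y 1} (hσ : IsContact σ) (y : Y) :
    volForm σ y ≠ 0 := smul_ne_zero (by positivity) (hσ.2 y)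

theorem ratio_volForm_ne_zero {σ τ : DForm (2 * n + 1) Y 1} (hσ : IsContact σ) (hτ : IsContact τ)
    (y : Y) : ratio (volForm σ) (volForm τ) y ≠ 0 :=
  div_ne_zero (topVal_ne_zero (hτ.volForm_ne_zero y)) (topVal_ne_zero (hσ.volForm_ne_zero y))

/-- The pair `(σ, dσ)` is nondegenerate for a contact form `σ`. -/
theorem IsContact.eq_zero_of_contract {σ : DForm (2 * n + 1) Y 1} (hσ : IsContact σ) {y : Y}
    {X : Euc (2 * n + 1)} (h0 : atPt σ y (fun _ => X) = 0)
    (hX : ∀ w, atPt (dForm σ) y ![X, w] = 0) : X = 0 := by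
  let a : Euc (2 * n + 1) [⋀^Fin 1]→L[ℝ] ℝ :=
    ContinuousAlternatingMap.ofSubsingleton ℝ (Euc (2 * n + 1)) ℝ (0 : Fin 1) (innerSL ℝ X)
  have h := topVal_of_contract (α := fun _ => a) (σ := σ) X hX
  have ha : atPt (m := 2 * n + 1) (Y := Y) (fun _ => a) y (fun _ => X) = inner ℝ X X := rfl
  rw [h0, zero_mul, ha] at h
  rcases mul_eq_zero.1 h.symm with h1 | h1
  · exact inner_self_eq_zero.1 h1
  · exact absurd h1 (topVal_ne_zero (hσ.volForm_ne_zero y))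

variable [IsManifold (𝓡 (2 * n + 1)) ∞ Y]

/-- For a Reeb field `ξ` of `σ`: `α ∧ (dσ) ^ n = α(ξ) σ ∧ (dσ) ^ n`. -/
theorem IsReeb.ratio_contactTop {σ : DForm (2 * n + 1) Y 1} {ξ : VField (2 * n + 1) Y}
    (hσ : IsContact σ) (hξ : IsReeb σ ξ) (α : DForm (2 * n + 1) Y 1) (y : Y) :
    ratio (volForm σ) (contactTop α σ) y = pair α ξ y := by
  have h := topVal_of_contract (α := α) (σ := σ) (y := y) (ξ y) (hξ.2.2 y)
  have h1 : atPt σ y (fun _ => ξ y) = 1 := hξ.2.1 y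
  rw [h1, one_mul] at h
  rw [ratio, h, mul_div_cancel_right₀ _ (topVal_ne_zero (hσ.volForm_ne_zero y))]
  rfl

theorem ratio_self {m : ℕ} {Y : Type*} [TopologicalSpace Y] [ChartedSpace (Euc m) Y]
    {ν : DForm m Y m} (hν : ∀ y, ν y ≠ 0) (y : Y) : ratio ν ν y = 1 :=
  div_self (topVal_ne_zero (hν y))

theorem dForm_add_smul {m : ℕ} {Y : Type*} [TopologicalSpace Y] [ChartedSpace (Euc m) Y]
    {k : ℕ} {σ β : DForm m Y k} (hσ : IsSmoothForm σ) (hβ : IsSmoothForm β) (s : ℝ) (y : Y) :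
    dForm (fun y => σ y + s • β y) y = dForm σ y + s • dForm β y := by
  have hd : ∀ {τ : DForm m Y k}, IsSmoothForm τ →
      DifferentiableAt ℝ (coordForm y τ) (chartAt (Euc m) y y) := fun h =>
    (h.contDiffAt (mem_chart_target _ y)).differentiableAt (by simp)
  have h1 : extDeriv (coordForm y σ + s • coordForm y β) (chartAt (Euc m) y y) =
      extDeriv (coordForm y σ) (chartAt (Euc m) y y) +
        s • extDeriv (coordForm y β) (chartAt (Euc m) y y) := by
    rw [extDeriv_add (hd hσ) ((hd hβ).const_smul s), extDeriv_smul]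
  exact congrArg (fun L => ContinuousAlternatingMap.compContinuousLinearMap L (dchart y y)) h1

/-- Cartan's formula at a point, in the chart around this point. -/
theorem Preserves.fderiv_pair_self {m : ℕ} {Y : Type*} [TopologicalSpace Y]
    [ChartedSpace (Euc m) Y] [IsManifold (𝓡 m) ∞ Y] {σ : DForm m Y 1} {X : VField m Y}
    (h : Preserves X σ) (hσ : IsSmoothForm σ) (hX : IsSmoothField X) (y : Y) (v : Euc m) :
    fderiv ℝ (fun z => pair σ X ((chartAt (Euc m) y).symm z)) (chartAt (Euc m) y y) v =
      -atPt (dForm σ) y ![X y, v] := by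
  rw [h.fderiv_pair hσ hX (mem_chart_target _ y), coordForm_two_apply _ _ (mem_chart_target _ y),
    dsymm_self, (chartAt (Euc m) y).left_inv (mem_chart_source _ y)]
  rfl

theorem isSmoothFun_ratio_volForm {σ τ : DForm (2 * n + 1) Y 1} (hσ : IsContact σ)
    (hτ : IsSmoothForm τ) : IsSmoothFun (m := 2 * n + 1) (ratio (volForm σ) (volForm τ)) :=
  isSmoothFun_ratio hσ.isVolumeForm fun p => contDiffOn_topCoeff_contactTop hτ hτ p

end Pointwise

section Integrals

open MeasureTheory

variable {n : ℕ} {Y : Type*} [TopologicalSpace Y] [ChartedSpace (Euc (2 * n + 1)) Y]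
  [IsManifold (𝓡 (2 * n + 1)) ∞ Y] [T2Space Y] [CompactSpace Y]

theorem integrable_of_continuous {Y : Type*} [TopologicalSpace Y] [CompactSpace Y]
    [MeasurableSpace Y] [BorelSpace Y] {μ : Measure Y} [IsFiniteMeasure μ] {g : Y → ℝ}
    (hg : Continuous g) : Integrable g μ :=
  hg.integrable_of_hasCompactSupport (HasCompactSupport.of_compactSpace _)

/-- The change of the reference volume form. -/
theorem volIntegral_eq_of_ratio {m : ℕ} {Y : Type*} [TopologicalSpace Y]
    [ChartedSpace (Euc m) Y] [IsManifold (𝓡 m) ∞ Y] [T2Space Y] [CompactSpace Y]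
    {ν ν' : DForm m Y m} (hν : ∀ y, ν y ≠ 0) (g : Y → ℝ) :
    volIntegral ν' g = volIntegral ν (fun y => g y * |ratio ν ν' y|) := by
  unfold volIntegral
  refine Finset.sum_congr rfl fun p _ => ?_
  congr 1
  ext x
  rw [topCoeff_eq_ratio hν ν', abs_mul]
  ring

theorem contactIntegral_eq_volIntegral {τ : DForm (2 * n + 1) Y 1} (hτ : IsContact τ) (f : Y → ℝ) :
    contactIntegral τ f = volIntegral (volForm τ) f := by
  unfold contactIntegral
  rw [integral_eq_volIntegral hτ.volForm_ne_zero]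
  congr 1
  ext y
  have h : topVal (fun y => f y • volForm τ y) y = f y * topVal (volForm τ) y := rfl
  rw [ratio, h, mul_div_cancel_right₀ _ (topVal_ne_zero (hτ.volForm_ne_zero y))]

theorem contactVolume_eq_contactIntegral (τ : DForm (2 * n + 1) Y 1) :
    contactVolume τ = contactIntegral τ (fun _ => 1) := by
  unfold contactVolume contactIntegral
  simp only [one_smul]

variable [MeasurableSpace Y] [BorelSpace Y]

theorem integral_volMeasure_pos {m : ℕ} {Y : Type*} [TopologicalSpace Y]
    [ChartedSpace (Euc m) Y] [IsManifold (𝓡 m) ∞ Y] [T2Space Y] [CompactSpace Y]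
    [MeasurableSpace Y] [BorelSpace Y] {ν : DForm m Y m} (hν : IsVolumeForm ν)
    {g : Y → ℝ} (hg : Continuous g) (h0 : ∀ y, 0 ≤ g y) {y : Y} (hy : g y ≠ 0) :
    0 < ∫ y, g y ∂(volMeasure hν) := by
  rw [integral_volMeasure hν hg]
  exact volIntegral_pos hν hg h0 hy

/-- Integrals with respect to a contact form `τ`, in terms of the measure of a reference contact
form `σ`. -/
theorem contactIntegral_eq {σ τ : DForm (2 * n + 1) Y 1} (hσ : IsContact σ) (hτ : IsContact τ)
    {f : Y → ℝ} (hf : Continuous f) : contactIntegral τ f =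
      ∫ y, f y * |ratio (volForm σ) (volForm τ) y| ∂(volMeasure hσ.isVolumeForm) := by
  rw [contactIntegral_eq_volIntegral hτ, volIntegral_eq_of_ratio hσ.volForm_ne_zero,
    integral_volMeasure]
  exact hf.mul (isSmoothFun_ratio_volForm hσ hτ.1).continuous.abs

theorem contactIntegral_self {σ : DForm (2 * n + 1) Y 1} (hσ : IsContact σ)
    {f : Y → ℝ} (hf : Continuous f) :
    contactIntegral σ f = ∫ y, f y ∂(volMeasure hσ.isVolumeForm) := by
  rw [contactIntegral_eq hσ hσ hf]
  simp only [ratio_self hσ.volForm_ne_zero, abs_one, mul_one]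

theorem coordField_zero {m : ℕ} {Y : Type*} [TopologicalSpace Y] [ChartedSpace (Euc m) Y]
    (p : Y) (x : Euc m) : coordField p (0 : VField m Y) x = 0 := by
  rw [coordField_eq]
  exact map_zero (dchart p _)

theorem isSmoothField_zero {m : ℕ} {Y : Type*} [TopologicalSpace Y] [ChartedSpace (Euc m) Y]
    [IsManifold (𝓡 m) ∞ Y] : IsSmoothField (0 : VField m Y) :=
  Bundle.contMDiff_zeroSection ℝ (TangentSpace (𝓡 m) : Y → Type _)

/-- **Stokes' theorem** weighted with a locally constant function `χ`. -/
theorem integral_mul_variation {ν : DForm (2 * n + 1) Y (2 * n + 1)} (hν : IsVolumeForm ν)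
    {σ α : DForm (2 * n + 1) Y 1} (hσ : IsSmoothForm σ) (hα : IsSmoothForm α)
    {χ : Y → ℝ} (hχ : IsSmoothFun (m := 2 * n + 1) χ)
    (hχ' : ∀ (p : Y), ∀ x ∈ (chartAt (Euc (2 * n + 1)) p).target,
      fderiv ℝ (fun z => χ ((chartAt (Euc (2 * n + 1)) p).symm z)) x = 0) :
    ∫ y, χ y * variation ν σ α y ∂(volMeasure hν) =
      (n + 1) * ∫ y, χ y * ratio ν (contactTop α σ) y ∂(volMeasure hν) := by
  have h := integral_stokesFun hν hσ hα hχ isSmoothField_zero fun p x hx v => by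
    rw [hχ' p x hx, coordField_zero]
    have : coordForm p (dForm σ) x ![0, v] = 0 :=
      (coordForm p (dForm σ) x).map_coord_zero 0 rfl
    rw [this]
    simp
  have h0 : ∀ (τ : DForm (2 * n + 1) Y 1) (y : Y), pair τ 0 y = 0 := fun τ y =>
    (atPt τ y).map_coord_zero 0 rfl
  simp only [stokesFun, h0, zero_mul, sub_zero, add_zero] at h
  have i1 := (hχ.mul (isSmoothFun_variation hν hσ hα)).continuous
  have i2 := (hχ.mul (isSmoothFun_ratio hν
    fun p => contDiffOn_topCoeff_contactTop hα hσ p)).continuous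
  rw [integral_sub (integrable_of_continuous i1) ((integrable_of_continuous i2).const_mul _),
    integral_const_mul] at h
  linarith

end Integrals

/-! ### Dependence on the Reeb field and the variations of the volume -/

section ReebDependence

open MeasureTheory

variable {n : ℕ} {Y : Type*} [TopologicalSpace Y] [ChartedSpace (Euc (2 * n + 1)) Y]
  [IsManifold (𝓡 (2 * n + 1)) ∞ Y] [T2Space Y] [CompactSpace Y]
  [MeasurableSpace Y] [BorelSpace Y]

theorem isSmoothFamily_add_smul {m : ℕ} {Y : Type*} [TopologicalSpace Y] [ChartedSpace (Euc m) Y]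
    {k : ℕ} {σ β : DForm m Y k} (hσ : IsSmoothForm σ) (hβ : IsSmoothForm β) :
    IsSmoothFamily Set.univ (fun (s : ℝ) y => σ y + s • β y) := fun p =>
  ((hσ p).comp contDiffOn_snd fun _ hq => hq.2).add
    (contDiffOn_fst.smul ((hβ p).comp contDiffOn_snd fun _ hq => hq.2))

theorem velocity_add_smul {m : ℕ} {Y : Type*} [TopologicalSpace Y] [ChartedSpace (Euc m) Y]
    {k : ℕ} (σ β : DForm m Y k) (s : ℝ) : velocity (fun (s : ℝ) y => σ y + s • β y) s = β := by
  ext1 y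
  have h : HasDerivAt (fun s : ℝ => atPt σ y + s • atPt β y) ((1 : ℝ) • atPt β y) s :=
    ((hasDerivAt_id s).smul_const _).const_add _
  rw [one_smul] at h
  exact h.deriv

/-- Along the segment joining two contact forms with the same Reeb field, the volume form only
changes by an exact form. -/
theorem IsReeb.integral_mul_ratio {σ τ : DForm (2 * n + 1) Y 1} {ξ : VField (2 * n + 1) Y}
    (hσ : IsContact σ) (hτ : IsContact τ) (hξ : IsReeb σ ξ) (hξ' : IsReeb τ ξ)
    {χ : Y → ℝ} (hχ : IsSmoothFun (m := 2 * n + 1) χ)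
    (hχ' : ∀ (p : Y), ∀ x ∈ (chartAt (Euc (2 * n + 1)) p).target,
      fderiv ℝ (fun z => χ ((chartAt (Euc (2 * n + 1)) p).symm z)) x = 0) :
    ∫ y, χ y * ratio (volForm σ) (volForm τ) y ∂(volMeasure hσ.isVolumeForm) =
      ∫ y, χ y ∂(volMeasure hσ.isVolumeForm) := by
  -- Both `β = τ - σ` and `dβ` vanish on `ξ`, hence `β ∧ (d (σ + s β)) ^ n = 0` for all `s`.
  set β : DForm (2 * n + 1) Y 1 := fun y => τ y + (-1 : ℝ) • σ y with hβdef
  have hβ : IsSmoothForm β := hτ.1.add (hσ.1.const_smul _)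
  have hν := hσ.isVolumeForm
  let F : ℝ → DForm (2 * n + 1) Y 1 := fun s y => σ y + s • β y
  have hF : IsSmoothFamily Set.univ F := isSmoothFamily_add_smul hσ.1 hβ
  have hFs : ∀ s, IsSmoothForm (F s) := fun s => hF.isSmoothForm (Set.mem_univ s)
  have hβξ : ∀ y, atPt β y (fun _ => ξ y) = 0 := fun y => by
    have h1 : atPt σ y (fun _ => ξ y) = 1 := hξ.2.1 y
    have h2 : atPt τ y (fun _ => ξ y) = 1 := hξ'.2.1 y
    change atPt τ y (fun _ => ξ y) + (-1) * atPt σ y (fun _ => ξ y) = 0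
    rw [h1, h2]; norm_num
  have hdβ : ∀ y w, atPt (dForm β) y ![ξ y, w] = 0 := fun y w => by
    have h := dForm_add_smul hτ.1 hσ.1 (-1) y
    have h1 : atPt (dForm σ) y ![ξ y, w] = 0 := hξ.2.2 y w
    have h2 : atPt (dForm τ) y ![ξ y, w] = 0 := hξ'.2.2 y w
    have h3 : atPt (dForm β) y ![ξ y, w] = atPt (dForm τ) y ![ξ y, w] +
        (-1) * atPt (dForm σ) y ![ξ y, w] := congrArg (fun L => L ![ξ y, w]) h
    rw [h3, h1, h2]; norm_num
  have h0 : ∀ s y, ratio (volForm σ) (contactTop β (F s)) y = 0 := fun s y => by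
    have h1 : ∀ w, atPt (dForm (F s)) y ![ξ y, w] = 0 := fun w => by
      have h2 : atPt (dForm σ) y ![ξ y, w] = 0 := hξ.2.2 y w
      have h3 : atPt (dForm (F s)) y ![ξ y, w] = atPt (dForm σ) y ![ξ y, w] +
          s * atPt (dForm β) y ![ξ y, w] :=
        congrArg (fun L => L ![ξ y, w]) (dForm_add_smul hσ.1 hβ s y)
      rw [h3, h2, hdβ, mul_zero, add_zero]
    have h4 : atPt (F s) y (fun _ => ξ y) = 1 := by
      have h5 : atPt σ y (fun _ => ξ y) = 1 := hξ.2.1 y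
      change atPt σ y (fun _ => ξ y) + s * atPt β y (fun _ => ξ y) = 1
      rw [h5, hβξ, mul_zero, add_zero]
    have h := topVal_of_contract (α := β) (ξ y) h1
    rw [h4, hβξ, one_mul, zero_mul] at h
    rw [ratio, h, zero_div]
  have hd : ∀ s, HasDerivAt (fun s => ∫ y, χ y * ratio (volForm σ) (volForm (F s)) y
      ∂(volMeasure hν)) 0 s := fun s => by
    have h := ((hχ.family Set.univ).mul (hF.ratio_volForm hν isOpen_univ)).hasDerivAt_integral
      (μ := volMeasure hν) isOpen_univ (Set.mem_univ s)
      fun y => (hF.hasDerivAt_ratio_volForm hν.2 isOpen_univ (Set.mem_univ s) y).const_mul (χ y)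
    rw [velocity_add_smul, integral_mul_variation hν (hFs s) hβ hχ hχ'] at h
    simpa only [h0, mul_zero, integral_zero] using h
  have h := is_const_of_deriv_eq_zero (fun s => (hd s).differentiableAt) (fun s => (hd s).deriv) 1 0
  have hF1 : F 1 = τ := by
    ext1 y
    change atPt σ y + (1 : ℝ) • (atPt τ y + (-1 : ℝ) • atPt σ y) = atPt τ y
    module
  have hF0 : F 0 = σ := by
    ext1 y
    simp only [F, zero_smul, add_zero]
  simpa only [hF1, hF0, ratio_self hν.2, mul_one] using h

/-- Contact forms with the same Reeb field induce the same orientation. -/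
theorem IsReeb.ratio_pos {σ τ : DForm (2 * n + 1) Y 1} {ξ : VField (2 * n + 1) Y}
    (hσ : IsContact σ) (hτ : IsContact τ) (hξ : IsReeb σ ξ) (hξ' : IsReeb τ ξ) (y : Y) :
    0 < ratio (volForm σ) (volForm τ) y := by
  have hr := isSmoothFun_ratio_volForm hσ hτ.1
  have hr0 := ratio_volForm_ne_zero hσ hτ
  set r := ratio (volForm σ) (volForm τ) with hrdef
  -- `χ` is the indicator function of the open and closed set on which `r` is negative; there
  -- `χ * r` and `χ` would have integrals of opposite signs.
  let χ : Y → ℝ := fun y => (1 - Real.sign (r y)) / 2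
  have hloc : ∀ (p : Y), ∀ x ∈ (chartAt (Euc (2 * n + 1)) p).target,
      (fun z => χ ((chartAt (Euc (2 * n + 1)) p).symm z)) =ᶠ[𝓝 x]
        fun _ => χ ((chartAt (Euc (2 * n + 1)) p).symm x) := fun p x hx => by
    filter_upwards [eventually_sign_eq (chartAt (Euc (2 * n + 1)) p).open_target
      (hr p).continuousOn (fun z _ => hr0 _) hx] with z hz
    simp only [χ, hz]
  have hχ : IsSmoothFun (m := 2 * n + 1) χ := fun p x hx =>
    (contDiffAt_const.congr_of_eventuallyEq (hloc p x hx)).contDiffWithinAt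
  have hχ' : ∀ (p : Y), ∀ x ∈ (chartAt (Euc (2 * n + 1)) p).target,
      fderiv ℝ (fun z => χ ((chartAt (Euc (2 * n + 1)) p).symm z)) x = 0 := fun p x hx => by
    rw [(hloc p x hx).fderiv_eq]
    exact fderiv_const_apply _
  have h := hξ.integral_mul_ratio hσ hτ hξ' hχ hχ'
  rcases lt_or_gt_of_ne (hr0 y) with hy | hy
  swap
  · exact hy
  exfalso
  have hneg : ∀ z, r z < 0 → χ z = 1 := fun z hz => by
    simp only [χ, Real.sign_of_neg hz]; norm_num
  have hpos : ∀ z, 0 < r z → χ z = 0 := fun z hz => by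
    simp only [χ, Real.sign_of_pos hz]; norm_num
  have hc := hχ.continuous
  have hcr := (hχ.mul hr).continuous
  have h1 := integral_volMeasure_pos hσ.isVolumeForm (g := fun z => χ z - χ z * r z)
    (hc.sub hcr) (fun z => by
    rcases lt_or_gt_of_ne (hr0 z) with hz | hz
    · rw [hneg z hz]; linarith
    · rw [hpos z hz]; simp) (y := y) (by rw [hneg y hy]; linarith)
  rw [integral_sub (integrable_of_continuous hc) (integrable_of_continuous hcr), h, sub_self] at h1
  exact lt_irrefl _ h1

theorem IsReeb.contactVolume_eq {σ τ : DForm (2 * n + 1) Y 1} {ξ : VField (2 * n + 1) Y}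
    (hσ : IsContact σ) (hτ : IsContact τ) (hξ : IsReeb σ ξ) (hξ' : IsReeb τ ξ) :
    contactVolume τ = contactVolume σ := by
  have h := hξ.integral_mul_ratio hσ hτ hξ' (isSmoothFun_const 1)
    fun p x _ => fderiv_const_apply _
  rw [contactVolume_eq_contactIntegral, contactVolume_eq_contactIntegral,
    contactIntegral_eq hσ hτ continuous_const, contactIntegral_self hσ continuous_const, ← h]
  simp only [abs_of_pos (hξ.ratio_pos hσ hτ hξ' _)]

end ReebDependence

section Variations

open MeasureTheory

variable {n : ℕ} {Y : Type*} [TopologicalSpace Y] [ChartedSpace (Euc (2 * n + 1)) Y]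
  [IsManifold (𝓡 (2 * n + 1)) ∞ Y]

theorem hasDerivAt_oneForm_apply_const {m : ℕ} {a : ℝ → Euc m [⋀^Fin 1]→L[ℝ] ℝ}
    {a' : Euc m [⋀^Fin 1]→L[ℝ] ℝ} {t : ℝ} (ha : HasDerivAt a a' t) (v : Euc m) :
    HasDerivAt (fun s => a s (fun _ => v)) (a' (fun _ => v)) t := by
  let L : (Euc m [⋀^Fin 1]→L[ℝ] ℝ) →L[ℝ] ℝ :=
    ContinuousAlternatingMap.apply ℝ (Euc m) ℝ (fun _ => v)
  exact L.hasFDerivAt.comp_hasDerivAt t ha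

theorem hasDerivAt_oneForm_apply {m : ℕ} {a : ℝ → Euc m [⋀^Fin 1]→L[ℝ] ℝ}
    {a' : Euc m [⋀^Fin 1]→L[ℝ] ℝ} {v : ℝ → Euc m} {v' : Euc m} {t : ℝ} (ha : HasDerivAt a a' t)
    (hv : HasDerivAt v v' t) :
    HasDerivAt (fun s => a s (fun _ => v s)) (a t (fun _ => v') + a' (fun _ => v t)) t := by
  have hc : ∀ i, HasDerivAt (fun s => v s i) (v' i) t := fun i =>
    (EuclideanSpace.proj (𝕜 := ℝ) i : Euc m →L[ℝ] ℝ).hasFDerivAt.comp_hasDerivAt t hv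
  have hb : ∀ i, HasDerivAt (fun s => a s (fun _ => EuclideanSpace.basisFun (Fin m) ℝ i))
      (a' (fun _ => EuclideanSpace.basisFun (Fin m) ℝ i)) t := fun i =>
    hasDerivAt_oneForm_apply_const ha _
  have h := HasDerivAt.fun_sum (u := Finset.univ) fun i _ => (hc i).mul (hb i)
  rw [Finset.sum_add_distrib, ← oneForm_eq_sum, ← oneForm_eq_sum] at h
  exact h.congr_of_eventuallyEq (.of_forall fun s => oneForm_eq_sum (a s) (v s))

/-- The derivative of the identity `σ_t (ξ_t) = 1`. -/
theorem IsSmoothFamily.pair_velocity {m : ℕ} {Y : Type*} [TopologicalSpace Y]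
    [ChartedSpace (Euc m) Y] [IsManifold (𝓡 m) ∞ Y] {U : Set ℝ} (hU : IsOpen U)
    {σ : ℝ → DForm m Y 1} (hσ : IsSmoothFamily U σ) {ξ : ℝ → VField m Y} {ξ' : VField m Y} {t : ℝ}
    (ht : t ∈ U) (h1 : ∀ s ∈ U, ∀ y, ContactVolume.pair (σ s) (ξ s) y = 1)
    (hξ : ∀ y, HasDerivAt (fun s => ξ s y) (ξ' y) t) (y : Y) :
    ContactVolume.pair (velocity σ t) (ξ t) y = -ContactVolume.pair (σ t) ξ' y := by
  have hξy : HasDerivAt (F := Euc m) (fun s => ξ s y) (ξ' y) t := hξ y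
  have h := hasDerivAt_oneForm_apply (hσ.hasDerivAt_atPt hU ht y) hξy
  have hone : HasDerivAt (fun s => atPt (σ s) y (fun _ => ξ s y)) 0 t := by
    refine (hasDerivAt_const t (1 : ℝ)).congr_of_eventuallyEq ?_
    filter_upwards [hU.mem_nhds ht] with s hs
    exact h1 s hs y
  exact eq_neg_of_add_eq_zero_right (h.unique hone)

theorem IsSmoothFamily.ratio_contactTop_velocity {U : Set ℝ} (hU : IsOpen U)
    {σ : ℝ → DForm (2 * n + 1) Y 1} (hσ : IsSmoothFamily U σ) {ξ : ℝ → VField (2 * n + 1) Y}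
    {ξ' : VField (2 * n + 1) Y} {t : ℝ} (ht : t ∈ U)
    (hc : ∀ s ∈ U, IsContact (σ s) ∧ IsReeb (σ s) (ξ s))
    (hξ : ∀ y, HasDerivAt (fun s => ξ s y) (ξ' y) t) (y : Y) :
    ratio (volForm (σ t)) (contactTop (velocity σ t) (σ t)) y =
      -ContactVolume.pair (σ t) ξ' y := by
  rw [(hc t ht).2.ratio_contactTop (hc t ht).1,
    hσ.pair_velocity hU ht (fun s hs => (hc s hs).2.2.1) hξ]

/-- The velocity `ξ'` is only assumed to exist at each point, but `σ_t(ξ')` is continuous, being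
`-σ_t'(ξ_t)`. -/
theorem IsSmoothFamily.continuous_pair {U : Set ℝ} (hU : IsOpen U)
    {σ : ℝ → DForm (2 * n + 1) Y 1} (hσ : IsSmoothFamily U σ) {ξ : ℝ → VField (2 * n + 1) Y}
    {ξ' : VField (2 * n + 1) Y} {t : ℝ} (ht : t ∈ U)
    (hc : ∀ s ∈ U, IsContact (σ s) ∧ IsReeb (σ s) (ξ s))
    (hξ : ∀ y, HasDerivAt (fun s => ξ s y) (ξ' y) t) :
    Continuous (ContactVolume.pair (σ t) ξ') := by
  have h0 := (hc t ht).1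
  refine (isSmoothFun_ratio h0.isVolumeForm fun p => contDiffOn_topCoeff_contactTop
    (hσ.isSmoothForm_velocity hU ht) h0.1 p).continuous.neg.congr fun y => ?_
  rw [Pi.neg_apply, hσ.ratio_contactTop_velocity hU ht hc hξ, neg_neg]

/-- The orientation does not change along a smooth family of contact forms. -/
theorem IsSmoothFamily.ratio_pos {σ : ℝ → DForm (2 * n + 1) Y 1} {ε : ℝ}
    (hσ : IsSmoothFamily (Set.Ioo (-ε) ε) σ) (hc : ∀ t ∈ Set.Ioo (-ε) ε, IsContact (σ t))
    {t : ℝ} (ht : t ∈ Set.Ioo (-ε) ε) (y : Y) :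
    0 < ratio (volForm (σ 0)) (volForm (σ t)) y := by
  have h0 : (0 : ℝ) ∈ Set.Ioo (-ε) ε := by
    have := ht.1.trans ht.2
    constructor <;> linarith
  have hcont : ContinuousOn (fun t => ratio (volForm (σ 0)) (volForm (σ t)) y)
      (Set.Ioo (-ε) ε) := fun s hs =>
    (hσ.hasDerivAt_ratio_volForm (hc 0 h0).volForm_ne_zero isOpen_Ioo
      hs y).continuousAt.continuousWithinAt
  by_contra hneg
  obtain ⟨s, hs, hs0⟩ := (convex_Ioo (-ε) ε).isPreconnected.intermediate_value ht h0 hcont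
    ⟨not_lt.1 hneg, by rw [ratio_self (hc 0 h0).volForm_ne_zero]; exact zero_le_one⟩
  exact ratio_volForm_ne_zero (hc 0 h0) (hc s hs) y hs0

variable [T2Space Y] [CompactSpace Y] [MeasurableSpace Y] [BorelSpace Y]

theorem IsSmoothFamily.hasDerivAt_contactIntegral {σ : ℝ → DForm (2 * n + 1) Y 1} {ε : ℝ}
    (hε : 0 < ε) (hσ : IsSmoothFamily (Set.Ioo (-ε) ε) σ)
    (hc : ∀ t ∈ Set.Ioo (-ε) ε, IsContact (σ t)) (h0 : IsContact (σ 0)) {f : ℝ → Y → ℝ} {f' : Y → ℝ}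
    (hf : IsSmoothFunFamily (m := 2 * n + 1) (Set.Ioo (-ε) ε) f)
    (hf' : ∀ y, HasDerivAt (fun t => f t y) (f' y) 0) :
    HasDerivAt (fun t => contactIntegral (σ t) (f t))
      (∫ y, (f' y + f 0 y * variation (volForm (σ 0)) (σ 0) (velocity σ 0) y)
        ∂(volMeasure h0.isVolumeForm)) 0 := by
  have hz : (0 : ℝ) ∈ Set.Ioo (-ε) ε := ⟨neg_lt_zero.2 hε, hε⟩
  have h := (hf.mul (hσ.ratio_volForm h0.isVolumeForm isOpen_Ioo)).hasDerivAt_integral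
    (μ := volMeasure h0.isVolumeForm) isOpen_Ioo hz
    fun y => (hf' y).mul (hσ.hasDerivAt_ratio_volForm h0.volForm_ne_zero isOpen_Ioo hz y)
  simp only [ratio_self h0.volForm_ne_zero, mul_one] at h
  refine h.congr_of_eventuallyEq ?_
  filter_upwards [isOpen_Ioo.mem_nhds hz] with t ht
  rw [contactIntegral_eq h0 (hc t ht) (hf.isSmoothFun ht).continuous]
  simp only [abs_of_pos (hσ.ratio_pos hc ht _)]

/-- The first variation of the contact volume. -/
theorem hasDerivAt_contactVolume {σ : ℝ → DForm (2 * n + 1) Y 1} {ξ : ℝ → VField (2 * n + 1) Y}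
    {ξ' : VField (2 * n + 1) Y} {ε : ℝ} (hε : 0 < ε) (hσ : IsSmoothFamily (Set.Ioo (-ε) ε) σ)
    (hc : ∀ t ∈ Set.Ioo (-ε) ε, IsContact (σ t) ∧ IsReeb (σ t) (ξ t))
    (hξ : ∀ y, HasDerivAt (fun t => ξ t y) (ξ' y) 0) :
    HasDerivAt (fun t => contactVolume (σ t))
      (-((n : ℝ) + 1) * contactIntegral (σ 0) (pair (σ 0) ξ')) 0 := by
  have hz : (0 : ℝ) ∈ Set.Ioo (-ε) ε := ⟨neg_lt_zero.2 hε, hε⟩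
  have h0 := (hc 0 hz).1
  have hv := hσ.isSmoothForm_velocity isOpen_Ioo hz
  have h := hσ.hasDerivAt_contactIntegral hε (fun t ht => (hc t ht).1) h0
    ((isSmoothFun_const (m := 2 * n + 1) (Y := Y) 1).family _) fun y => hasDerivAt_const 0 1
  have hw := hσ.ratio_contactTop_velocity isOpen_Ioo hz hc hξ
  have hcont := hσ.continuous_pair isOpen_Ioo hz hc hξ
  simp only [zero_add, ← contactVolume_eq_contactIntegral] at h
  rw [integral_mul_variation h0.isVolumeForm h0.1 hv (isSmoothFun_const 1)
    fun p x _ => fderiv_const_apply _] at h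
  simp only [hw, one_mul, integral_neg] at h
  rw [contactIntegral_self h0 hcont]
  exact h.congr_deriv (by ring)

/-- The second variation: with `f = σ(X)`, Stokes' theorem gives
`∫ (σ'(X) + f * variation) = (n + 2) ∫ f σ'(ξ)`, and `σ'(ξ) = -σ(ξ')`. -/
theorem hasDerivAt_contactIntegral_pair {σ : ℝ → DForm (2 * n + 1) Y 1}
    {ξ : ℝ → VField (2 * n + 1) Y} {X ξ' : VField (2 * n + 1) Y} {ε : ℝ} (hε : 0 < ε)
    (hσ : IsSmoothFamily (Set.Ioo (-ε) ε) σ)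
    (hc : ∀ t ∈ Set.Ioo (-ε) ε, IsContact (σ t) ∧ IsReeb (σ t) (ξ t))
    (hξ : ∀ y, HasDerivAt (fun t => ξ t y) (ξ' y) 0) (hX : IsSmoothField X)
    (hXσ : Preserves X (σ 0)) :
    HasDerivAt (fun t => contactIntegral (σ t) (pair (σ t) X))
      (-((n : ℝ) + 2) * contactIntegral (σ 0) (fun y => pair (σ 0) X y * pair (σ 0) ξ' y)) 0 := by
  have hz : (0 : ℝ) ∈ Set.Ioo (-ε) ε := ⟨neg_lt_zero.2 hε, hε⟩
  have h0 := (hc 0 hz).1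
  have hν := h0.isVolumeForm
  have hv := hσ.isSmoothForm_velocity isOpen_Ioo hz
  have hf := h0.1.pair hX
  have hp : ∀ y, HasDerivAt (fun t => pair (σ t) X y) (pair (velocity σ 0) X y) 0 := fun y =>
    hasDerivAt_oneForm_apply_const (hσ.hasDerivAt_atPt isOpen_Ioo hz y) (X y)
  have h := hσ.hasDerivAt_contactIntegral hε (fun t ht => (hc t ht).1) h0 (hσ.pair hX) hp
  have hw := hσ.ratio_contactTop_velocity isOpen_Ioo hz hc hξ
  have hcont := hσ.continuous_pair isOpen_Ioo hz hc hξ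
  have hst := integral_stokesFun hν h0.1 hv hf hX fun p x hx v => hXσ.fderiv_pair h0.1 hX hx v
  have hfc : Continuous (fun y => pair (σ 0) X y * pair (σ 0) ξ' y) := hf.continuous.mul hcont
  have hi := (isSmoothFun_stokesFun hν h0.1 hv hf hX).continuous
  have e : ∀ y, pair (velocity σ 0) X y + pair (σ 0) X y *
      variation (volForm (σ 0)) (σ 0) (velocity σ 0) y =
      stokesFun (volForm (σ 0)) (σ 0) (pair (σ 0) X) X (velocity σ 0) y +
        -((n : ℝ) + 2) * (pair (σ 0) X y * pair (σ 0) ξ' y) := fun y => by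
    rw [stokesFun, hw, ratio_self hν.2]
    ring
  simp only [e] at h
  rw [integral_add (integrable_of_continuous hi)
    ((integrable_of_continuous hfc).const_mul _), hst, zero_add, integral_const_mul] at h
  rwa [contactIntegral_self h0 hfc]

end Variations

/-! ### Positivity and convexity -/

section Positivity

open MeasureTheory

variable {n : ℕ} {Y : Type*} [TopologicalSpace Y] [ChartedSpace (Euc (2 * n + 1)) Y]

theorem pair_add_smul {m : ℕ} {Y : Type*} [TopologicalSpace Y] [ChartedSpace (Euc m) Y]
    (σ : DForm m Y 1) (a b : ℝ) (X Z : VField m Y) (y : Y) :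
    pair σ (a • X + b • Z) y = a * pair σ X y + b * pair σ Z y := by
  have h : ∀ u v : Euc m, atPt σ y (fun _ => a • u + b • v) =
      a * atPt σ y (fun _ => u) + b * atPt σ y (fun _ => v) := fun u v => by
    rw [oneForm_const_add, oneForm_const_smul, oneForm_const_smul]
  exact h (X y) (Z y)

theorem twoForm_sub_smul {V : Type*} [AddCommGroup V] [Module ℝ V] [TopologicalSpace V]
    (β : V [⋀^Fin 2]→L[ℝ] ℝ) (u v w : V) (c : ℝ) :
    β ![u - c • v, w] = β ![u, w] - c * β ![v, w] := by
  simp only [← twoFormBilin_apply, map_sub, map_smul, LinearMap.sub_apply, LinearMap.smul_apply,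
    smul_eq_mul]

theorem oneForm_sub_smul {V : Type*} [AddCommGroup V] [Module ℝ V] [TopologicalSpace V]
    (σ : V [⋀^Fin 1]→L[ℝ] ℝ) (u v : V) (c : ℝ) :
    σ (fun _ => u - c • v) = σ (fun _ => u) - c * σ (fun _ => v) := by
  have h : oneFormLin σ (u - c • v) = oneFormLin σ u - c * oneFormLin σ v := by
    rw [map_sub, map_smul, smul_eq_mul]
  exact h

theorem preserves_zero {m : ℕ} {Y : Type*} [TopologicalSpace Y] [ChartedSpace (Euc m) Y]
    (σ : DForm m Y 1) : Preserves (0 : VField m Y) σ := fun y v => by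
  have h : coordField y (0 : VField m Y) = fun _ => 0 := funext (coordField_zero y)
  unfold lieDeriv
  simp only [h, map_zero, fderiv_fun_const, Pi.zero_apply]
  exact (congrArg₂ (· + ·) rfl ((coordForm y σ (chartAt (Euc m) y y)).map_coord_zero
    (m := fun _ => (0 : Euc m)) 0 rfl)).trans (add_zero (0 : ℝ))

theorem IsContact.eq_smul_of_contract {σ : DForm (2 * n + 1) Y 1} (hσ : IsContact σ) {y : Y}
    {u v : Euc (2 * n + 1)} {c : ℝ} (h : atPt σ y (fun _ => u) = c * atPt σ y (fun _ => v))
    (hd : ∀ w, atPt (dForm σ) y ![u, w] = c * atPt (dForm σ) y ![v, w]) : u = c • v := by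
  refine sub_eq_zero.1 (hσ.eq_zero_of_contract (y := y) ?_ fun w => ?_)
  · rw [oneForm_sub_smul, h, sub_self]
  · rw [twoForm_sub_smul, hd, sub_self]

variable [IsManifold (𝓡 (2 * n + 1)) ∞ Y]

/-- A field `X` preserving the contact form `σ` is determined by its Hamiltonian `σ(X)`. -/
theorem Preserves.eq_of_pair_eq {σ : DForm (2 * n + 1) Y 1} (hσ : IsContact σ)
    {X Z : VField (2 * n + 1) Y} (hX : IsSmoothField X) (hZ : IsSmoothField Z)
    (hXσ : Preserves X σ) (hZσ : Preserves Z σ) (h : ∀ y, pair σ X y = pair σ Z y) : X = Z := by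
  ext1 y
  refine (hσ.eq_smul_of_contract (y := y) (u := X y) (v := Z y) (c := 1) ((h y).trans
    (one_mul _).symm) fun w => ?_).trans (one_smul ℝ _)
  have h1 := hXσ.fderiv_pair_self hσ.1 hX y w
  have h2 := hZσ.fderiv_pair_self hσ.1 hZ y w
  simp only [h] at h1
  linarith

/-- At a critical point of its Hamiltonian, a field preserving `σ` is a multiple of the Reeb
field. -/
theorem Preserves.eq_smul_of_fderiv_eq_zero {σ : DForm (2 * n + 1) Y 1} (hσ : IsContact σ)
    {ξ X : VField (2 * n + 1) Y} (hξ : IsReeb σ ξ) (hX : IsSmoothField X) (hXσ : Preserves X σ)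
    {y : Y} (hy : fderiv ℝ (fun z => pair σ X ((chartAt (Euc (2 * n + 1)) y).symm z))
      (chartAt (Euc (2 * n + 1)) y y) = 0) : X y = pair σ X y • ξ y := by
  refine hσ.eq_smul_of_contract (y := y) (u := X y) (v := ξ y) ?_ fun w => ?_
  · have h2 : atPt σ y (fun _ => ξ y) = 1 := hξ.2.1 y
    rw [h2, mul_one]
    rfl
  · have h1 := hXσ.fderiv_pair_self hσ.1 hX y w
    have h2 : atPt (dForm σ) y ![ξ y, w] = 0 := hξ.2.2 y w
    rw [hy, zero_apply] at h1
    rw [h2]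
    linarith

/-- In a convex set of Reeb fields that preserve `σ` and contain the Reeb field of `σ`, the
Hamiltonians are positive: otherwise some convex combination with the Reeb field of `σ` vanishes at
the minimum of the Hamiltonian. -/
theorem IsReeb.pair_pos_of_convex [CompactSpace Y] {σ : DForm (2 * n + 1) Y 1} (hσ : IsContact σ)
    {ξ : VField (2 * n + 1) Y} (hξ : IsReeb σ ξ) {C : Set (VField (2 * n + 1) Y)}
    (hC : Convex ℝ C) (hξC : ξ ∈ C) (h : ∀ ζ ∈ C, Preserves ζ σ ∧
      ∃ τ : DForm (2 * n + 1) Y 1, IsContact τ ∧ IsReeb τ ζ)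
    {ζ : VField (2 * n + 1) Y} (hζ : ζ ∈ C) (y : Y) : 0 < pair σ ζ y := by
  obtain ⟨hp, τ, -, hτ⟩ := h ζ hζ
  have hg := hσ.1.pair hτ.1
  obtain ⟨y₀, -, hy₀⟩ := isCompact_univ.exists_isMinOn ⟨y, Set.mem_univ y⟩
    hg.continuous.continuousOn
  have hmin : ∀ z, pair σ ζ y₀ ≤ pair σ ζ z := fun z => hy₀ (Set.mem_univ z)
  refine lt_of_lt_of_le ?_ (hmin y)
  have hcrit := hp.eq_smul_of_fderiv_eq_zero hσ hξ hτ.1 (y := y₀) (IsLocalMin.fderiv_eq_zero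
    (.of_forall fun z => by
      simp only [(chartAt (Euc (2 * n + 1)) y₀).left_inv (mem_chart_source _ y₀)]
      exact hmin _))
  by_contra! hneg
  set g := pair σ ζ y₀ with hgdef
  have hg1 : 0 < 1 - g := by linarith
  -- This combination of `ζ y₀ = g • ξ y₀` and `ξ y₀` is zero.
  obtain ⟨-, τ', -, hτ'⟩ := h _ (hC hζ hξC (a := (1 - g)⁻¹) (b := -g * (1 - g)⁻¹) (by positivity)
    (mul_nonneg (by linarith) (by positivity)) (by field_simp; ring))
  have h1 := hτ'.2.1 y₀
  have h2 : pair τ' ζ y₀ = g * pair τ' ξ y₀ := by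
    have h3 := oneForm_const_smul (atPt τ' y₀) g (ξ y₀)
    exact (congrArg (fun v : Euc (2 * n + 1) => atPt τ' y₀ (fun _ => v)) hcrit).trans h3
  rw [pair_add_smul, h2] at h1
  ring_nf at h1
  exact zero_ne_one h1

variable [T2Space Y] [CompactSpace Y] [MeasurableSpace Y] [BorelSpace Y]

theorem contactIntegral_pair_mul_self_pos {σ : DForm (2 * n + 1) Y 1} (hσ : IsContact σ)
    {X : VField (2 * n + 1) Y} (hX : IsSmoothField X) (hXσ : Preserves X σ) (h0 : X ≠ 0) :
    0 < contactIntegral σ (fun y => pair σ X y * pair σ X y) := by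
  have hf := (hσ.1.pair hX).continuous
  obtain ⟨y, hy⟩ : ∃ y, pair σ X y ≠ 0 := by
    by_contra! h
    exact h0 (hXσ.eq_of_pair_eq hσ hX isSmoothField_zero (preserves_zero σ) fun y =>
      (h y).trans ((atPt σ y).map_coord_zero 0 rfl).symm)
  have hff : Continuous fun y => pair σ X y * pair σ X y := hf.mul hf
  rw [contactIntegral_self hσ hff]
  exact integral_volMeasure_pos hσ.isVolumeForm hff (fun y => mul_self_nonneg _)
    (mul_self_ne_zero.2 hy)

end Positivity

section Convexity

open MeasureTheory

theorem wedgePow_smul {V : Type*} [AddCommGroup V] [Module ℝ V] [TopologicalSpace V]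
    (α : V [⋀^Fin 1]→L[ℝ] ℝ) (β : V [⋀^Fin 2]→L[ℝ] ℝ) (c : ℝ) (n : ℕ) (v : Fin (2 * n + 1) → V) :
    wedgePow (c • α) (c • β) n v = c ^ (n + 1) * wedgePow α β n v := by
  have hB := twoForm_eq_half β
  rw [wedgePow_apply α β _ hB, wedgePow_apply (c • α) (c • β) (c • ((1 / 2 : ℝ) • twoFormBilin β))
    (fun u w => by
      rw [ContinuousAlternatingMap.smul_apply, hB u w]
      simp only [LinearMap.smul_apply, smul_eq_mul]
      ring)]
  simp only [skewSum, Finset.mul_sum]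
  refine Finset.sum_congr rfl fun π _ => ?_
  have h : ∀ k : Fin n, (c • (1 / 2 : ℝ) • twoFormBilin β) (v (π (pairFst k))) (v (π (pairSnd k))) =
      c * ((1 / 2 : ℝ) • twoFormBilin β) (v (π (pairFst k))) (v (π (pairSnd k))) := fun _ => rfl
  simp only [h, ContinuousAlternatingMap.smul_apply, smul_eq_mul]
  rw [Finset.prod_mul_distrib, Finset.prod_const, Finset.card_univ, Fintype.card_fin]
  ring

variable {n : ℕ} {Y : Type*} [TopologicalSpace Y] [ChartedSpace (Euc (2 * n + 1)) Y]

/-- The Leibniz rule for the exterior derivative of `f σ`. -/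
theorem dForm_smul_apply {m : ℕ} {Y : Type*} [TopologicalSpace Y] [ChartedSpace (Euc m) Y]
    [IsManifold (𝓡 m) ∞ Y] {σ : DForm m Y 1} (hσ : IsSmoothForm σ) {f : Y → ℝ}
    (hf : IsSmoothFun (m := m) f) (y : Y) {L : Euc m →L[ℝ] ℝ}
    (hL : HasFDerivAt (fun z => f ((chartAt (Euc m) y).symm z)) L (chartAt (Euc m) y y))
    (u w : Euc m) :
    atPt (dForm (fun y => f y • σ y)) y ![u, w] = f y * atPt (dForm σ) y ![u, w] +
      (L u * atPt σ y (fun _ => w) - L w * atPt σ y (fun _ => u)) := by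
  have ht : chartAt (Euc m) y y ∈ (chartAt (Euc m) y).target := mem_chart_target _ y
  have hd : DifferentiableAt ℝ (coordForm y σ) (chartAt (Euc m) y y) :=
    (hσ.contDiffAt ht).differentiableAt (by simp)
  have h1 := hL.smul hd.hasFDerivAt
  rw [(chartAt (Euc m) y).left_inv (mem_chart_source _ y), coordForm_self] at h1
  have h2 : HasFDerivAt (coordForm y (fun y => f y • σ y)) _ (chartAt (Euc m) y y) := h1
  rw [← coordForm_self, ← coordForm_self, coordForm_dForm (hσ.smul hf) ht, coordForm_dForm hσ ht,
    extDeriv_eq_derivBilin hd, extDeriv_eq_derivBilin h2.differentiableAt]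
  have h3 : ∀ u w, derivBilin (coordForm y (fun y => f y • σ y)) (chartAt (Euc m) y y) u w =
      f y * derivBilin (coordForm y σ) (chartAt (Euc m) y y) u w +
        L u * atPt σ y (fun _ => w) := fun u w => by
    have h4 := congrArg (fun T => T u (fun _ => w)) h2.fderiv
    exact h4
  rw [h3, h3]
  ring

variable [IsManifold (𝓡 (2 * n + 1)) ∞ Y]

theorem IsSmoothFun.inv {m : ℕ} {Y : Type*} [TopologicalSpace Y] [ChartedSpace (Euc m) Y]
    {f : Y → ℝ} (hf : IsSmoothFun (m := m) f) (h0 : ∀ y, f y ≠ 0) :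
    IsSmoothFun (m := m) (fun y => (f y)⁻¹) := fun p => (hf p).inv fun _ _ => h0 _

section Rescale

variable {σ : DForm (2 * n + 1) Y 1} {ξ ζ : VField (2 * n + 1) Y}

/-- The exterior derivative of `σ / σ(ζ)`; the derivative of `σ(ζ)` is `-ι_ζ dσ`. -/
theorem Preserves.dForm_inv_smul (hσ : IsContact σ) (hζ : IsSmoothField ζ) (hζσ : Preserves ζ σ)
    (h0 : ∀ y, pair σ ζ y ≠ 0) (y : Y) (u w : Euc (2 * n + 1)) :
    atPt (dForm (fun y => (pair σ ζ y)⁻¹ • σ y)) y ![u, w] =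
      (pair σ ζ y)⁻¹ * (atPt (dForm σ) y ![u, w] + (pair σ ζ y)⁻¹ *
        (atPt (dForm σ) y ![ζ y, u] * atPt σ y (fun _ => w) -
          atPt (dForm σ) y ![ζ y, w] * atPt σ y (fun _ => u))) := by
  have hg := hσ.1.pair hζ
  have ht : chartAt (Euc (2 * n + 1)) y y ∈ (chartAt (Euc (2 * n + 1)) y).target :=
    mem_chart_target _ y
  have hd := HasDerivAt.comp_hasFDerivAt (chartAt (Euc (2 * n + 1)) y y) (hasDerivAt_inv (h0 _))
    (((hg y).contDiffAt ((chartAt (Euc (2 * n + 1)) y).open_target.mem_nhds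
      ht)).differentiableAt (by simp)).hasFDerivAt
  have hy := (chartAt (Euc (2 * n + 1)) y).left_inv (mem_chart_source _ y)
  rw [dForm_smul_apply hσ.1 (hg.inv h0) y hd]
  simp only [smul_apply, smul_eq_mul, hy,
    hζσ.fderiv_pair_self hσ.1 hζ y]
  ring

theorem Preserves.isReeb_inv_smul (hσ : IsContact σ) (hζ : IsSmoothField ζ)
    (hζσ : Preserves ζ σ) (h0 : ∀ y, pair σ ζ y ≠ 0) :
    IsReeb (fun y => (pair σ ζ y)⁻¹ • σ y) ζ := by
  refine ⟨hζ, fun y => inv_mul_cancel₀ (h0 y), fun y v => ?_⟩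
  have h := hζσ.dForm_inv_smul hσ hζ h0 y (ζ y) v
  have h1 : atPt (dForm σ) y ![ζ y, ζ y] = 0 := by
    have := twoForm_swap (atPt (dForm σ) y) (ζ y) (ζ y)
    linarith
  have h2 : atPt σ y (fun _ => ζ y) = pair σ ζ y := rfl
  rw [h1, h2] at h
  refine h.trans ?_
  have := h0 y
  field_simp
  ring

/-- The pair `(h σ, d (h σ))` with `h = 1 / σ(ζ)` is `h` times the pullback of `(σ, dσ)` under the
unipotent map `v ↦ v - h σ(v) (ζ - σ(ζ) ξ)`. -/
theorem Preserves.topVal_volForm_inv_smul (hσ : IsContact σ) (hξ : IsReeb σ ξ)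
    (hζ : IsSmoothField ζ) (hζσ : Preserves ζ σ) (h0 : ∀ y, pair σ ζ y ≠ 0) (y : Y) :
    topVal (volForm (fun y => (pair σ ζ y)⁻¹ • σ y)) y =
      (pair σ ζ y)⁻¹ ^ (n + 1) * topVal (volForm σ) y := by
  set h := (pair σ ζ y)⁻¹ with hh
  let X : Euc (2 * n + 1) := (ζ y : Euc (2 * n + 1)) - pair σ ζ y • (ξ y : Euc (2 * n + 1))
  let c : Euc (2 * n + 1) →L[ℝ] ℝ := (-h) • oneFormLin (atPt σ y)
  let A : Euc (2 * n + 1) →L[ℝ] Euc (2 * n + 1) :=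
    ContinuousLinearMap.id ℝ (Euc (2 * n + 1)) + c.smulRight X
  have hc : ∀ v, c v = -h * atPt σ y (fun _ => v) := fun v => rfl
  have hξσ : atPt σ y (fun _ => ξ y) = 1 := hξ.2.1 y
  have hζσ' : atPt σ y (fun _ => ζ y) = pair σ ζ y := rfl
  have hX0 : atPt σ y (fun _ => X) = 0 := by
    refine (oneForm_sub_smul (atPt σ y) (ζ y) (ξ y) _).trans ?_
    rw [hξσ, hζσ']
    ring
  have hXd : ∀ w, atPt (dForm σ) y ![X, w] = atPt (dForm σ) y ![ζ y, w] := fun w => by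
    have h1 : atPt (dForm σ) y ![ξ y, w] = 0 := hξ.2.2 y w
    refine (twoForm_sub_smul (atPt (dForm σ) y) (ζ y) (ξ y) w _).trans ?_
    rw [h1, mul_zero, sub_zero]
  have e1 : (atPt σ y).compContinuousLinearMap A = atPt σ y := by
    ext v
    have hv : v = fun _ => v 0 := by ext1 i; rw [Subsingleton.elim i 0]
    rw [hv]
    have h1 : ((atPt σ y).compContinuousLinearMap A) (fun _ => v 0) =
      atPt σ y (fun _ => v 0 + c (v 0) • X) := rfl
    rw [h1, oneForm_const_add, oneForm_const_smul, hX0, mul_zero, add_zero]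
  have e2 : ∀ u w, (atPt (dForm σ) y).compContinuousLinearMap A ![u, w] =
      atPt (dForm σ) y ![u, w] + h * (atPt (dForm σ) y ![ζ y, u] * atPt σ y (fun _ => w) -
          atPt (dForm σ) y ![ζ y, w] * atPt σ y (fun _ => u)) := fun u w => by
    have h1 : (atPt (dForm σ) y).compContinuousLinearMap A ![u, w] =
        twoFormBilin (atPt (dForm σ) y) (u + c u • X) (w + c w • X) := by
      rw [twoFormBilin_apply, ContinuousAlternatingMap.compContinuousLinearMap_apply]
      congr 1
      ext i : 1
      fin_cases i <;> rfl
    have h2 : atPt (dForm σ) y ![X, X] = 0 := by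
      have := twoForm_swap (atPt (dForm σ) y) X X
      linarith
    have h3 := twoForm_swap (atPt (dForm σ) y) X u
    rw [h1]
    simp only [map_add, map_smul, LinearMap.add_apply, LinearMap.smul_apply, twoFormBilin_apply,
      smul_eq_mul, h2, h3, hXd, hc]
    ring
  have e3 : atPt (dForm (fun y => (pair σ ζ y)⁻¹ • σ y)) y =
      h • (atPt (dForm σ) y).compContinuousLinearMap A := by
    ext v
    have hv : v = ![v 0, v 1] := by ext1 i; fin_cases i <;> rfl
    rw [hv, ContinuousAlternatingMap.smul_apply, e2, hζσ.dForm_inv_smul hσ hζ h0, smul_eq_mul]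
  have e4 : atPt (fun y => (pair σ ζ y)⁻¹ • σ y) y =
      h • (atPt σ y).compContinuousLinearMap A := by
    rw [e1]; rfl
  have hw := wedgePow_comp_id_add (EuclideanSpace.basisFun (Fin (2 * n + 1)) ℝ).toBasis
    (atPt σ y) (atPt (dForm σ) y) X c
  rw [hc, hX0, mul_zero, add_zero, one_mul] at hw
  simp only [OrthonormalBasis.coe_toBasis] at hw
  rw [volForm_eq, volForm_eq, topVal_contactTop, topVal_contactTop, e3, e4, wedgePow_smul, hw]
  ring

theorem Preserves.isContact_inv_smul (hσ : IsContact σ) (hξ : IsReeb σ ξ)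
    (hζ : IsSmoothField ζ) (hζσ : Preserves ζ σ) (h0 : ∀ y, pair σ ζ y ≠ 0) :
    IsContact (fun y => (pair σ ζ y)⁻¹ • σ y) := by
  refine ⟨hσ.1.smul ((hσ.1.pair hζ).inv h0), fun y hy => ?_⟩
  have h := hζσ.topVal_volForm_inv_smul hσ hξ hζ h0 y
  have h1 : volForm (fun y => (pair σ ζ y)⁻¹ • σ y) y = 0 := by
    unfold volForm
    rw [hy, smul_zero]
  have h2 : topVal (volForm (fun y => (pair σ ζ y)⁻¹ • σ y)) y = 0 :=
    congrArg (fun T : Euc (2 * n + 1) [⋀^Fin (2 * n + 1)]→L[ℝ] ℝ =>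
      T (fun i => EuclideanSpace.basisFun (Fin (2 * n + 1)) ℝ i)) h1
  rw [h2] at h
  exact mul_ne_zero (pow_ne_zero _ (inv_ne_zero (h0 y)))
    (topVal_ne_zero (hσ.volForm_ne_zero y)) h.symm

variable [T2Space Y] [CompactSpace Y] [MeasurableSpace Y] [BorelSpace Y]

/-- By uniqueness of the volume, this is the volume of the Reeb field `ζ`, as a function of its
Hamiltonian `σ(ζ)`. -/
theorem Preserves.contactVolume_inv_smul (hσ : IsContact σ) (hξ : IsReeb σ ξ)
    (hζ : IsSmoothField ζ) (hζσ : Preserves ζ σ) (h0 : ∀ y, 0 < pair σ ζ y) :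
    contactVolume (fun y => (pair σ ζ y)⁻¹ • σ y) =
      ∫ y, (pair σ ζ y) ^ (-(n + 1 : ℤ)) ∂(volMeasure hσ.isVolumeForm) := by
  have h0' : ∀ y, pair σ ζ y ≠ 0 := fun y => (h0 y).ne'
  rw [contactVolume_eq_contactIntegral, contactIntegral_eq hσ
    (hζσ.isContact_inv_smul hσ hξ hζ h0') continuous_const]
  congr 1
  ext y
  rw [one_mul, ratio, hζσ.topVal_volForm_inv_smul hσ hξ hζ h0',
    mul_div_cancel_right₀ _ (topVal_ne_zero (hσ.volForm_ne_zero y)),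
    abs_of_pos (pow_pos (inv_pos.2 (h0 y)) _), zpow_neg, inv_pow]
  norm_cast

theorem strictConvexOn_contactVolume (hσ : IsContact σ) (hξ : IsReeb σ ξ)
    {C : Set (VField (2 * n + 1) Y)} (hC : Convex ℝ C) (hξC : ξ ∈ C)
    (h : ∀ ζ ∈ C, Preserves ζ σ ∧ ∃ τ : DForm (2 * n + 1) Y 1, IsContact τ ∧ IsReeb τ ζ)
    {Vol : VField (2 * n + 1) Y → ℝ} (hVol : ∀ (τ : DForm (2 * n + 1) Y 1)
      (ζ : VField (2 * n + 1) Y), IsContact τ → IsReeb τ ζ → Vol ζ = contactVolume τ) :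
    StrictConvexOn ℝ C Vol := by
  have hpos : ∀ ζ ∈ C, ∀ y, 0 < pair σ ζ y := fun ζ hζ y =>
    hξ.pair_pos_of_convex hσ hC hξC h hζ y
  have hsm : ∀ ζ ∈ C, IsSmoothField ζ := fun ζ hζ => (h ζ hζ).2.choose_spec.2.1
  have hV : ∀ ζ ∈ C, Vol ζ =
      ∫ y, (pair σ ζ y) ^ (-(n + 1 : ℤ)) ∂(volMeasure hσ.isVolumeForm) := fun ζ hζ => by
    have h0 : ∀ y, pair σ ζ y ≠ 0 := fun y => (hpos ζ hζ y).ne'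
    rw [hVol _ _ ((h ζ hζ).1.isContact_inv_smul hσ hξ (hsm ζ hζ) h0)
      ((h ζ hζ).1.isReeb_inv_smul hσ (hsm ζ hζ) h0),
      (h ζ hζ).1.contactVolume_inv_smul hσ hξ (hsm ζ hζ) (hpos ζ hζ)]
  have hcont : ∀ ζ ∈ C, Continuous fun y => (pair σ ζ y) ^ (-(n + 1 : ℤ)) := fun ζ hζ =>
    (hσ.1.pair (hsm ζ hζ)).continuous.zpow₀ _ fun y => Or.inl (hpos ζ hζ y).ne'
  refine ⟨hC, fun ζ₁ h₁ ζ₂ h₂ hne a b ha hb hab => ?_⟩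
  have h₃ := hC h₁ h₂ ha.le hb.le hab
  obtain ⟨y, hy⟩ : ∃ y, pair σ ζ₁ y ≠ pair σ ζ₂ y := by
    by_contra! heq
    exact hne ((h ζ₁ h₁).1.eq_of_pair_eq hσ (hsm _ h₁) (hsm _ h₂) (h ζ₂ h₂).1 heq)
  have hφ := strictConvexOn_zpow (m := -(n + 1 : ℤ)) (by omega) (by omega)
  have c12 : Continuous fun y => a * pair σ ζ₁ y ^ (-(n + 1 : ℤ)) +
      b * pair σ ζ₂ y ^ (-(n + 1 : ℤ)) := ((hcont _ h₁).const_mul a).add ((hcont _ h₂).const_mul b)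
  have hlt := integral_volMeasure_pos hσ.isVolumeForm
    (g := fun y => (a * pair σ ζ₁ y ^ (-(n + 1 : ℤ)) + b * pair σ ζ₂ y ^ (-(n + 1 : ℤ))) -
      pair σ (a • ζ₁ + b • ζ₂) y ^ (-(n + 1 : ℤ)))
    (c12.sub (hcont _ h₃))
    (fun z => by
      have := hφ.convexOn.2 (hpos _ h₁ z) (hpos _ h₂ z) ha.le hb.le hab
      rw [pair_add_smul]
      exact sub_nonneg.2 this) (y := y) (by
      have := hφ.2 (hpos _ h₁ y) (hpos _ h₂ y) hy ha hb hab
      rw [pair_add_smul]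
      exact (sub_pos.2 this).ne')
  rw [integral_sub (integrable_of_continuous c12) (integrable_of_continuous (hcont _ h₃)),
    integral_add (integrable_of_continuous ((hcont _ h₁).const_mul a))
      (integrable_of_continuous ((hcont _ h₂).const_mul b)), integral_const_mul,
    integral_const_mul, ← hV _ h₁, ← hV _ h₂, ← hV _ h₃] at hlt
  exact sub_pos.1 hlt

end Rescale

end Convexity

end ContactVolume

end

open ContactVolume in
theorem mainTheorem1 (n : ℕ) (Y : Type*) [TopologicalSpace Y]
    [ChartedSpace (EuclideanSpace ℝ (Fin (2 * n + 1))) Y]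
    [IsManifold (𝓡 (2 * n + 1)) ∞ Y] [T2Space Y] [CompactSpace Y] :
    -- the contact volume is a functional `Vol` of the Reeb vector field alone
    ∃ Vol : VField (2 * n + 1) Y → ℝ,
      (∀ (σ : DForm (2 * n + 1) Y 1) (ξ : VField (2 * n + 1) Y),
        IsContact σ → IsReeb σ ξ → Vol ξ = contactVolume σ) ∧
      -- first variation, along any smooth one-parameter family of contact forms
      (∀ (ε : ℝ) (σ : ℝ → DForm (2 * n + 1) Y 1) (ξ : ℝ → VField (2 * n + 1) Y)
        (ξ' : VField (2 * n + 1) Y), 0 < ε →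
        IsSmoothFamily (Set.Ioo (-ε) ε) σ →
        (∀ t ∈ Set.Ioo (-ε) ε, IsContact (σ t) ∧ IsReeb (σ t) (ξ t)) →
        (∀ y, HasDerivAt (fun t => ξ t y) (ξ' y) 0) →
        HasDerivAt (fun t => Vol (ξ t))
          (-((n : ℝ) + 1) * contactIntegral (σ 0) (pair (σ 0) ξ')) 0) ∧
      -- second variation: the derivative of the first variation in the direction `ξ'`
      (∀ (ε : ℝ) (σ : ℝ → DForm (2 * n + 1) Y 1) (ξ : ℝ → VField (2 * n + 1) Y)
        (ξ' ξ'' : VField (2 * n + 1) Y), 0 < ε →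
        IsSmoothFamily (Set.Ioo (-ε) ε) σ →
        (∀ t ∈ Set.Ioo (-ε) ε, IsContact (σ t) ∧ IsReeb (σ t) (ξ t)) →
        (∀ y, HasDerivAt (fun t => ξ t y) (ξ'' y) 0) →
        IsSmoothField ξ' → Preserves ξ' (σ 0) →
        HasDerivAt (fun t => -((n : ℝ) + 1) * contactIntegral (σ t) (pair (σ t) ξ'))
          (((n : ℝ) + 1) * ((n : ℝ) + 2) *
            contactIntegral (σ 0) (fun y => pair (σ 0) ξ' y * pair (σ 0) ξ'' y)) 0) ∧
      -- the same as a mixed second derivative of `Vol` along two-parameter families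
      (∀ (ε : ℝ) (σ : ℝ × ℝ → DForm (2 * n + 1) Y 1) (ξ : ℝ × ℝ → VField (2 * n + 1) Y)
        (ξ' ξ'' : VField (2 * n + 1) Y), 0 < ε →
        IsSmoothFamily (Set.Ioo (-ε) ε ×ˢ Set.Ioo (-ε) ε) σ →
        (∀ q ∈ Set.Ioo (-ε) ε ×ˢ Set.Ioo (-ε) ε, IsContact (σ q) ∧ IsReeb (σ q) (ξ q)) →
        (∀ t ∈ Set.Ioo (-ε) ε, ∀ y, HasDerivAt (fun s => ξ (s, t) y) (ξ' y) 0) →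
        (∀ y, HasDerivAt (fun t => ξ (0, t) y) (ξ'' y) 0) →
        IsSmoothField ξ' → Preserves ξ' (σ (0, 0)) →
        HasDerivAt (fun t => deriv (fun s => Vol (ξ (s, t))) 0)
          (((n : ℝ) + 1) * ((n : ℝ) + 2) *
            contactIntegral (σ (0, 0))
              (fun y => pair (σ (0, 0)) ξ' y * pair (σ (0, 0)) ξ'' y)) 0) ∧
      -- the second variation is positive definite on vector fields preserving the contact form
      (∀ (σ : DForm (2 * n + 1) Y 1) (ξ' : VField (2 * n + 1) Y),
        IsContact σ → IsSmoothField ξ' → Preserves ξ' σ → ξ' ≠ 0 →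
        0 < ((n : ℝ) + 1) * ((n : ℝ) + 2) *
          contactIntegral σ (fun y => pair σ ξ' y * pair σ ξ' y)) ∧
      -- hence `Vol` is strictly convex on every convex set of Reeb vector fields that contains
      -- the Reeb vector field of `σ` and consists of fields preserving `σ`
      (∀ (σ : DForm (2 * n + 1) Y 1) (ξ : VField (2 * n + 1) Y)
        (C : Set (VField (2 * n + 1) Y)),
        IsContact σ → IsReeb σ ξ → Convex ℝ C → ξ ∈ C →
        (∀ ζ ∈ C, Preserves ζ σ ∧ ∃ τ : DForm (2 * n + 1) Y 1, IsContact τ ∧ IsReeb τ ζ) →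
        StrictConvexOn ℝ C Vol) := by
  classical
  let : MeasurableSpace Y := borel Y
  have : BorelSpace Y := ⟨rfl⟩
  -- The value `0` at fields that are not Reeb fields is arbitrary.
  let Vol : VField (2 * n + 1) Y → ℝ := fun ξ =>
    if h : ∃ σ : DForm (2 * n + 1) Y 1, IsContact σ ∧ IsReeb σ ξ then contactVolume h.choose else 0
  have hVol : ∀ (σ : DForm (2 * n + 1) Y 1) (ξ : VField (2 * n + 1) Y),
      IsContact σ → IsReeb σ ξ → Vol ξ = contactVolume σ := fun σ ξ hσ hξ => by
    have h : ∃ σ : DForm (2 * n + 1) Y 1, IsContact σ ∧ IsReeb σ ξ := ⟨σ, hσ, hξ⟩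
    have h1 : Vol ξ = contactVolume h.choose := dif_pos h
    rw [h1]
    exact hξ.contactVolume_eq hσ h.choose_spec.1 h.choose_spec.2
  have hfirst : ∀ (ε : ℝ) (σ : ℝ → DForm (2 * n + 1) Y 1) (ξ : ℝ → VField (2 * n + 1) Y)
      (ξ' : VField (2 * n + 1) Y), 0 < ε → IsSmoothFamily (Set.Ioo (-ε) ε) σ →
      (∀ t ∈ Set.Ioo (-ε) ε, IsContact (σ t) ∧ IsReeb (σ t) (ξ t)) →
      (∀ y, HasDerivAt (fun t => ξ t y) (ξ' y) 0) →
      HasDerivAt (fun t => Vol (ξ t))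
        (-((n : ℝ) + 1) * contactIntegral (σ 0) (pair (σ 0) ξ')) 0 := by
    intro ε σ ξ ξ' hε hσ hc hξ
    refine (hasDerivAt_contactVolume hε hσ hc hξ).congr_of_eventuallyEq ?_
    filter_upwards [isOpen_Ioo.mem_nhds (⟨neg_lt_zero.2 hε, hε⟩ : (0 : ℝ) ∈ Set.Ioo (-ε) ε)]
      with t ht
    exact hVol _ _ (hc t ht).1 (hc t ht).2
  have hsecond : ∀ (ε : ℝ) (σ : ℝ → DForm (2 * n + 1) Y 1) (ξ : ℝ → VField (2 * n + 1) Y)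
      (ξ' ξ'' : VField (2 * n + 1) Y), 0 < ε → IsSmoothFamily (Set.Ioo (-ε) ε) σ →
      (∀ t ∈ Set.Ioo (-ε) ε, IsContact (σ t) ∧ IsReeb (σ t) (ξ t)) →
      (∀ y, HasDerivAt (fun t => ξ t y) (ξ'' y) 0) → IsSmoothField ξ' → Preserves ξ' (σ 0) →
      HasDerivAt (fun t => -((n : ℝ) + 1) * contactIntegral (σ t) (pair (σ t) ξ'))
        (((n : ℝ) + 1) * ((n : ℝ) + 2) *
          contactIntegral (σ 0) (fun y => pair (σ 0) ξ' y * pair (σ 0) ξ'' y)) 0 :=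
    fun ε σ ξ ξ' ξ'' hε hσ hc hξ hX hXσ =>
      ((hasDerivAt_contactIntegral_pair hε hσ hc hξ hX hXσ).const_mul _).congr_deriv (by ring)
  refine ⟨Vol, hVol, hfirst, hsecond, ?_, fun σ ξ' hσ hX hXσ h0 => ?_,
    fun σ ξ C hσ hξ hC hξC h => strictConvexOn_contactVolume hσ hξ hC hξC h hVol⟩
  · intro ε σ ξ ξ' ξ'' hε hσ hc hs ht hX hXσ
    have hz : (0 : ℝ) ∈ Set.Ioo (-ε) ε := ⟨neg_lt_zero.2 hε, hε⟩
    refine (hsecond ε (fun t => σ (0, t)) (fun t => ξ (0, t)) ξ' ξ'' hε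
      (fun p => (hσ p).comp ((contDiff_const.prodMk contDiff_fst).prodMk contDiff_snd).contDiffOn
        fun q hq => ⟨⟨hz, hq.1⟩, hq.2⟩)
      (fun t ht => hc _ ⟨hz, ht⟩) ht hX hXσ).congr_of_eventuallyEq ?_
    filter_upwards [isOpen_Ioo.mem_nhds hz] with t ht
    exact (hfirst ε (fun s => σ (s, t)) (fun s => ξ (s, t)) ξ' hε
      (fun p => (hσ p).comp ((contDiff_fst.prodMk contDiff_const).prodMk contDiff_snd).contDiffOn
        fun q hq => ⟨⟨hq.1, ht⟩, hq.2⟩)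
      (fun s hs => hc _ ⟨hs, ht⟩) (hs t ht)).deriv
  · have := contactIntegral_pair_mul_self_pos hσ hX hXσ h0
    positivity
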